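/- All groups are finite, and a class of groups is closed under isomorphism. For a group $G$ let $\pi(G)$ be the set of prime divisors of $|G|$, and for a class $\mathfrak F$ of groups let $\pi(\mathfrak F)=\bigcup_{G\in\mathfrak F}\pi(G)$. A formation is a class of groups that is closed under quotients and contains $G/(M\cap N)$ whenever $M,N\trianglelefteq G$ and it contains $G/M$ and $G/N$; it is hereditary if it is closed under subgroups. A Schmidt group is a non-nilpotent group all of whose proper subgroups are nilpotent. A formation $\mathfrak F$ has the Shemetkov property if every group that is not in $\mathfrak F$ but has all its proper subgroups in $\mathfrak F$ is a Schmidt group or a group of prime order. A group $G$ is the mutually permutable product of its subgroups $A$ and $B$ if $G=AB$, $A$ permutes with every subgroup of $B$, and $B$ permutes with every subgroup of $A$ (subgroups $X$, $Y$ permute if $XY=YX$). Let $\mathfrak F$ be a hereditary formation with the Shemetkov property. Then the following are equivalent: 1. every group $G$ that is the mutually permutable product of two subgroups $A,B\in\mathfrak F$ belongs to $\mathfrak F$; 2. every supersoluble Schmidt group $G$ with $\pi(G)\subseteq\pi(\mathfrak F)$ belongs to $\mathfrak F$. -/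

import Mathlib

universe u

open scoped Pointwise

/-- A class of finite groups: a property of finite groups that is invariant under isomorphism. -/
structure FiniteGroupClass where
  mem : ∀ (G : Type u) [Group G] [Finite G], Prop
  mem_of_mulEquiv : ∀ (G H : Type u) [Group G] [Finite G] [Group H] [Finite H],
    (G ≃* H) → mem G → mem H

/-- The set of prime divisors of the order of a finite group. -/
def groupPrimes (G : Type u) [Group G] : Set ℕ :=
  {p : ℕ | p.Prime ∧ p ∣ Nat.card G}

/-- A Schmidt group: a finite non-nilpotent group all of whose proper subgroups are nilpotent. -/
def IsSchmidtGroup (G : Type u) [Group G] : Prop :=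
  Finite G ∧ ¬ Group.IsNilpotent G ∧ ∀ H : Subgroup G, H ≠ ⊤ → Group.IsNilpotent H

/-- A supersoluble group: it has a finite series from `⊥` to `⊤` of subgroups that are
normal in the whole group, with cyclic factors. Here `(H (i + 1)).map (mk' (H i))` is the factor
`H (i + 1) / H i` as a subgroup of `G / H i`. -/
def IsSupersoluble (G : Type u) [Group G] : Prop :=
  ∃ (n : ℕ) (H : ℕ → Subgroup G) (_ : ∀ i, (H i).Normal),
    H 0 = ⊥ ∧ H n = ⊤ ∧
      ∀ i < n, H i ≤ H (i + 1) ∧ IsCyclic ((H (i + 1)).map (QuotientGroup.mk' (H i)))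

/-- Two subgroups permute: `A B = B A` as sets. -/
def SubgroupsPermute {G : Type u} [Group G] (A B : Subgroup G) : Prop :=
  (A : Set G) * (B : Set G) = (B : Set G) * (A : Set G)

/-- `G` is the mutually permutable product of its subgroups `A` and `B`: `G = A B`, `A` permutes
with every subgroup of `B`, and `B` permutes with every subgroup of `A`. -/
structure IsMutuallyPermutableProduct {G : Type u} [Group G] (A B : Subgroup G) : Prop where
  mul_eq_univ : (A : Set G) * (B : Set G) = Set.univ
  left_permutes : ∀ K : Subgroup G, K ≤ B → SubgroupsPermute A K
  right_permutes : ∀ K : Subgroup G, K ≤ A → SubgroupsPermute B K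

namespace FiniteGroupClass

/-- A formation: a class of finite groups closed under quotients and such that
`G / (M ∩ N)` is in the class whenever `G / M` and `G / N` are. -/
structure IsFormation (F : FiniteGroupClass.{u}) : Prop where
  quotient_mem : ∀ (G : Type u) [Group G] [Finite G] (N : Subgroup G) [N.Normal],
    F.mem G → F.mem (G ⧸ N)
  quotient_inf_mem : ∀ (G : Type u) [Group G] [Finite G] (M N : Subgroup G) [M.Normal] [N.Normal],
    F.mem (G ⧸ M) → F.mem (G ⧸ N) → F.mem (G ⧸ (M ⊓ N))

/-- Closed under taking subgroups. -/
def IsHereditary (F : FiniteGroupClass.{u}) : Prop :=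
  ∀ (G : Type u) [Group G] [Finite G] (H : Subgroup G), F.mem G → F.mem H

/-- `G` is `s`-critical for `F`: it is not in `F` but all its proper subgroups are. -/
def IsSCritical (F : FiniteGroupClass.{u}) (G : Type u) [Group G] [Finite G] : Prop :=
  ¬ F.mem G ∧ ∀ H : Subgroup G, H ≠ ⊤ → F.mem H

/-- The Shemetkov property: every `s`-critical group for `F` is a Schmidt group or a group of
prime order. -/
def HasShemetkovProperty (F : FiniteGroupClass.{u}) : Prop :=
  ∀ (G : Type u) [Group G] [Finite G],
    F.IsSCritical G → IsSchmidtGroup G ∨ (Nat.card G).Prime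

/-- The set of all primes dividing the order of some group in `F`. -/
def primes (F : FiniteGroupClass.{u}) : Set ℕ :=
  {p : ℕ | ∃ (G : Type u) (_ : Group G) (_ : Finite G), F.mem G ∧ p ∈ groupPrimes G}

/-- Every finite group which is the mutually permutable product of two subgroups from `F`
is in `F`. -/
def ClosedUnderMutuallyPermutableProducts (F : FiniteGroupClass.{u}) : Prop :=
  ∀ (G : Type u) [Group G] [Finite G] (A B : Subgroup G),
    IsMutuallyPermutableProduct A B → F.mem A → F.mem B → F.mem G

end FiniteGroupClass

open scoped commutatorElement

/-! ### Formations with the Shemetkov property: critical subgroups and nilpotent members -/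

namespace FiniteGroupClass

variable {F : FiniteGroupClass.{u}}

/-! From 1 to 2: in a supersoluble Schmidt group, take the first term of the cyclic normal series
that is not in the Frattini subgroup and a maximal subgroup not containing it. These are proper and
form a mutually permutable product (`exists_coatom_product_of_isSupersoluble`). Both are nilpotent,
and by the Shemetkov property nilpotent groups with primes in `F.primes` lie in `F`
(`mem_of_isNilpotent`).

From 2 to 1: the core is a local description of `F`. A Schmidt group is `P⟨z⟩` with `P` a normal
`p`-subgroup and `z` a `q`-element (`IsSchmidtGroup.exists_isPrimaryExtension`). For primes `p`, `q`
of `F`, Schmidt groups of type `(p, q)` are all in `F` or all outside it (`mem_of_isSchmidtGroup`).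
If `P` is elementary abelian, this holds because the action is always multiplication by a primitive
`q`-th root of unity on one cyclotomic field; the general case follows by pulling back along a cover
whose kernel is free over `ZMod (p ^ 2)`. So a group with primes in `F.primes` is in `F` exactly
when, for every critical pair `(p, q)`, each `q`-element normalizing a `p`-subgroup centralizes it.
With the Frattini argument this yields `mem_of_product_of_normal_le`: a product of two members of
`F` is in `F` as soon as some normal subgroup inside both factors has its quotient in `F`.

Now induct on the order of `G = AB`. Unless `A ∩ B = 1` and `B` is simple, there is a proper
nontrivial normal subgroup `K` of `B` containing `A ∩ B`, since `A ∩ B` permutes with every subgroup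
of `B`. By induction `AK` is in `F`; it contains the normal closure of `K`, and either `G` is in `F`
or `AK` is normal. Symmetrically one gets `BH`, and `G = (AK)(BH)` is handled by the product
criterion with `N = AK ∩ BH`. If `A ∩ B = 1` and one factor is simple, `normalCore_ne_bot_or_normal`
leads to a normal factor. The other factor then normalizes all subgroups of the normal one, so only
`q`-elements acting on cyclic `p`-groups matter. Their Schmidt subgroups are supersoluble, and
condition 2 applies. -/

theorem mem_congr {G H : Type u} [Group G] [Finite G] [Group H] [Finite H] (e : G ≃* H) :
    F.mem G ↔ F.mem H :=
  ⟨F.mem_of_mulEquiv G H e, F.mem_of_mulEquiv H G e.symm⟩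

theorem IsHereditary.mem_of_injective (hF : F.IsHereditary) {G H : Type u} [Group G] [Finite G]
    [Group H] [Finite H] (f : G →* H) (hf : Function.Injective f) (h : F.mem H) : F.mem G :=
  (mem_congr (MonoidHom.ofInjective hf)).2 (hF H f.range h)

theorem IsHereditary.mem_of_le (hF : F.IsHereditary) {G : Type u} [Group G] [Finite G]
    {H K : Subgroup G} (hle : H ≤ K) (h : F.mem K) : F.mem H :=
  hF.mem_of_injective (Subgroup.inclusion hle) (Subgroup.inclusion_injective hle) h

theorem mem_top_iff {G : Type u} [Group G] [Finite G] : F.mem (⊤ : Subgroup G) ↔ F.mem G :=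
  mem_congr Subgroup.topEquiv

theorem IsFormation.mem_of_surjective (hF : F.IsFormation) {G H : Type u} [Group G] [Finite G]
    [Group H] [Finite H] (f : G →* H) (hf : Function.Surjective f) (h : F.mem G) : F.mem H :=
  (mem_congr (QuotientGroup.quotientKerEquivOfSurjective f hf)).1 (hF.quotient_mem G f.ker h)

theorem IsFormation.mem_map (hF : F.IsFormation) {G H : Type u} [Group G] [Finite G]
    [Group H] [Finite H] (f : G →* H) {A : Subgroup G} (h : F.mem A) : F.mem (A.map f) :=
  hF.mem_of_surjective (f.subgroupMap A) (f.subgroupMap_surjective A) h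

theorem IsFormation.mem_of_inf_eq_bot (hF : F.IsFormation) {G : Type u} [Group G] [Finite G]
    (M N : Subgroup G) [M.Normal] [N.Normal] (h : M ⊓ N = ⊥) (hM : F.mem (G ⧸ M))
    (hN : F.mem (G ⧸ N)) : F.mem G :=
  (mem_congr ((QuotientGroup.quotientMulEquivOfEq h).trans QuotientGroup.quotientBot)).1
    (hF.quotient_inf_mem G M N hM hN)

theorem mem_map_subtype_iff {G : Type u} [Group G] [Finite G] {H : Subgroup G}
    {K : Subgroup H} : F.mem (K.map H.subtype) ↔ F.mem K :=
  (mem_congr (K.equivMapOfInjective H.subtype H.subtype_injective)).symm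

theorem mem_subgroupOf_iff {G : Type u} [Group G] [Finite G] {H K : Subgroup G} (h : H ≤ K) :
    F.mem (H.subgroupOf K) ↔ F.mem H :=
  mem_congr (Subgroup.subgroupOfEquivOfLe h)

theorem exists_isSCritical {G : Type u} [Group G] [Finite G] (hG : ¬ F.mem G) :
    ∃ S : Subgroup G, F.IsSCritical S := by
  classical
  have hne : ∃ n, ∃ S : Subgroup G, ¬ F.mem S ∧ Nat.card S = n :=
    ⟨_, ⊤, fun h => hG (mem_top_iff.1 h), rfl⟩
  obtain ⟨S, hS, hcard⟩ := Nat.find_spec hne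
  refine ⟨S, hS, fun H hH => ?_⟩
  by_contra hcon
  refine Nat.find_min hne (m := Nat.card (H.map S.subtype)) ?_
    ⟨H.map S.subtype, fun h => hcon (mem_map_subtype_iff.1 h), rfl⟩
  rw [← hcard, Subgroup.card_map_of_injective S.subtype_injective]
  exact lt_of_le_of_ne (Nat.le_of_dvd Nat.card_pos (Subgroup.card_subgroup_dvd_card H))
    (fun h => hH (Subgroup.eq_top_of_card_eq H h))

theorem IsHereditary.mem_of_prime_card (hF : F.IsHereditary) {G : Type u} [Group G] [Finite G]
    (hG : (Nat.card G).Prime) (hp : Nat.card G ∈ F.primes) : F.mem G := by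
  obtain ⟨X, _, _, hX, -, hdvd⟩ := hp
  have := Fact.mk hG
  obtain ⟨x, hx⟩ := exists_prime_orderOf_dvd_card' (G := X) (Nat.card G) hdvd
  have : IsCyclic G := isCyclic_of_prime_card rfl
  exact F.mem_of_mulEquiv _ _
    (mulEquivOfCyclicCardEq (by rw [Nat.card_zpowers, hx])) (hF X (Subgroup.zpowers x) hX)

theorem groupPrimes_subset_of_injective {G H : Type*} [Group G] [Group H] [Finite H] (f : G →* H)
    (hf : Function.Injective f) : groupPrimes G ⊆ groupPrimes H :=
  fun _ hp => ⟨hp.1, hp.2.trans (Subgroup.card_dvd_of_injective f hf)⟩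

theorem groupPrimes_subgroup_subset {G : Type*} [Group G] [Finite G] (H : Subgroup G) :
    groupPrimes H ⊆ groupPrimes G :=
  groupPrimes_subset_of_injective H.subtype H.subtype_injective

theorem groupPrimes_subset_primes {G : Type u} [Group G] [Finite G] (h : F.mem G) :
    groupPrimes G ⊆ F.primes := fun _ hp => ⟨G, _, ‹_›, h, hp⟩

/-- The prime order alternative of the Shemetkov property cannot occur: a group of prime order
embeds in a member of `F` by Cauchy's theorem. -/
theorem exists_isSCritical_isSchmidtGroup (hher : F.IsHereditary) (hshem : F.HasShemetkovProperty)
    {G : Type u} [Group G] [Finite G] (hG : ¬ F.mem G) (hp : groupPrimes G ⊆ F.primes) :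
    ∃ S : Subgroup G, F.IsSCritical S ∧ IsSchmidtGroup S := by
  obtain ⟨S, hS⟩ := exists_isSCritical hG
  refine ⟨S, hS, (hshem S hS).resolve_right fun h => hS.1 ?_⟩
  exact hher.mem_of_prime_card h (hp (groupPrimes_subgroup_subset S ⟨h, dvd_rfl⟩))

theorem mem_of_isNilpotent (hher : F.IsHereditary) (hshem : F.HasShemetkovProperty)
    {G : Type u} [Group G] [Finite G] [Group.IsNilpotent G] (hp : groupPrimes G ⊆ F.primes) :
    F.mem G := by
  by_contra hG
  obtain ⟨S, -, hS⟩ := exists_isSCritical_isSchmidtGroup hher hshem hG hp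
  exact hS.2.1 inferInstance

end FiniteGroupClass

/-! ### Permuting subgroups -/

theorem SubgroupsPermute.symm {G : Type*} [Group G] {A B : Subgroup G}
    (h : SubgroupsPermute A B) : SubgroupsPermute B A := Eq.symm h

theorem SubgroupsPermute.exists_mul_eq {G : Type*} [Group G] {A B : Subgroup G}
    (h : SubgroupsPermute A B) {a b : G} (ha : a ∈ A) (hb : b ∈ B) :
    ∃ b' ∈ B, ∃ a' ∈ A, a * b = b' * a' := by
  have : a * b ∈ (A : Set G) * (B : Set G) := Set.mul_mem_mul ha hb
  rw [h] at this
  obtain ⟨b', hb', a', ha', h⟩ := this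
  exact ⟨b', hb', a', ha', h.symm⟩

theorem SubgroupsPermute.of_exists {G : Type*} [Group G] {A B : Subgroup G}
    (h : ∀ a ∈ A, ∀ b ∈ B, ∃ b' ∈ B, ∃ a' ∈ A, a * b = b' * a') : SubgroupsPermute A B := by
  refine Set.Subset.antisymm ?_ ?_
  · rintro _ ⟨a, ha, b, hb, rfl⟩
    obtain ⟨b', hb', a', ha', h⟩ := h a ha b hb
    exact ⟨b', hb', a', ha', h.symm⟩
  · rintro _ ⟨b, hb, a, ha, rfl⟩
    obtain ⟨b', hb', a', ha', h⟩ := h a⁻¹ (inv_mem ha) b⁻¹ (inv_mem hb)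
    refine ⟨a'⁻¹, inv_mem ha', b'⁻¹, inv_mem hb', ?_⟩
    simp only
    rw [← mul_inv_rev, ← h]
    simp

theorem SubgroupsPermute.mem_sup {G : Type*} [Group G] {A B : Subgroup G}
    (h : SubgroupsPermute A B) {g : G} : g ∈ A ⊔ B ↔ ∃ a ∈ A, ∃ b ∈ B, a * b = g := by
  let S : Subgroup G :=
    { carrier := {g | ∃ a ∈ A, ∃ b ∈ B, a * b = g}
      one_mem' := ⟨1, one_mem _, 1, one_mem _, one_mul 1⟩
      mul_mem' := by
        rintro _ _ ⟨a, ha, b, hb, rfl⟩ ⟨c, hc, d, hd, rfl⟩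
        obtain ⟨c', hc', b', hb', e⟩ := h.symm.exists_mul_eq hb hc
        refine ⟨a * c', mul_mem ha hc', b' * d, mul_mem hb' hd, ?_⟩
        rw [mul_assoc, ← mul_assoc c', ← e]
        group
      inv_mem' := by
        rintro _ ⟨a, ha, b, hb, rfl⟩
        obtain ⟨c, hc, d, hd, e⟩ := h.symm.exists_mul_eq (inv_mem hb) (inv_mem ha)
        exact ⟨c, hc, d, hd, by rw [← e, mul_inv_rev]⟩ }
  have hS : A ⊔ B ≤ S := sup_le (fun a ha => ⟨a, ha, 1, one_mem _, mul_one a⟩)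
    (fun b hb => ⟨1, one_mem _, b, hb, one_mul b⟩)
  refine ⟨fun hg => hS hg, ?_⟩
  rintro ⟨a, ha, b, hb, rfl⟩
  exact Subgroup.mul_mem_sup ha hb

theorem SubgroupsPermute.of_normal {G : Type*} [Group G] (A B : Subgroup G) [A.Normal] :
    SubgroupsPermute A B := by
  refine .of_exists fun a ha b hb => ⟨b, hb, b⁻¹ * a * b, ?_, by group⟩
  simpa using Subgroup.Normal.conj_mem ‹A.Normal› a ha b⁻¹

theorem IsMutuallyPermutableProduct.symm {G : Type*} [Group G] {A B : Subgroup G}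
    (h : IsMutuallyPermutableProduct A B) : IsMutuallyPermutableProduct B A :=
  ⟨(h.left_permutes B le_rfl).symm.trans h.mul_eq_univ, h.right_permutes, h.left_permutes⟩

theorem IsMutuallyPermutableProduct.exists_mul_eq {G : Type*} [Group G] {A B : Subgroup G}
    (h : IsMutuallyPermutableProduct A B) (g : G) : ∃ a ∈ A, ∃ b ∈ B, a * b = g := by
  have : g ∈ (A : Set G) * (B : Set G) := h.mul_eq_univ ▸ Set.mem_univ g
  exact this

/-! ### Factorizing supersoluble Schmidt groups: from 1 to 2 -/

theorem Group.IsNilpotent.commute_of_pow_eq_one {G : Type*} [Group G] [Finite G]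
    [Group.IsNilpotent G] {p q : ℕ} (hp : p.Prime) (hq : q.Prime) (hpq : p ≠ q) {x y : G}
    {i j : ℕ} (hx : x ^ p ^ i = 1) (hy : y ^ q ^ j = 1) : Commute x y := by
  have := Fact.mk hp
  have := Fact.mk hq
  have hX : IsPGroup p (Subgroup.zpowers x) :=
    IsPGroup.of_card_dvd_pow (n := i) (by
      rw [Nat.card_zpowers]; exact orderOf_dvd_of_pow_eq_one hx)
  have hY : IsPGroup q (Subgroup.zpowers y) :=
    IsPGroup.of_card_dvd_pow (n := j) (by
      rw [Nat.card_zpowers]; exact orderOf_dvd_of_pow_eq_one hy)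
  obtain ⟨P, hP⟩ := hX.exists_le_sylow
  obtain ⟨Q, hQ⟩ := hY.exists_le_sylow
  exact Subgroup.commute_of_normal_of_disjoint _ _ inferInstance inferInstance
    (IsPGroup.disjoint_of_ne p q hpq _ _ P.2 Q.2) x y
    (hP (Subgroup.mem_zpowers x)) (hQ (Subgroup.mem_zpowers y))

theorem exists_coatom_product_of_isSupersoluble {G : Type*} [Group G] [Finite G]
    (hG : IsSupersoluble G) (hnil : ¬ Group.IsNilpotent G) :
    ∃ A B : Subgroup G, A ≠ ⊤ ∧ B ≠ ⊤ ∧ IsMutuallyPermutableProduct A B := by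
  classical
  obtain ⟨n, H, hnorm, h0, hn, hH⟩ := hG
  have hnt : Nontrivial G := by
    by_contra hcon
    rw [not_nontrivial_iff_subsingleton] at hcon
    exact hnil inferInstance
  have hnF : ¬ H n ≤ frattini G := fun h => by
    obtain ⟨M, hM, -⟩ := (eq_top_or_exists_le_coatom (⊥ : Subgroup G)).resolve_left bot_ne_top
    exact hM.1 (top_unique (hn ▸ h.trans (frattini_le_coatom hM)))
  -- The least such index is some `i + 1`, since `H 0 = ⊥`; thus `H i` lies in every maximal
  -- subgroup while `H (i + 1)` avoids some `M`.
  have hex : ∃ j, ¬ H j ≤ frattini G := ⟨n, hnF⟩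
  have hjn : Nat.find hex ≤ n := Nat.find_min' hex hnF
  obtain ⟨i, hi⟩ : ∃ i, Nat.find hex = i + 1 := by
    refine Nat.exists_eq_succ_of_ne_zero fun h => ?_
    have := Nat.find_spec hex
    rw [h, h0] at this
    exact this bot_le
  have hA : ¬ H (i + 1) ≤ frattini G := hi ▸ Nat.find_spec hex
  have hHi : H i ≤ frattini G := not_not.1 (Nat.find_min hex (m := i) (by omega))
  obtain ⟨hle, hcyc⟩ := hH i (by omega)
  have hnH := hnorm i
  have hnA := hnorm (i + 1)
  obtain ⟨M, hM, hAM⟩ : ∃ M : Subgroup G, IsCoatom M ∧ ¬ H (i + 1) ≤ M := by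
    by_contra! hcon
    exact hA (by rw [frattini, Order.radical]; exact le_iInf₂ hcon)
  have hsup : H (i + 1) ⊔ M = ⊤ := by
    rw [sup_comm]
    exact hM.2 _ (lt_of_le_of_ne le_sup_left fun h => hAM (by rw [h]; exact le_sup_right))
  refine ⟨H (i + 1), M, fun htop => ?_, hM.1, ?_, fun K _ => .of_normal _ _, fun K hK => ?_⟩
  -- If `H (i + 1)` were everything, a generator modulo `H i` would generate `G`, as Frattini
  -- elements are non-generators; but `G` is not cyclic.
  · obtain ⟨⟨x, hx⟩, hgen⟩ := hcyc.exists_generator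
    obtain ⟨g, rfl⟩ := QuotientGroup.mk'_surjective (H i) x
    have hg : Subgroup.zpowers g ⊔ H i = ⊤ := by
      refine top_unique fun y _ => ?_
      obtain ⟨k, hk⟩ := Subgroup.mem_zpowers_iff.1
        (hgen ⟨QuotientGroup.mk' (H i) y, Subgroup.mem_map_of_mem _ (htop ▸ Subgroup.mem_top y)⟩)
      have hk' : ((g ^ k : G) : G ⧸ H i) = (y : G ⧸ H i) := by
        simpa using congrArg Subtype.val hk
      rw [QuotientGroup.eq] at hk'
      rw [← mul_inv_cancel_left (g ^ k) y]
      exact Subgroup.mul_mem_sup (zpow_mem (Subgroup.mem_zpowers g) k) hk'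
    have htop' : Subgroup.zpowers g = ⊤ :=
      frattini_nongenerating (top_unique (hg ▸ sup_le_sup_left hHi _))
    have : IsCyclic G := ⟨g, fun y => by rw [← Subgroup.mem_zpowers_iff, htop']; trivial⟩
    exact hnil (@CommGroup.isNilpotent G IsCyclic.commGroup)
  · rw [← Subgroup.normal_mul, hsup]; rfl
  -- Conjugation acts on the cyclic factor as a power map, so `m * k * m⁻¹` is a power of `k` up to
  -- an element of `H i`, which is absorbed into `M`.
  · refine .of_exists fun m hm k hk => ?_
    have hcA : ((H (i + 1)).map (QuotientGroup.mk' (H i))).Normal :=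
      hnA.map _ (QuotientGroup.mk'_surjective _)
    obtain ⟨e, he⟩ := MonoidHom.map_cyclic
      (MulAut.conjNormal (H := (H (i + 1)).map (QuotientGroup.mk' (H i)))
        (QuotientGroup.mk' (H i) m)).toMonoidHom
    have h1 := congrArg Subtype.val
      (he ⟨QuotientGroup.mk' (H i) k, Subgroup.mem_map_of_mem _ (hK hk)⟩)
    have h2 : ((k ^ e : G) : G ⧸ H i) = ((m * k * m⁻¹ : G) : G ⧸ H i) := by
      simpa using h1.symm
    rw [QuotientGroup.eq] at h2
    refine ⟨k ^ e, zpow_mem hk e, (k ^ e)⁻¹ * (m * k * m⁻¹) * m,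
      mul_mem (frattini_le_coatom hM (hHi h2)) hm, by group⟩

theorem FiniteGroupClass.mem_of_isSupersoluble {F : FiniteGroupClass.{u}}
    (hher : F.IsHereditary) (hshem : F.HasShemetkovProperty)
    (hclosed : F.ClosedUnderMutuallyPermutableProducts) {G : Type u} [Group G] [Finite G]
    (hG : IsSchmidtGroup G) (hsup : IsSupersoluble G) (hp : groupPrimes G ⊆ F.primes) :
    F.mem G := by
  obtain ⟨A, B, hA, hB, hAB⟩ := exists_coatom_product_of_isSupersoluble hsup hG.2.1
  have := hG.2.2 A hA
  have := hG.2.2 B hB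
  exact hclosed G A B hAB
    (mem_of_isNilpotent hher hshem ((groupPrimes_subgroup_subset A).trans hp))
    (mem_of_isNilpotent hher hshem ((groupPrimes_subgroup_subset B).trans hp))

/-! ### Primary parts of elements -/

theorem Nat.exists_dvd_mul_pow_and_modEq_one {q : ℕ} (hq : q.Prime) {n : ℕ} (hn : n ≠ 0) (N : ℕ) :
    ∃ m a : ℕ, n ∣ m * q ^ a ∧ m ≡ 1 [MOD q ^ N] := by
  obtain ⟨a, n', hn', rfl⟩ := Nat.exists_eq_pow_mul_and_not_dvd hn q hq.ne_one
  obtain ⟨m, h1, h2⟩ := Nat.chineseRemainder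
    (((Nat.Prime.coprime_iff_not_dvd hq).2 hn').pow_left N) 1 0
  refine ⟨m, a, ?_, h1⟩
  rw [mul_comm m]
  exact mul_dvd_mul_left _ ((Nat.modEq_zero_iff_dvd).1 h2)

theorem pow_eq_self_of_modEq_one {G : Type*} [Group G] {n m : ℕ} {z : G} (hz : z ^ n = 1)
    (hm : m ≡ 1 [MOD n]) : z ^ m = z := by
  have := (pow_eq_pow_iff_modEq (x := z) (n := m) (m := 1)).2
    (hm.of_dvd (orderOf_dvd_of_pow_eq_one hz))
  simpa using this

/-- Raising `g` to the power `m` extracts the `q`-part of `g`, and fixes the elements whose order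
divides `q ^ N`. -/
theorem exists_pow_primePart {G : Type*} [Group G] [Finite G] {q : ℕ} (hq : q.Prime) (g : G)
    (N : ℕ) : ∃ m a : ℕ, (g ^ m) ^ q ^ a = 1 ∧ m ≡ 1 [MOD q ^ N] := by
  obtain ⟨m, a, h1, h2⟩ := Nat.exists_dvd_mul_pow_and_modEq_one hq (orderOf_pos g).ne' N
  exact ⟨m, a, by rw [← pow_mul]; exact orderOf_dvd_iff_pow_eq_one.1 h1, h2⟩

/-- Every element is a product of powers of itself having prime power order (Bézout). -/
theorem Subgroup.le_of_forall_primePow {G : Type*} [Group G] [Finite G] {H K : Subgroup G}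
    (h : ∀ q : ℕ, q.Prime → ∀ a : ℕ, ∀ z ∈ H, z ^ q ^ a = 1 → z ∈ K) : H ≤ K := by
  have key : ∀ n : ℕ, ∀ g ∈ H, orderOf g = n → g ∈ K := by
    intro n
    induction n using Nat.recOnPosPrimePosCoprime with
    | prime_pow p a hp ha =>
      exact fun g hg hn => h p hp a g hg (hn ▸ pow_orderOf_eq_one g)
    | zero => exact fun g _ hn => absurd hn (orderOf_pos g).ne'
    | one => exact fun g _ hn => orderOf_eq_one_iff.1 hn ▸ one_mem K
    | coprime a b ha hb hab iha ihb =>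
      intro g hg hn
      have h1 : g ^ b ∈ K := iha _ (pow_mem hg b) (by
        rw [orderOf_pow' _ (by omega), hn, Nat.gcd_eq_right (Dvd.intro_left _ rfl),
          Nat.mul_div_cancel _ (by omega)])
      have h2 : g ^ a ∈ K := ihb _ (pow_mem hg a) (by
        rw [orderOf_pow' _ (by omega), hn, Nat.gcd_eq_right (Dvd.intro _ rfl),
          Nat.mul_div_cancel_left _ (by omega)])
      have h3 := Nat.gcd_eq_gcd_ab a b
      rw [hab.gcd_eq_one] at h3
      rw [← zpow_one g, ← Nat.cast_one, h3, zpow_add, zpow_mul, zpow_mul]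
      exact mul_mem (zpow_mem (by simpa using h2) _) (zpow_mem (by simpa using h1) _)
  exact fun g hg => key _ g hg rfl

/-! ### Minimal non-nilpotent groups have a normal maximal subgroup -/

theorem Subgroup.exists_mem_normalizer_of_lt {G : Type*} [Group G] {D M : Subgroup G}
    [Group.IsNilpotent M] (h : D < M) : ∃ x ∈ M, x ∉ D ∧ x ∈ Subgroup.normalizer (D : Set G) := by
  have hlt : D.subgroupOf M < ⊤ := by
    rw [lt_top_iff_ne_top, Ne, Subgroup.subgroupOf_eq_top]
    exact h.not_ge
  obtain ⟨x, hx, hxD⟩ := SetLike.exists_of_lt (Group.normalizerCondition_of_isNilpotent _ hlt)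
  rw [Subgroup.mem_normalizer_iff] at hx
  refine ⟨x, x.2, fun hD => hxD (Subgroup.mem_subgroupOf.2 hD), ?_⟩
  rw [Subgroup.mem_normalizer_iff]
  intro d
  constructor
  · intro hd
    exact Subgroup.mem_subgroupOf.1 ((hx ⟨d, h.le hd⟩).1 (Subgroup.mem_subgroupOf.2 hd))
  · intro hd
    have hdM : d ∈ M := by
      have := mul_mem (mul_mem (inv_mem x.2) (h.le hd)) x.2
      simpa [mul_assoc] using this
    exact Subgroup.mem_subgroupOf.1 ((hx ⟨d, hdM⟩).2 (Subgroup.mem_subgroupOf.2 hd))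

theorem Subgroup.isCoatom_comap_conj {G : Type*} [Group G] {M : Subgroup G} (hM : IsCoatom M)
    (x : G) : IsCoatom (M.comap (MulAut.conj x).toMonoidHom) :=
  Subgroup.isCoatom_comap_of_surjective (MulAut.conj x).surjective hM

theorem isNilpotent_of_subgroup_quotient {G : Type*} [Group G] (D : Subgroup G) [D.Normal]
    (h : ∀ H : Subgroup G, H ≠ ⊤ → Group.IsNilpotent H) :
    ∀ H : Subgroup (G ⧸ D), H ≠ ⊤ → Group.IsNilpotent H := by
  intro H hH
  have hsurj := QuotientGroup.mk'_surjective D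
  have := h (H.comap (QuotientGroup.mk' D)) (fun he => hH (by
    rw [← Subgroup.map_comap_eq_self_of_surjective hsurj H, he,
      Subgroup.map_top_of_surjective _ hsurj]))
  exact Group.nilpotent_of_surjective ((QuotientGroup.mk' D).subgroupComap H)
    (MonoidHom.subgroupComap_surjective_of_surjective _ _ hsurj)

/-- Conjugates of `M` by distinct cosets meet trivially, so the non-identity elements they cover
number `(|M| - 1) * M.index`. -/
theorem card_conj_of_self_normalizing {G : Type*} [Group G] [Finite G] {M : Subgroup G}
    (hM : ∀ x : G, x ∉ M → M ⊓ M.comap (MulAut.conj x).toMonoidHom = ⊥) :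
    Nat.card {g : G | g ≠ 1 ∧ ∃ x : G, x⁻¹ * g * x ∈ M} + M.index = Nat.card G := by
  let f : (G ⧸ M) × {m : M // m ≠ 1} → {g : G | g ≠ 1 ∧ ∃ x : G, x⁻¹ * g * x ∈ M} :=
    fun c => ⟨c.1.out * c.2.1 * c.1.out⁻¹, by
      refine ⟨fun h => c.2.2 (Subtype.ext ?_), c.1.out, by simp [mul_assoc]⟩
      simpa using h⟩
  have hf : Function.Bijective f := by
    constructor
    · rintro ⟨c, m, hm⟩ ⟨d, n, hn⟩ h
      have h' : c.out * (m : G) * c.out⁻¹ = d.out * (n : G) * d.out⁻¹ := congrArg Subtype.val h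
      have hcd : c = d := by
        rw [← QuotientGroup.out_eq' c, ← QuotientGroup.out_eq' d, QuotientGroup.eq]
        by_contra hcon
        have hb := hM (d.out⁻¹ * c.out) (fun hmem => hcon (by simpa using inv_mem hmem))
        have hmem : (m : G) ∈ M ⊓ M.comap (MulAut.conj (d.out⁻¹ * c.out)).toMonoidHom := by
          refine ⟨m.2, ?_⟩
          have : d.out⁻¹ * c.out * m * (d.out⁻¹ * c.out)⁻¹ = n := by
            rw [mul_inv_rev, inv_inv]
            calc _ = d.out⁻¹ * (c.out * m * c.out⁻¹) * d.out := by group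
              _ = n := by rw [h']; group
          change d.out⁻¹ * c.out * m * (d.out⁻¹ * c.out)⁻¹ ∈ M
          exact this ▸ n.2
        rw [hb, Subgroup.mem_bot] at hmem
        exact hm (Subtype.ext hmem)
      subst hcd
      have : m = n := Subtype.ext (by simpa using h')
      subst this
      rfl
    · rintro ⟨g, hg, x, hx⟩
      obtain ⟨m, hm⟩ := QuotientGroup.mk_out_eq_mul M x
      have hmem : (x : G ⧸ M).out⁻¹ * g * (x : G ⧸ M).out ∈ M := by
        rw [hm]
        have := mul_mem (mul_mem (inv_mem m.2) hx) m.2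
        convert this using 1
        group
      refine ⟨⟨x, ⟨⟨_, hmem⟩, fun h => hg ?_⟩⟩, Subtype.ext ?_⟩
      · have := congrArg Subtype.val h
        simp only [OneMemClass.coe_one] at this
        rw [mul_assoc, inv_mul_eq_one] at this
        simpa using this
      · simp [f, mul_assoc]
  rw [← Nat.card_congr (Equiv.ofBijective f hf), Nat.card_prod, ← Subgroup.index_eq_card]
  have h1 : Nat.card {m : M // m ≠ 1} + 1 = Nat.card M := by
    classical
    have := Fintype.ofFinite M
    rw [Nat.card_eq_fintype_card, Nat.card_eq_fintype_card, Fintype.card_subtype_compl,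
      Fintype.card_subtype_eq]
    have : 0 < Fintype.card M := Fintype.card_pos
    omega
  rw [← Subgroup.index_mul_card M, ← h1]
  ring

/-- Counting: if no maximal subgroup is normal, each conjugacy class of maximal subgroups covers at
least half of `|G|` among the non-identity elements. One class is not enough to cover them all, and
two classes are disjoint, which is too many. -/
theorem exists_normal_coatom_of_inf_eq_bot {G : Type*} [Group G] [Finite G]
    (hG : ¬ IsCyclic G)
    (hinf : ∀ M₁ M₂ : Subgroup G, IsCoatom M₁ → IsCoatom M₂ → M₁ ≠ M₂ → M₁ ⊓ M₂ = ⊥) :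
    ∃ M : Subgroup G, M.Normal ∧ IsCoatom M := by
  by_contra! hcon
  have hnt : Nontrivial G := by
    by_contra h
    rw [not_nontrivial_iff_subsingleton] at h
    exact hG inferInstance
  have hcyc : ∀ g : G, Subgroup.zpowers g ≠ ⊤ := fun g hg =>
    hG ⟨g, fun y => by rw [← Subgroup.mem_zpowers_iff, hg]; trivial⟩
  have hcard : ∀ M : Subgroup G, IsCoatom M →
      Nat.card {g : G | g ≠ 1 ∧ ∃ x : G, x⁻¹ * g * x ∈ M} + M.index = Nat.card G := by
    intro M hM
    refine card_conj_of_self_normalizing fun x hx => ?_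
    refine hinf _ _ hM (Subgroup.isCoatom_comap_conj hM x) fun heq => hx ?_
    have hself : Subgroup.normalizer (M : Set G) = M := by
      by_contra hne
      have := hM.2 _ (lt_of_le_of_ne Subgroup.le_normalizer (Ne.symm hne))
      exact hcon M (Subgroup.normalizer_eq_top_iff.1 this) hM
    rw [← hself, Subgroup.mem_normalizer_iff]
    intro h
    conv_lhs => rw [heq]
    rfl
  have hindex : ∀ M : Subgroup G, IsCoatom M → 2 * M.index ≤ Nat.card G := by
    intro M hM
    rw [← Subgroup.card_mul_index M]
    refine Nat.mul_le_mul_right _ ?_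
    rw [Nat.succ_le_iff, Subgroup.one_lt_card_iff_ne_bot]
    rintro rfl
    obtain ⟨g, hg⟩ := exists_ne (1 : G)
    exact hcyc g (hM.2 _ (bot_lt_iff_ne_bot.2 (by simpa using hg)))
  obtain ⟨M₁, hM₁, -⟩ := (eq_top_or_exists_le_coatom (⊥ : Subgroup G)).resolve_left bot_ne_top
  obtain ⟨g, hg1, hg⟩ : ∃ g : G, g ≠ 1 ∧ ∀ x : G, x⁻¹ * g * x ∉ M₁ := by
    by_contra! hall
    have heq : {g : G | g ≠ 1 ∧ ∃ x : G, x⁻¹ * g * x ∈ M₁} = {1}ᶜ := by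
      ext g
      exact ⟨fun h => h.1, fun h => ⟨h, hall g h⟩⟩
    have h1 := hcard M₁ hM₁
    have h2 : M₁.index ≠ 1 := fun h => hM₁.1 (Subgroup.index_eq_one.1 h)
    rw [heq] at h1
    have h3 : Nat.card ({1}ᶜ : Set G) + 1 = Nat.card G := by
      have := Set.ncard_add_ncard_compl ({1} : Set G)
      rw [Set.ncard_singleton] at this
      rw [Nat.card_coe_set_eq]
      omega
    omega
  obtain ⟨M₂, hM₂, hgM₂⟩ := (eq_top_or_exists_le_coatom (Subgroup.zpowers g)).resolve_left (hcyc g)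
  have hdisj : Disjoint {g : G | g ≠ 1 ∧ ∃ x : G, x⁻¹ * g * x ∈ M₁}
      {g : G | g ≠ 1 ∧ ∃ x : G, x⁻¹ * g * x ∈ M₂} := by
    rw [Set.disjoint_left]
    rintro h ⟨h1, x, hx⟩ ⟨-, y, hy⟩
    have hxm : h ∈ M₁.comap (MulAut.conj x⁻¹).toMonoidHom := by simpa using hx
    have hym : h ∈ M₂.comap (MulAut.conj y⁻¹).toMonoidHom := by simpa using hy
    have heq : M₁.comap (MulAut.conj x⁻¹).toMonoidHom = M₂.comap (MulAut.conj y⁻¹).toMonoidHom := by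
      by_contra hne
      have := hinf _ _ (Subgroup.isCoatom_comap_conj hM₁ x⁻¹)
        (Subgroup.isCoatom_comap_conj hM₂ y⁻¹) hne
      exact h1 (Subgroup.mem_bot.1 (this ▸ ⟨hxm, hym⟩))
    have hgy : y * g * y⁻¹ ∈ M₂.comap (MulAut.conj y⁻¹).toMonoidHom := by
      simpa [mul_assoc] using hgM₂ (Subgroup.mem_zpowers g)
    rw [← heq] at hgy
    refine hg (y⁻¹ * x) ?_
    simpa [mul_assoc] using hgy
  have h1 := hcard M₁ hM₁
  have h2 := hcard M₂ hM₂
  have h3 := hindex M₁ hM₁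
  have h4 := hindex M₂ hM₂
  have h5 := Set.ncard_union_eq hdisj
  have h6 : ({g : G | g ≠ 1 ∧ ∃ x : G, x⁻¹ * g * x ∈ M₁} ∪
      {g : G | g ≠ 1 ∧ ∃ x : G, x⁻¹ * g * x ∈ M₂}).ncard < Nat.card G := by
    rw [← Set.ncard_univ]
    refine Set.ncard_lt_ncard (Set.ssubset_univ_iff.2 fun h => ?_)
    have : (1 : G) ∈ (Set.univ : Set G) := trivial
    rw [← h] at this
    rcases this with h | h <;> exact h.1 rfl
  rw [Nat.card_coe_set_eq] at h1 h2
  omega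

/-- If two maximal subgroups meet nontrivially, an intersection `D` of largest order is normal, and
induction applies to `G / D`; otherwise the counting lemma applies. -/
theorem exists_normal_coatom_of_minimal_nonnilpotent {G : Type u} [Group G] [Finite G]
    (hG : ¬ Group.IsNilpotent G) (h : ∀ H : Subgroup G, H ≠ ⊤ → Group.IsNilpotent H) :
    ∃ M : Subgroup G, M.Normal ∧ IsCoatom M := by
  induction hn : Nat.card G using Nat.strong_induction_on generalizing G with
  | _ n ih =>
  subst hn
  by_cases hinf : ∀ M₁ M₂ : Subgroup G, IsCoatom M₁ → IsCoatom M₂ → M₁ ≠ M₂ → M₁ ⊓ M₂ = ⊥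
  · refine exists_normal_coatom_of_inf_eq_bot (fun hc => hG ?_) hinf
    exact @CommGroup.isNilpotent G IsCyclic.commGroup
  push Not at hinf
  obtain ⟨M, N, hM, hN, hMN, hD⟩ := hinf
  obtain ⟨⟨M₁, M₂⟩, ⟨hM₁, hM₂, hne⟩, hmax⟩ := Set.exists_max_image
    {c : Subgroup G × Subgroup G | IsCoatom c.1 ∧ IsCoatom c.2 ∧ c.1 ≠ c.2}
    (fun c => Nat.card (c.1 ⊓ c.2 : Subgroup G)) (Set.toFinite _) ⟨(M, N), hM, hN, hMN⟩
  have hDbot : M₁ ⊓ M₂ ≠ ⊥ := by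
    intro hbot
    have := hmax (M, N) ⟨hM, hN, hMN⟩
    simp only [hbot, Subgroup.card_bot] at this
    exact hD ((Subgroup.card_le_one_iff_eq_bot _).1 this)
  have hlt : ∀ M' M'' : Subgroup G, IsCoatom M' → IsCoatom M'' → M' ≠ M'' → M' ⊓ M'' < M' :=
    fun M' M'' h' h'' hne' => inf_lt_left.2 fun hle =>
      hne' ((h'.le_iff.1 hle).resolve_left h''.1).symm
  have hmax' : ∀ M' M'' : Subgroup G, IsCoatom M' → IsCoatom M'' →
      M₁ ⊓ M₂ < M' ⊓ M'' → M' = M'' := by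
    intro M' M'' h' h'' hl
    by_contra hne'
    have := hmax (M', M'') ⟨h', h'', hne'⟩
    exact hl.ne (Subgroup.eq_of_le_of_card_ge hl.le this)
  -- Normalizers grow in the nilpotent groups `M₁` and `M₂`. A maximal subgroup containing the
  -- normalizer of the intersection therefore meets each of them in more than the intersection, and
  -- so equals both.
  have hnorm : (M₁ ⊓ M₂).Normal := by
    rw [← Subgroup.normalizer_eq_top_iff]
    by_contra hN'
    obtain ⟨M₃, hM₃, hle⟩ := (eq_top_or_exists_le_coatom _).resolve_left hN'
    have hle' : M₁ ⊓ M₂ ≤ M₃ := Subgroup.le_normalizer.trans hle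
    have := h M₁ hM₁.1
    have := h M₂ hM₂.1
    obtain ⟨x, hx, hxD, hxN⟩ := Subgroup.exists_mem_normalizer_of_lt (hlt M₁ M₂ hM₁ hM₂ hne)
    obtain ⟨y, hy, hyD, hyN⟩ := Subgroup.exists_mem_normalizer_of_lt
      (inf_comm M₁ M₂ ▸ hlt M₂ M₁ hM₂ hM₁ hne.symm)
    have e1 : M₃ = M₁ := hmax' _ _ hM₃ hM₁
      ⟨le_inf hle' inf_le_left, fun hl => hxD (hl ⟨hle hxN, hx⟩)⟩
    have e2 : M₃ = M₂ := hmax' _ _ hM₃ hM₂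
      ⟨le_inf hle' inf_le_right, fun hl => hyD (hl ⟨hle hyN, hy⟩)⟩
    exact hne (e1.symm.trans e2)
  have hsurj := QuotientGroup.mk'_surjective (M₁ ⊓ M₂)
  obtain ⟨K, hK, hKc⟩ : ∃ K : Subgroup (G ⧸ M₁ ⊓ M₂), K.Normal ∧ IsCoatom K := by
    by_cases hnil : Group.IsNilpotent (G ⧸ M₁ ⊓ M₂)
    · have hnt : (⊥ : Subgroup (G ⧸ M₁ ⊓ M₂)) ≠ ⊤ := by
        intro hbt
        refine hM₁.1 (top_unique fun x _ => ?_)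
        have hx : (x : G ⧸ M₁ ⊓ M₂) ∈ (⊥ : Subgroup (G ⧸ M₁ ⊓ M₂)) := hbt ▸ Subgroup.mem_top _
        exact ((QuotientGroup.eq_one_iff x).1 (Subgroup.mem_bot.1 hx)).1
      obtain ⟨K, hK, -⟩ := (eq_top_or_exists_le_coatom _).resolve_left hnt
      exact ⟨K, (Group.isNilpotent_of_finite_tfae.out 0 2 rfl rfl).1 hnil K hK, hK⟩
    · refine ih _ ?_ hnil (isNilpotent_of_subgroup_quotient _ h) rfl
      rw [← Subgroup.index_eq_card, ← Subgroup.card_mul_index (M₁ ⊓ M₂)]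
      exact lt_mul_of_one_lt_left (Nat.pos_of_ne_zero Subgroup.index_ne_zero_of_finite)
        ((Subgroup.one_lt_card_iff_ne_bot _).2 hDbot)
  exact ⟨K.comap (QuotientGroup.mk' _), hK.comap _, Subgroup.isCoatom_comap_of_surjective hsurj hKc⟩

/-! ### Schmidt groups are generated by a normal p-subgroup and a q-element -/

/-- `G` is generated by a normal `p`-subgroup and a `q`-element. -/
def IsPrimaryExtension (p q : ℕ) (G : Type*) [Group G] : Prop :=
  ∃ (P : Subgroup G) (z : G), P.Normal ∧ IsPGroup p P ∧ (∃ a, z ^ q ^ a = 1) ∧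
    P ⊔ Subgroup.zpowers z = ⊤

theorem isPGroup_zpowers {G : Type*} [Group G] {p a : ℕ} {x : G} (hx : x ^ p ^ a = 1) :
    IsPGroup p (Subgroup.zpowers x) :=
  IsPGroup.of_card_dvd_pow (n := a) (by
    rw [Nat.card_zpowers]; exact orderOf_dvd_of_pow_eq_one hx)

theorem IsPGroup.exists_pow_eq_one {G : Type*} [Group G] {p : ℕ} {P : Subgroup G}
    (hP : IsPGroup p P) {x : G} (hx : x ∈ P) : ∃ a, x ^ p ^ a = 1 := by
  obtain ⟨a, ha⟩ := isPGroup_iff_pow_pow_eq_one.1 hP ⟨x, hx⟩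
  exact ⟨a, by simpa using congrArg Subtype.val ha⟩

theorem eq_one_of_pow_prime_pow {G : Type*} [Group G] {p q : ℕ} (hp : p.Prime) (hq : q.Prime)
    (hpq : p ≠ q) {x : G} {a b : ℕ} (h1 : x ^ p ^ a = 1) (h2 : x ^ q ^ b = 1) : x = 1 := by
  rw [← orderOf_eq_one_iff]
  exact Nat.eq_one_of_dvd_coprimes (Nat.coprime_pow_primes a b hp hq hpq)
    (orderOf_dvd_of_pow_eq_one h1) (orderOf_dvd_of_pow_eq_one h2)

theorem mem_of_sup_zpowers_eq_top {G : Type*} [Group G] {p q : ℕ} (hp : p.Prime) (hq : q.Prime)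
    (hpq : p ≠ q) {M : Subgroup G} [M.Normal] {z : G} {b : ℕ} (hz : z ^ q ^ b = 1)
    (htop : M ⊔ Subgroup.zpowers z = ⊤) {x : G} {a : ℕ} (hx : x ^ p ^ a = 1) : x ∈ M := by
  obtain ⟨m, hm, y, hy, hxy⟩ := Subgroup.mem_sup_of_normal_left.1
    (htop ▸ Subgroup.mem_top x : x ∈ M ⊔ Subgroup.zpowers z)
  obtain ⟨k, rfl⟩ := Subgroup.mem_zpowers_iff.1 hy
  rw [← QuotientGroup.eq_one_iff]
  refine eq_one_of_pow_prime_pow hp hq hpq (a := a) (b := b) ?_ ?_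
  · rw [← QuotientGroup.mk_pow, hx, QuotientGroup.mk_one]
  · rw [← hxy, QuotientGroup.mk_mul, (QuotientGroup.eq_one_iff m).2 hm, one_mul,
      ← QuotientGroup.mk_pow, ← zpow_natCast, ← zpow_mul, mul_comm, zpow_mul, zpow_natCast, hz,
      one_zpow, QuotientGroup.mk_one]

theorem exists_normal_isPGroup_mem {G : Type*} [Group G] [Finite G] {M : Subgroup G} [M.Normal]
    [Group.IsNilpotent M] {p : ℕ} (hp : p.Prime) {x : G} (hx : x ∈ M) {a : ℕ}
    (hxa : x ^ p ^ a = 1) : ∃ P : Subgroup G, P.Normal ∧ IsPGroup p P ∧ P ≤ M ∧ x ∈ P := by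
  have := Fact.mk hp
  obtain ⟨P, hP⟩ := (isPGroup_zpowers (x := (⟨x, hx⟩ : M)) (p := p) (a := a)
    (Subtype.ext (by simpa using hxa))).exists_le_sylow
  have := P.characteristic_of_normal inferInstance
  exact ⟨P.1.map M.subtype, ConjAct.normal_of_characteristic_of_normal, P.2.map _,
    Subgroup.map_subtype_le _, ⟨x, hx⟩, hP (Subgroup.mem_zpowers _), rfl⟩

/-- Let `z` be a `q`-element outside a normal maximal subgroup `M`. If no normal `p`-subgroup inside
`M` with `p ≠ q` generated `G` together with `z`, then `z` would centralize all `q'`-elements of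
`M`; every Sylow subgroup would be normal and `G` nilpotent. -/
theorem IsSchmidtGroup.exists_isPrimaryExtension {G : Type u} [Group G] (hG : IsSchmidtGroup G) :
    ∃ p q : ℕ, p.Prime ∧ q.Prime ∧ p ≠ q ∧ IsPrimaryExtension p q G := by
  obtain ⟨hfin, hnil, hsub⟩ := hG
  obtain ⟨M, hM, hMc⟩ := exists_normal_coatom_of_minimal_nonnilpotent hnil hsub
  have hMnil := hsub M hMc.1
  obtain ⟨q, hq, b, z, hz, hzM⟩ : ∃ q : ℕ, q.Prime ∧ ∃ b : ℕ, ∃ z : G, z ^ q ^ b = 1 ∧ z ∉ M := by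
    by_contra! hcon
    exact hMc.1 (top_unique (Subgroup.le_of_forall_primePow
      fun q hq a z _ hz => hcon q hq a z hz))
  have htop : M ⊔ Subgroup.zpowers z = ⊤ := hMc.2 _
    (lt_of_le_of_ne le_sup_left fun h => hzM (h ▸ Subgroup.mem_sup_right (Subgroup.mem_zpowers z)))
  by_contra! hcon
  have hcomm : ∀ p : ℕ, p.Prime → p ≠ q → ∀ a : ℕ, ∀ x ∈ M, x ^ p ^ a = 1 → Commute x z := by
    intro p hp hpq a x hx hxa
    obtain ⟨P, hPn, hPp, -, hxP⟩ := exists_normal_isPGroup_mem hp hx hxa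
    have := hsub (P ⊔ Subgroup.zpowers z) fun h => hcon p q hp hq hpq ⟨P, z, hPn, hPp, ⟨b, hz⟩, h⟩
    have h := Group.IsNilpotent.commute_of_pow_eq_one hp hq hpq (i := a) (j := b)
      (x := (⟨x, Subgroup.mem_sup_left hxP⟩ : (P ⊔ Subgroup.zpowers z : Subgroup G)))
      (y := ⟨z, Subgroup.mem_sup_right (Subgroup.mem_zpowers z)⟩)
      (Subtype.ext (by simpa using hxa)) (Subtype.ext (by simpa using hz))
    exact congrArg Subtype.val h
  refine hnil ((Group.isNilpotent_of_finite_tfae.out 0 3 rfl rfl).2 fun r hr S => ?_)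
  by_cases hrq : r = q
  · subst hrq
    obtain ⟨T, hT⟩ := (isPGroup_zpowers hz).exists_le_sylow
    have hzT : z ∈ T := hT (Subgroup.mem_zpowers z)
    -- It suffices to test elements of prime power order: those of order a power of `r` lie in a
    -- normal `r`-subgroup, hence in `T`, and the others centralize `T`, whose elements have the
    -- form `m * z ^ k` with `m ∈ M ∩ T`.
    have hMT : M ≤ Subgroup.normalizer (T.1 : Set G) := by
      refine Subgroup.le_of_forall_primePow fun p hp a x hx hxa => ?_
      by_cases hpr : p = r
      · subst hpr
        obtain ⟨P, hPn, hPp, -, hxP⟩ := exists_normal_isPGroup_mem hp hx hxa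
        exact Subgroup.le_normalizer (hPp.le_sylow_of_normal T hxP)
      · have hc : ∀ t ∈ T, Commute x t := by
          intro t ht
          obtain ⟨m, hm, y, hy, hxy⟩ := Subgroup.mem_sup_of_normal_left.1
            (htop ▸ Subgroup.mem_top t : t ∈ M ⊔ Subgroup.zpowers z)
          obtain ⟨k, rfl⟩ := Subgroup.mem_zpowers_iff.1 hy
          have hmT : m ∈ T.1 := by
            have : m = t * (z ^ k)⁻¹ := by rw [← hxy]; group
            exact this ▸ mul_mem ht (inv_mem (zpow_mem hzT k))
          obtain ⟨c, hc⟩ := T.2.exists_pow_eq_one hmT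
          have h := Group.IsNilpotent.commute_of_pow_eq_one hp hq hpr (i := a) (j := c)
            (x := (⟨x, hx⟩ : M)) (y := ⟨m, hm⟩)
            (Subtype.ext (by simpa using hxa)) (Subtype.ext (by simpa using hc))
          rw [← hxy]
          exact (show Commute x m from congrArg Subtype.val h).mul_right
            ((hcomm p hp hpr a x hx hxa).zpow_right k)
        exact Subgroup.centralizer_le_normalizer (T.1 : Set G)
          (Subgroup.mem_centralizer_iff.2 fun t ht => (hc t ht).symm)
    have hTn : T.1.Normal := by
      rw [← Subgroup.normalizer_eq_top_iff]
      refine top_unique (htop ▸ sup_le hMT ?_)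
      rw [Subgroup.zpowers_le]
      exact Subgroup.le_normalizer hzT
    have := T.unique_of_normal hTn
    rw [Subsingleton.elim S T]
    exact hTn
  · have hSM : S.1 ≤ M := fun s hs => by
      obtain ⟨a, ha⟩ := S.2.exists_pow_eq_one hs
      exact mem_of_sup_zpowers_eq_top hr.out hq hrq hz htop ha
    have := (S.subtype hSM).characteristic_of_normal inferInstance
    have h := ConjAct.normal_of_characteristic_of_normal (K := (S.subtype hSM).1)
    rwa [Sylow.coe_subtype, Subgroup.map_subgroupOf_eq_of_le hSM] at h

/-! ### Minimally nontrivial coprime automorphisms of p-groups -/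

/-- The automorphism `σ` is nontrivial, and is trivial on every proper `σ`-invariant subgroup. -/
structure MulAut.IsMinimallyNontrivial {P : Type*} [Group P] (σ : MulAut P) : Prop where
  ne_one : σ ≠ 1
  apply_eq : ∀ W : Subgroup P, W ≠ ⊤ → (∀ x ∈ W, σ x ∈ W) → ∀ x ∈ W, σ x = x

namespace MulAut

variable {P : Type*} [Group P] {σ : MulAut P} {p q b : ℕ}

/-- With `m = σ x * x⁻¹` fixed, `σ ^ k` sends `x` to `m ^ k * x`. Hence the order of `m` divides a
power of `q`, while `m` is a `p`-element. -/
theorem apply_eq_of_apply_mul_inv_eq (hp : p.Prime) (hq : q.Prime) (hpq : p ≠ q)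
    (hP : IsPGroup p P) (hσ : σ ^ q ^ b = 1) {x : P}
    (hx : σ (σ x * x⁻¹) = σ x * x⁻¹) : σ x = x := by
  set m := σ x * x⁻¹ with hm
  have hxm : σ x = m * x := by rw [hm]; group
  have key : ∀ k : ℕ, (σ ^ k) x = m ^ k * x := by
    intro k
    induction k with
    | zero => simp
    | succ k ih => rw [pow_succ', MulAut.mul_apply, ih, map_mul, map_pow, hx, pow_succ, mul_assoc,
        ← hxm]
  have h1 : m ^ q ^ b = 1 := by
    have := key (q ^ b)
    rw [hσ, MulAut.one_apply] at this
    exact (right_eq_mul.1 this)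
  obtain ⟨a, ha⟩ := isPGroup_iff_pow_pow_eq_one.1 hP m
  rw [hxm, eq_one_of_pow_prime_pow hp hq hpq ha h1, one_mul]

namespace IsMinimallyNontrivial

/-- The subgroup `[P, σ]` is invariant; were it proper, `σ` would fix it pointwise and then be
trivial by coprimality. -/
theorem closure_eq_top (h : σ.IsMinimallyNontrivial) (hp : p.Prime) (hq : q.Prime) (hpq : p ≠ q)
    (hP : IsPGroup p P) (hσ : σ ^ q ^ b = 1) :
    Subgroup.closure (Set.range fun x => σ x * x⁻¹) = ⊤ := by
  by_contra hne
  refine h.ne_one (MulEquiv.ext fun x => ?_)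
  refine apply_eq_of_apply_mul_inv_eq hp hq hpq hP hσ
    (h.apply_eq _ hne ?_ _ (Subgroup.subset_closure ⟨x, rfl⟩))
  intro y hy
  have : Subgroup.closure (Set.range fun x => σ x * x⁻¹) ≤
      (Subgroup.closure (Set.range fun x => σ x * x⁻¹)).comap σ.toMonoidHom := by
    rw [Subgroup.closure_le]
    rintro _ ⟨x, rfl⟩
    exact Subgroup.subset_closure ⟨σ x, by simp⟩
  exact this hy

/-- Since `σ` fixes both `d` and `y⁻¹ * d * y`, the element `d` commutes with `σ y * y⁻¹`, and such
elements generate `P`. -/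
theorem commute_of_mem (h : σ.IsMinimallyNontrivial) (hp : p.Prime) (hq : q.Prime) (hpq : p ≠ q)
    (hP : IsPGroup p P) (hσ : σ ^ q ^ b = 1) {D : Subgroup P} [hD : D.Normal] (hne : D ≠ ⊤)
    (hinv : ∀ x ∈ D, σ x ∈ D) {d : P} (hd : d ∈ D) (x : P) : Commute d x := by
  have hfix := h.apply_eq D hne hinv
  have hle : Subgroup.closure (Set.range fun x => σ x * x⁻¹) ≤ Subgroup.centralizer {d} := by
    rw [Subgroup.closure_le]
    rintro _ ⟨y, rfl⟩
    rw [SetLike.mem_coe, Subgroup.mem_centralizer_singleton_iff]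
    have h1 := hfix _ (hD.conj_mem d hd y⁻¹)
    rw [inv_inv, map_mul, map_mul, map_inv, hfix d hd] at h1
    have h2 : d * (σ y * y⁻¹) = σ y * ((σ y)⁻¹ * d * σ y) * y⁻¹ := by group
    rw [h2, h1]
    group
  rw [h.closure_eq_top hp hq hpq hP hσ] at hle
  exact (Subgroup.mem_centralizer_singleton_iff.1 (hle (Subgroup.mem_top x))).symm

theorem nontrivial (h : σ.IsMinimallyNontrivial) : Nontrivial P := by
  by_contra hcon
  rw [not_nontrivial_iff_subsingleton] at hcon
  exact h.ne_one (MulEquiv.ext fun x => Subsingleton.elim _ _)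

theorem commutator_ne_top [Finite P] (h : σ.IsMinimallyNontrivial) (hp : p.Prime) (hP : IsPGroup p P) :
    commutator P ≠ ⊤ := by
  have := Fact.mk hp
  have := h.nontrivial
  have := hP.isNilpotent
  exact (Group.IsSolvable.commutator_lt_top_of_nontrivial P).ne

theorem apply_mem_commutator {x : P} (hx : x ∈ commutator P) : σ x ∈ commutator P := by
  have h := Subgroup.characteristic_iff_map_le.1 (inferInstance : (commutator P).Characteristic) σ
  exact h ⟨x, hx, rfl⟩

theorem commute_of_mem_commutator [Finite P] (h : σ.IsMinimallyNontrivial) (hp : p.Prime) (hq : q.Prime)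
    (hpq : p ≠ q) (hP : IsPGroup p P) (hσ : σ ^ q ^ b = 1) {d : P} (hd : d ∈ commutator P)
    (x : P) : Commute d x :=
  h.commute_of_mem hp hq hpq hP hσ (h.commutator_ne_top hp hP)
    (fun _ hx => apply_mem_commutator hx) hd x

/-- The `p`-th powers form a proper subgroup of the abelianization, so `σ` fixes its preimage
pointwise. Hence the generators `σ y * y⁻¹` have trivial `p`-th power modulo the derived subgroup.
-/
theorem pow_mem_commutator [Finite P] (h : σ.IsMinimallyNontrivial) (hp : p.Prime) (hq : q.Prime)
    (hpq : p ≠ q) (hP : IsPGroup p P) (hσ : σ ^ q ^ b = 1) (x : P) : x ^ p ∈ commutator P := by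
  have := Fact.mk hp
  have hpow : (powMonoidHom p : Abelianization P →* Abelianization P).range ≠ ⊤ := by
    intro htop
    have hinj := Finite.injective_iff_surjective.2 (MonoidHom.range_eq_top.1 htop)
    have hnt : Nontrivial (Abelianization P) :=
      QuotientGroup.nontrivial_iff.2 (h.commutator_ne_top hp hP)
    obtain ⟨n, hn, hc⟩ := (hP.to_quotient (commutator P)).nontrivial_iff_card.1 hnt
    obtain ⟨y, hy⟩ := exists_prime_orderOf_dvd_card' (G := Abelianization P) p
      (hc ▸ dvd_pow_self p hn.ne')
    have : y = 1 := hinj (by simp [← hy, pow_orderOf_eq_one])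
    rw [this, orderOf_one] at hy
    exact hp.one_lt.ne hy
  have hfix := h.apply_eq ((powMonoidHom p : Abelianization P →* Abelianization P).range.comap
    Abelianization.of) (fun htop => hpow (by
      rw [← Subgroup.map_comap_eq_self_of_surjective (f := Abelianization.of) (QuotientGroup.mk'_surjective (commutator P))
        (powMonoidHom p : Abelianization P →* Abelianization P).range, htop,
        Subgroup.map_top_of_surjective Abelianization.of (QuotientGroup.mk'_surjective (commutator P))])) (by
      rintro y ⟨v, hv⟩
      refine ⟨Abelianization.map σ.toMonoidHom v, ?_⟩
      have := congrArg (Abelianization.map σ.toMonoidHom) hv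
      simpa using this)
  rw [← Abelianization.ker_of, MonoidHom.mem_ker, map_pow]
  have hle : Subgroup.closure (Set.range fun x => σ x * x⁻¹) ≤
      ((powMonoidHom p : Abelianization P →* Abelianization P).comp Abelianization.of).ker := by
    rw [Subgroup.closure_le]
    rintro _ ⟨y, rfl⟩
    have h1 := hfix (y ^ p) ⟨Abelianization.of y, by simp⟩
    rw [SetLike.mem_coe, MonoidHom.mem_ker, MonoidHom.comp_apply, powMonoidHom_apply, map_mul,
      mul_pow, ← map_pow, ← map_pow σ, h1, map_inv, map_pow, inv_pow, mul_inv_cancel]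
  rw [h.closure_eq_top hp hq hpq hP hσ] at hle
  simpa using hle (Subgroup.mem_top x)

end IsMinimallyNontrivial

end MulAut

/-! ### The action of z on P in a Schmidt group -/

theorem isNilpotent_of_commute {G : Type*} [Group G] {P : Subgroup G} [Group.IsNilpotent P]
    {z : G} (hc : ∀ x ∈ P, Commute x z) (htop : P ⊔ Subgroup.zpowers z = ⊤) :
    Group.IsNilpotent G := by
  have hcomm : ∀ (x : P) (y : Subgroup.zpowers z), Commute (P.subtype x)
      ((Subgroup.zpowers z).subtype y) := by
    rintro x ⟨y, hy⟩
    obtain ⟨k, rfl⟩ := Subgroup.mem_zpowers_iff.1 hy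
    exact (hc x x.2).zpow_right k
  have : Group.IsNilpotent (Subgroup.zpowers z) :=
    @CommGroup.isNilpotent _ (IsCyclic.commGroup (α := Subgroup.zpowers z))
  refine Group.nilpotent_of_surjective (MonoidHom.noncommCoprod _ _ hcomm) ?_
  rw [← MonoidHom.range_eq_top, MonoidHom.noncommCoprod_range, Subgroup.range_subtype,
    Subgroup.range_subtype, htop]

section

variable {G : Type*} [Group G] {P : Subgroup G} {z : G} {p q b : ℕ}

theorem zpow_pow_eq_one {n : ℕ} (hz : z ^ n = 1) (k : ℤ) : (z ^ k) ^ n = 1 := by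
  rw [← zpow_natCast, ← zpow_mul, mul_comm, zpow_mul, zpow_natCast, hz, one_zpow]

theorem inf_zpowers_eq_bot (hp : p.Prime) (hq : q.Prime) (hpq : p ≠ q)
    (hP : IsPGroup p P) (hz : z ^ q ^ b = 1) : P ⊓ Subgroup.zpowers z = ⊥ := by
  rw [eq_bot_iff]
  rintro x ⟨hx, hxz⟩
  obtain ⟨k, rfl⟩ := Subgroup.mem_zpowers_iff.1 hxz
  obtain ⟨a, ha⟩ := hP.exists_pow_eq_one hx
  exact Subgroup.mem_bot.2 (eq_one_of_pow_prime_pow hp hq hpq ha (zpow_pow_eq_one hz k))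

/-- A trivial action would make `G` nilpotent. For a proper invariant `W`, the subgroup `W⟨z⟩` is
proper because `P ∩ ⟨z⟩ = 1`; it is therefore nilpotent, and its `p`- and `q`-elements commute. -/
theorem IsSchmidtGroup.isMinimallyNontrivial_conj (hG : IsSchmidtGroup G) [P.Normal]
    (hp : p.Prime) (hq : q.Prime) (hpq : p ≠ q) (hP : IsPGroup p P) (hz : z ^ q ^ b = 1)
    (htop : P ⊔ Subgroup.zpowers z = ⊤) :
    (MulAut.conjNormal z : MulAut P).IsMinimallyNontrivial := by
  obtain ⟨hfin, hnil, hsub⟩ := hG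
  have := Fact.mk hp
  constructor
  · intro h
    have := hP.isNilpotent
    refine hnil (isNilpotent_of_commute (P := P) (fun x hx => ?_) htop)
    have h1 := congrArg Subtype.val (DFunLike.congr_fun h ⟨x, hx⟩)
    simp only [MulAut.conjNormal_apply, MulAut.one_apply] at h1
    exact (mul_inv_eq_iff_eq_mul.1 h1).symm
  · intro W hW hinv x hx
    have hperm : (W.map P.subtype) ⊔ Subgroup.zpowers z ≠ ⊤ := by
      intro h
      have hnorm : z ∈ Subgroup.normalizer ((W.map P.subtype : Subgroup G) : Set G) := by
        rw [Subgroup.mem_normalizer_iff_map_conj_eq]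
        refine Subgroup.eq_of_le_of_card_ge ?_ ?_
        · rintro _ ⟨_, ⟨w, hw, rfl⟩, rfl⟩
          exact ⟨_, hinv w hw, by simp⟩
        · exact (Subgroup.card_map_of_injective (MulAut.conj z).injective).ge
      refine hW (top_unique fun y _ => ?_)
      have hle : Subgroup.zpowers z ≤
          Subgroup.normalizer ((W.map P.subtype : Subgroup G) : Set G) := by
        rwa [Subgroup.zpowers_le]
      have hy : (y : G) ∈ ((W.map P.subtype ⊔ Subgroup.zpowers z : Subgroup G) : Set G) :=
        h ▸ Subgroup.mem_top (y : G)
      rw [Subgroup.coe_mul_of_right_le_normalizer_left _ _ hle] at hy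
      obtain ⟨_, ⟨w, hw, rfl⟩, v, hv, hwv⟩ := hy
      have hvP : v ∈ P ⊓ Subgroup.zpowers z := by
        refine ⟨?_, hv⟩
        change v ∈ P
        have : v = (w : G)⁻¹ * y := by rw [← hwv]; simp
        rw [this]
        exact mul_mem (inv_mem w.2) y.2
      rw [inf_zpowers_eq_bot hp hq hpq hP hz, Subgroup.mem_bot] at hvP
      have : w = y := Subtype.ext (by simpa [hvP] using hwv)
      exact this ▸ hw
    have := hsub _ hperm
    obtain ⟨a, ha⟩ := hP.exists_pow_eq_one x.2
    have h := Group.IsNilpotent.commute_of_pow_eq_one hp hq hpq (i := a) (j := b)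
      (x := (⟨x, Subgroup.mem_sup_left ⟨x, hx, rfl⟩⟩ :
        (W.map P.subtype ⊔ Subgroup.zpowers z : Subgroup G)))
      (y := ⟨z, Subgroup.mem_sup_right (Subgroup.mem_zpowers z)⟩)
      (Subtype.ext (by simpa using ha)) (Subtype.ext (by simpa using hz))
    have h' : Commute (x : G) z := congrArg Subtype.val h
    refine Subtype.ext ?_
    rw [MulAut.conjNormal_apply, ← h'.eq]
    group

theorem IsSchmidtGroup.conj_pow_eq_one (hG : IsSchmidtGroup G) [P.Normal]
    (hp : p.Prime) (hq : q.Prime) (hpq : p ≠ q) (hP : IsPGroup p P) (hz : z ^ q ^ b = 1)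
    (htop : P ⊔ Subgroup.zpowers z = ⊤) : (MulAut.conjNormal z : MulAut P) ^ q = 1 := by
  have hmin := hG.isMinimallyNontrivial_conj hp hq hpq hP hz htop
  obtain ⟨hfin, hnil, hsub⟩ := hG
  -- Otherwise `z ^ (1 - q * k) = 1` for some `k`, which is impossible when `q` divides the order of
  -- `z`. Properness gives nilpotency, so `z ^ q` centralizes `P`.
  have hne : P ⊔ Subgroup.zpowers (z ^ q) ≠ ⊤ := by
    intro h
    obtain ⟨m, hm, y, hy, hmy⟩ := Subgroup.mem_sup_of_normal_left.1
      (h ▸ Subgroup.mem_top z : z ∈ P ⊔ Subgroup.zpowers (z ^ q))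
    obtain ⟨k, rfl⟩ := Subgroup.mem_zpowers_iff.1 hy
    have hmz : m = z ^ (1 - q * k : ℤ) := by
      rw [zpow_sub, zpow_one, zpow_mul, zpow_natCast]
      exact eq_mul_inv_of_mul_eq hmy
    have hbot : m ∈ P ⊓ Subgroup.zpowers z := ⟨hm, Subgroup.mem_zpowers_iff.2 ⟨_, hmz.symm⟩⟩
    rw [inf_zpowers_eq_bot hp hq hpq hP hz, Subgroup.mem_bot, hmz] at hbot
    have h1 := orderOf_dvd_iff_zpow_eq_one.2 hbot
    have h2 : orderOf z = 1 := by
      by_contra h2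
      have h3 : q ∣ orderOf z := by
        obtain ⟨c, -, hc⟩ := (Nat.dvd_prime_pow hq).1 (orderOf_dvd_of_pow_eq_one hz)
        rw [hc]
        exact dvd_pow_self q (by rintro rfl; exact h2 (by simpa using hc))
      have h4 : (q : ℤ) ∣ 1 := by
        have := (Int.natCast_dvd_natCast.2 h3).trans h1
        simpa using dvd_add this (Dvd.intro k rfl)
      exact hq.one_lt.ne' (Int.natCast_dvd_natCast.1 (by simpa using h4) |> Nat.dvd_one.1)
    rw [orderOf_eq_one_iff] at h2
    exact hmin.ne_one (by rw [h2, map_one])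
  have := hsub _ hne
  rw [← map_pow]
  refine MulEquiv.ext fun x => Subtype.ext ?_
  obtain ⟨a, ha⟩ := hP.exists_pow_eq_one x.2
  have h := Group.IsNilpotent.commute_of_pow_eq_one hp hq hpq (i := a) (j := b)
    (x := (⟨x, Subgroup.mem_sup_left x.2⟩ : (P ⊔ Subgroup.zpowers (z ^ q) : Subgroup G)))
    (y := ⟨z ^ q, Subgroup.mem_sup_right (Subgroup.mem_zpowers _)⟩)
    (Subtype.ext (by simpa using ha)) (Subtype.ext (by
      have : (z ^ q) ^ q ^ b = 1 := by rw [← pow_mul, mul_comm, pow_mul, hz, one_pow]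
      simpa using this))
  have h' : Commute (x : G) (z ^ q) := congrArg Subtype.val h
  rw [MulAut.conjNormal_apply, ← h'.eq]
  simp

theorem conjNormal_pow_eq_one [P.Normal] (hz : z ^ b = 1) :
    (MulAut.conjNormal z : MulAut P) ^ b = 1 := by
  rw [← map_pow, hz, map_one]

end

/-! ### Schmidt subgroups of extensions of a p-group by a q-group -/

theorem pow_mem_of_sup_zpowers_eq_top {G : Type*} [Group G] {M : Subgroup G} [M.Normal] {z : G}
    {n : ℕ} (hz : z ^ n = 1) (htop : M ⊔ Subgroup.zpowers z = ⊤) (x : G) : x ^ n ∈ M := by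
  obtain ⟨m, hm, y, hy, hxy⟩ := Subgroup.mem_sup_of_normal_left.1
    (htop ▸ Subgroup.mem_top x : x ∈ M ⊔ Subgroup.zpowers z)
  obtain ⟨k, rfl⟩ := Subgroup.mem_zpowers_iff.1 hy
  rw [← QuotientGroup.eq_one_iff, ← hxy, QuotientGroup.mk_pow, QuotientGroup.mk_mul,
    (QuotientGroup.eq_one_iff m).2 hm, one_mul, ← QuotientGroup.mk_pow, zpow_pow_eq_one hz,
    QuotientGroup.mk_one]

/-- A Schmidt subgroup of an extension of a `p`-group by a `q`-group is an extension of a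
`p`-group by a cyclic `q`-group. -/
theorem IsSchmidtGroup.isPrimaryExtension_of_subgroup {G : Type u} [Group G] {N : Subgroup G}
    [N.Normal] {p q : ℕ} (hp : p.Prime) (hq : q.Prime) (hpq : p ≠ q) (hN : IsPGroup p N)
    (hNq : ∀ x : G, ∃ b, x ^ q ^ b ∈ N) {S : Subgroup G} (hS : IsSchmidtGroup S) :
    IsPrimaryExtension p q S := by
  have hprime : ∀ r : ℕ, r.Prime → ∀ x : G, x ≠ 1 → ∀ c, x ^ r ^ c = 1 → r = p ∨ r = q := by
    intro r hr x hx c hxc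
    obtain ⟨b, hb⟩ := hNq x
    obtain ⟨a, ha⟩ := hN.exists_pow_eq_one hb
    rw [← pow_mul] at ha
    have hd : r ∣ q ^ b * p ^ a := by
      obtain ⟨d, -, hd⟩ := (Nat.dvd_prime_pow hr).1 (orderOf_dvd_of_pow_eq_one hxc)
      refine (dvd_pow_self r ?_).trans (hd ▸ orderOf_dvd_of_pow_eq_one ha)
      rintro rfl
      exact hx (orderOf_eq_one_iff.1 (by simpa using hd))
    rcases (Nat.Prime.dvd_mul hr).1 hd with h | h
    · exact Or.inr ((Nat.prime_dvd_prime_iff_eq hr hq).1 (hr.dvd_of_dvd_pow h))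
    · exact Or.inl ((Nat.prime_dvd_prime_iff_eq hr hp).1 (hr.dvd_of_dvd_pow h))
  obtain ⟨p', q', hp', hq', hpq', P, z, hPn, hP, ⟨b, hz⟩, htop⟩ := hS.exists_isPrimaryExtension
  have hfin := hS.1
  have hmin := hS.isMinimallyNontrivial_conj hp' hq' hpq' hP hz htop
  have hz1 : (z : G) ≠ 1 := fun h => hmin.ne_one (by
    rw [show z = 1 from Subtype.ext h, map_one])
  have hzG : (z : G) ^ q' ^ b = 1 := by simpa using congrArg Subtype.val hz
  have hqq := hprime q' hq' z hz1 b hzG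
  have hnt := hmin.nontrivial
  obtain ⟨x, hx⟩ := exists_ne (1 : P)
  obtain ⟨a, ha⟩ := hP.exists_pow_eq_one x.2
  have hpp := hprime p' hp' ((x : S) : G) (fun h => hx (Subtype.ext (Subtype.ext h))) a
    (by simpa using congrArg Subtype.val ha)
  -- With the primes swapped, `z` would lie in `N`; then `P` and `N ∩ S` are normal of coprime
  -- orders and commute, contradicting the nontrivial action.
  have hpp' : p' = p := by
    by_contra hne
    obtain rfl : p' = q := hpp.resolve_left hne
    obtain rfl : q' = p := hqq.resolve_right (Ne.symm hpq')
    have hzN : (z : G) ∈ N := by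
      obtain ⟨c, hc⟩ := hNq z
      rw [← QuotientGroup.eq_one_iff] at hc ⊢
      exact eq_one_of_pow_prime_pow hp hq hpq (a := b) (b := c)
        (by rw [← QuotientGroup.mk_pow, hzG, QuotientGroup.mk_one]) hc
    refine hmin.ne_one (MulEquiv.ext fun y => Subtype.ext ?_)
    have hNS : IsPGroup q' (N.subgroupOf S) := hN.comap_subtype
    have := Fact.mk hp'
    have := Fact.mk hq'
    have hc := Subgroup.commute_of_normal_of_disjoint _ _ hPn
      (inferInstance : (N.subgroupOf S).Normal)
      (IsPGroup.disjoint_of_ne p' q' hpq' _ _ hP hNS) y z y.2 (Subgroup.mem_subgroupOf.2 hzN)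
    rw [MulAut.conjNormal_apply, ← hc.eq]
    simp
  subst hpp'
  obtain rfl : q' = q := hqq.resolve_left (Ne.symm hpq')
  exact ⟨P, z, hPn, hP, ⟨b, hz⟩, htop⟩

theorem IsSchmidtGroup.isPrimaryExtension_of_le {G : Type u} [Group G] {p q : ℕ} (hp : p.Prime)
    (hq : q.Prime) (hpq : p ≠ q) (hG : IsPrimaryExtension p q G) {S : Subgroup G}
    (hS : IsSchmidtGroup S) : IsPrimaryExtension p q S := by
  obtain ⟨P, z, hPn, hP, ⟨b, hz⟩, htop⟩ := hG
  exact hS.isPrimaryExtension_of_subgroup hp hq hpq hP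
    fun x => ⟨b, pow_mem_of_sup_zpowers_eq_top hz htop x⟩

theorem exists_isSchmidtGroup_of_not_isNilpotent {G : Type u} [Group G] [Finite G]
    (hG : ¬ Group.IsNilpotent G) : ∃ S : Subgroup G, IsSchmidtGroup S := by
  let F : FiniteGroupClass.{u} :=
    ⟨fun G _ _ => Group.IsNilpotent G, fun G H _ _ _ _ e h => Group.nilpotent_of_mulEquiv e⟩
  obtain ⟨S, hS⟩ := FiniteGroupClass.exists_isSCritical (F := F) hG
  exact ⟨S, inferInstance, hS.1, hS.2⟩

theorem mem_normalizer_of_forall_conj_mem {G : Type*} [Group G] [Finite G] {P : Subgroup G} {z : G}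
    (hnorm : ∀ x ∈ P, z * x * z⁻¹ ∈ P) : z ∈ Subgroup.normalizer (P : Set G) := by
  rw [Subgroup.mem_normalizer_iff_map_conj_eq]
  refine Subgroup.eq_of_le_of_card_ge ?_
    (Subgroup.card_map_of_injective (MulAut.conj z).injective).ge
  rintro _ ⟨x, hx, rfl⟩
  exact hnorm x hx

theorem normal_subgroupOf_sup_zpowers {G : Type*} [Group G] [Finite G] {P : Subgroup G} {z : G}
    (hnorm : ∀ x ∈ P, z * x * z⁻¹ ∈ P) : (P.subgroupOf (P ⊔ Subgroup.zpowers z)).Normal :=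
  Subgroup.normal_subgroupOf_of_le_normalizer (sup_le Subgroup.le_normalizer
    (Subgroup.zpowers_le.2 (mem_normalizer_of_forall_conj_mem hnorm)))

theorem sup_zpowers_subgroupOf_eq_top {G : Type*} [Group G] (P : Subgroup G) (z : G) :
    P.subgroupOf (P ⊔ Subgroup.zpowers z) ⊔ Subgroup.zpowers
      (⟨z, Subgroup.mem_sup_right (Subgroup.mem_zpowers z)⟩ : ↥(P ⊔ Subgroup.zpowers z)) = ⊤ := by
  rw [← (Subgroup.map_injective (Subgroup.subtype_injective _)).eq_iff, Subgroup.map_sup,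
    Subgroup.map_subgroupOf_eq_of_le le_sup_left, MonoidHom.map_zpowers, ← MonoidHom.range_eq_map,
    Subgroup.range_subtype]
  rfl

theorem isPrimaryExtension_sup_zpowers {G : Type*} [Group G] [Finite G] {p q b : ℕ}
    {P : Subgroup G} {z : G} (hP : IsPGroup p P) (hz : z ^ q ^ b = 1)
    (hnorm : ∀ x ∈ P, z * x * z⁻¹ ∈ P) :
    IsPrimaryExtension p q (P ⊔ Subgroup.zpowers z : Subgroup G) :=
  ⟨P.subgroupOf _, ⟨z, Subgroup.mem_sup_right (Subgroup.mem_zpowers z)⟩,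
    normal_subgroupOf_sup_zpowers hnorm, hP.comap_subtype, ⟨b, Subtype.ext (by simpa using hz)⟩,
    sup_zpowers_subgroupOf_eq_top P z⟩

/-! ### The elementary abelian case: cyclotomic fields -/

section FieldModel

variable {V : Type*} [CommGroup V] [Finite V] {p q : ℕ} {σ : MulAut V}

/-- On an abelian group `x ↦ σ x * x⁻¹` is an endomorphism. It is onto because `[V, σ] = V`, hence
injective, so `σ` has no nontrivial fixed points. -/
theorem MulAut.IsMinimallyNontrivial.eq_bot_of_ne_top (h : σ.IsMinimallyNontrivial) (hp : p.Prime)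
    (hq : q.Prime) (hpq : p ≠ q) (hV : ∀ x : V, x ^ p = 1) (hσ : σ ^ q = 1) {U : Subgroup V}
    (hU : U ≠ ⊤) (hinv : ∀ x ∈ U, σ x ∈ U) : U = ⊥ := by
  have hP : IsPGroup p V := isPGroup_iff_pow_pow_eq_one.2 fun x => ⟨1, by rw [pow_one, hV]⟩
  let τ : V →* V :=
    { toFun := fun x => σ x * x⁻¹
      map_one' := by simp
      map_mul' := fun x y => by rw [map_mul, mul_inv]; exact mul_mul_mul_comm _ _ _ _ }
  have htop : τ.range = ⊤ := by
    rw [eq_top_iff, ← h.closure_eq_top hp hq hpq hP (b := 1) (by rw [pow_one, hσ]),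
      Subgroup.closure_le]
    rintro _ ⟨x, rfl⟩
    exact ⟨x, rfl⟩
  have hinj := Finite.injective_iff_surjective.2 (MonoidHom.range_eq_top.1 htop)
  rw [eq_bot_iff]
  intro x hx
  refine Subgroup.mem_bot.2 (hinj ?_)
  rw [map_one]
  change σ x * x⁻¹ = 1
  rw [h.apply_eq U hU hinv x hx, mul_inv_cancel]

end FieldModel

/-- A vector space over `ZMod p` with an irreducible automorphism of prime order `q` is the
`q`-th cyclotomic field, with the automorphism acting as a primitive `q`-th root of unity. -/
theorem exists_addEquiv_cyclotomicField {W : Type*} [AddCommGroup W] [Finite W] [Nontrivial W]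
    {p q : ℕ} [hp : Fact p.Prime] [hq : Fact q.Prime] (hpq : p ≠ q) [Module (ZMod p) W]
    (f : Module.End (ZMod p) W) (hf : f ≠ 1) (hfq : f ^ q = 1)
    (hirr : ∀ U : Submodule (ZMod p) W, U ≠ ⊤ → (∀ x ∈ U, f x ∈ U) → U = ⊥) :
    ∃ (e : W ≃+ CyclotomicField q (ZMod p)) (ζ : CyclotomicField q (ZMod p)),
      IsPrimitiveRoot ζ q ∧ ∀ x, e (f x) = ζ * e x := by
  have hcomm : ∀ g : Polynomial (ZMod p), f * Polynomial.aeval f g = Polynomial.aeval f g * f := by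
    intro g
    simpa using congrArg (Polynomial.aeval (R := ZMod p) f) (mul_comm Polynomial.X g)
  have hcomm' : ∀ (g : Polynomial (ZMod p)) (w : W),
      f (Polynomial.aeval f g w) = Polynomial.aeval f g (f w) :=
    fun g w => LinearMap.congr_fun (hcomm g) w
  -- Schur's lemma: the kernel of a polynomial in `f` is invariant, hence zero or everything. So
  -- `ZMod p[X]` modulo the annihilator is a finite domain, that is, a field, and `W` is
  -- one-dimensional over it.
  have hker : ∀ g : Polynomial (ZMod p), ∀ v : W, v ≠ 0 →
      Polynomial.aeval f g v = 0 → Polynomial.aeval f g = 0 := by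
    intro g v hv hg
    rw [← LinearMap.ker_eq_top]
    by_contra hne
    have := hirr _ hne (fun x hx => by
      rw [LinearMap.mem_ker] at hx ⊢
      rw [← hcomm', hx, map_zero])
    exact hv ((Submodule.mem_bot _).1 (this ▸ LinearMap.mem_ker.2 hg))
  obtain ⟨v, hv⟩ := exists_ne (0 : W)
  let I : Ideal (Polynomial (ZMod p)) := RingHom.ker (Polynomial.aeval (R := ZMod p) f)
  let ψ : (Polynomial (ZMod p) ⧸ I) →+* Module.End (ZMod p) W :=
    Ideal.Quotient.lift I (Polynomial.aeval (R := ZMod p) f).toRingHom fun a ha => ha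
  have hψ : ∀ g, ψ (Ideal.Quotient.mk I g) = Polynomial.aeval f g := fun g => rfl
  have hψinj : Function.Injective ψ := by
    rw [injective_iff_map_eq_zero]
    intro a ha
    obtain ⟨g, rfl⟩ := Ideal.Quotient.mk_surjective a
    exact Ideal.Quotient.eq_zero_iff_mem.2 ha
  have hI : I.IsPrime := by
    refine ⟨fun htop => ?_, fun {a b} hab => ?_⟩
    · have : (1 : Polynomial (ZMod p)) ∈ I := htop ▸ trivial
      rw [RingHom.mem_ker, map_one] at this
      exact hv (LinearMap.congr_fun this v)
    · by_contra! hcon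
      obtain ⟨ha, hb⟩ := hcon
      rw [RingHom.mem_ker] at hab ha hb
      have hw : Polynomial.aeval f b v ≠ 0 := fun h => hb (hker b v hv h)
      refine ha (hker a _ hw ?_)
      rw [map_mul] at hab
      exact LinearMap.congr_fun hab v
  have hfin : Finite (Polynomial (ZMod p) ⧸ I) := by
    have : Finite (Module.End (ZMod p) W) :=
      Finite.of_injective (fun g : Module.End (ZMod p) W => (g : W → W)) DFunLike.coe_injective
    exact Finite.of_injective ψ hψinj
  have hmax : I.IsMaximal := Ideal.Quotient.maximal_of_isField _ (Finite.isField_of_domain _)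
  let _ : Field (Polynomial (ZMod p) ⧸ I) := Ideal.Quotient.field I
  let E₀ : (Polynomial (ZMod p) ⧸ I) →+ W :=
    { toFun := fun a => ψ a v
      map_zero' := by rw [map_zero]; rfl
      map_add' := fun a b => by rw [map_add]; rfl }
  have hE₀ : ∀ a, E₀ a = ψ a v := fun a => rfl
  have hinj : Function.Injective E₀ := by
    rw [injective_iff_map_eq_zero]
    intro a ha
    obtain ⟨g, rfl⟩ := Ideal.Quotient.mk_surjective a
    exact Ideal.Quotient.eq_zero_iff_mem.2 (hker g v hv ha)
  have hsurj : Function.Surjective E₀ := by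
    have htop : LinearMap.range ((LinearMap.applyₗ v).comp
        (Polynomial.aeval (R := ZMod p) f).toLinearMap) = ⊤ := by
      by_contra hne
      have := hirr _ hne (by
        rintro _ ⟨g, rfl⟩
        refine ⟨Polynomial.X * g, ?_⟩
        simp)
      refine hv ((Submodule.mem_bot (ZMod p)).1 (this ▸ ⟨1, ?_⟩))
      simp
    intro w
    obtain ⟨g, hg⟩ := LinearMap.range_eq_top.1 htop w
    exact ⟨Ideal.Quotient.mk I g, hg⟩
  let E := AddEquiv.ofBijective E₀ ⟨hinj, hsurj⟩
  set ξ : Polynomial (ZMod p) ⧸ I := Ideal.Quotient.mk I Polynomial.X with hξ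
  have hEξ : ∀ a, E (ξ * a) = f (E a) := by
    intro a
    change ψ (ξ * a) v = f (ψ a v)
    rw [map_mul, hξ, hψ, Polynomial.aeval_X]
    rfl
  have hξq : ξ ^ q = 1 := by
    apply hψinj
    rw [map_pow, hξ, hψ, Polynomial.aeval_X, hfq, map_one]
  have hξ1 : ξ ≠ 1 := by
    intro h
    have := congrArg ψ h
    rw [hξ, hψ, Polynomial.aeval_X, map_one] at this
    exact hf this
  have hprim : IsPrimitiveRoot ξ q := by
    rw [← orderOf_eq_prime hξq hξ1]
    exact IsPrimitiveRoot.orderOf ξ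
  have hcyc : IsCyclotomicExtension {q} (ZMod p) (Polynomial (ZMod p) ⧸ I) := by
    rw [IsCyclotomicExtension.iff_singleton]
    refine ⟨⟨ξ, hprim⟩, fun a => ?_⟩
    obtain ⟨g, rfl⟩ := Ideal.Quotient.mk_surjective a
    have h1 : Ideal.Quotient.mk I g = Polynomial.aeval ξ g := by
      rw [hξ]
      have := Polynomial.aeval_algHom_apply (Ideal.Quotient.mkₐ (ZMod p) I) Polynomial.X g
      rw [Polynomial.aeval_X_left_apply] at this
      exact this.symm
    rw [h1]
    exact Algebra.adjoin_mono (by simpa using hξq) (Polynomial.aeval_mem_adjoin_singleton _ ξ)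
  have hq0 : NeZero ((q : ℕ) : ZMod p) := ⟨fun h => by
    rw [ZMod.natCast_eq_zero_iff, Nat.prime_dvd_prime_iff_eq hp.out hq.out] at h
    exact hpq h⟩
  have : NeZero q := ⟨hq.out.ne_zero⟩
  let ε := IsCyclotomicExtension.algEquiv {q} (ZMod p) (Polynomial (ZMod p) ⧸ I)
    (CyclotomicField q (ZMod p))
  refine ⟨E.symm.trans ε.toAddEquiv, ε ξ, hprim.map_of_injective ε.injective, fun x => ?_⟩
  have hx : E.symm (f x) = ξ * E.symm x := by
    rw [AddEquiv.symm_apply_eq, hEξ, AddEquiv.apply_symm_apply]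
  change ε (E.symm (f x)) = ε ξ * ε (E.symm x)
  rw [hx, map_mul]

theorem exists_addEquiv_cyclotomicField_of_addMonoidHom {W : Type*} [AddCommGroup W] [Finite W]
    [Nontrivial W] {p q : ℕ} [hp : Fact p.Prime] [hq : Fact q.Prime] (hpq : p ≠ q)
    (hW : ∀ x : W, p • x = 0) (f : W →+ W) (hf : ∃ x, f x ≠ x) (hfq : ∀ x, f^[q] x = x)
    (hirr : ∀ U : AddSubgroup W, U ≠ ⊤ → (∀ x ∈ U, f x ∈ U) → U = ⊥) :
    ∃ (e : W ≃+ CyclotomicField q (ZMod p)) (ζ : CyclotomicField q (ZMod p)),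
      IsPrimitiveRoot ζ q ∧ ∀ x, e (f x) = ζ * e x := by
  let _ := AddCommGroup.zmodModule hW
  let g : Module.End (ZMod p) W := AddMonoidHom.toZModLinearMap p f
  obtain ⟨x, hx⟩ := hf
  refine exists_addEquiv_cyclotomicField hpq g (fun hg => hx (LinearMap.congr_fun hg x))
    (LinearMap.ext fun x => ?_) fun U hU hinv => ?_
  · rw [Module.End.pow_apply]
    exact hfq x
  · have := hirr U.toAddSubgroup
      (fun h => hU (by rw [eq_top_iff]; exact fun x _ => (h ▸ AddSubgroup.mem_top x :
        x ∈ U.toAddSubgroup))) hinv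
    refine (Submodule.eq_bot_iff U).2 fun x hx => ?_
    have hx' : x ∈ U.toAddSubgroup := hx
    rw [this] at hx'
    exact hx'

theorem MulAut.IsMinimallyNontrivial.exists_mulEquiv_cyclotomicField {V : Type*} [CommGroup V]
    [Finite V] {p q : ℕ} {σ : MulAut V}
    (h : σ.IsMinimallyNontrivial) [hp : Fact p.Prime] [hq : Fact q.Prime] (hpq : p ≠ q)
    (hV : ∀ x : V, x ^ p = 1) (hσ : σ ^ q = 1) :
    ∃ (e : V ≃* Multiplicative (CyclotomicField q (ZMod p))) (ζ : CyclotomicField q (ZMod p)),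
      IsPrimitiveRoot ζ q ∧ ∀ x, (e (σ x)).toAdd = ζ * (e x).toAdd := by
  have := h.nontrivial
  have hpow : ∀ (k : ℕ) (x : V), σ^[k] x = (σ ^ k) x := by
    intro k
    induction k with
    | zero => exact fun x => rfl
    | succ k ih =>
      intro x
      rw [Function.iterate_succ_apply', ih, pow_succ', MulAut.mul_apply]
  obtain ⟨e, ζ, hζ, he⟩ := exists_addEquiv_cyclotomicField_of_addMonoidHom (W := Additive V) hpq
    (fun x => hV x.toMul) (MonoidHom.toAdditive σ.toMonoidHom)
    (by
      by_contra! hcon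
      exact h.ne_one (MulEquiv.ext fun x => hcon (Additive.ofMul x)))
    (fun x => (hpow q x.toMul).trans (by rw [hσ]; rfl))
    (fun U hU hinv => by
      have hbot := h.eq_bot_of_ne_top hp.out hq.out hpq hV hσ
        (U := AddSubgroup.toSubgroup' U)
        (fun htop => hU (top_unique fun x _ => by
          have : x.toMul ∈ AddSubgroup.toSubgroup' U := htop ▸ Subgroup.mem_top _
          exact this))
        (fun x hx => hinv (Additive.ofMul x) hx)
      rw [eq_bot_iff]
      intro x hx
      have hx' : x.toMul ∈ AddSubgroup.toSubgroup' U := hx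
      rw [hbot, Subgroup.mem_bot] at hx'
      exact hx')
  exact ⟨AddEquiv.toMultiplicativeRight e, ζ, hζ, fun x => he (Additive.ofMul x)⟩

/-- Both actions are multiplication by primitive `q`-th roots of unity in the same field, and such
roots are powers of each other. Only the generated cyclic groups can be matched, not `σ` and `σ'`
themselves. -/
theorem MulAut.IsMinimallyNontrivial.exists_mulEquiv_zpowers_eq {V V' : Type*} [Group V]
    [Group V'] [Finite V] [Finite V'] {p q : ℕ} {σ : MulAut V} {σ' : MulAut V'}
    (h : σ.IsMinimallyNontrivial) (h' : σ'.IsMinimallyNontrivial) (hp : p.Prime) (hq : q.Prime)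
    (hpq : p ≠ q) (hc : ∀ x y : V, x * y = y * x) (hc' : ∀ x y : V', x * y = y * x)
    (hV : ∀ x : V, x ^ p = 1) (hV' : ∀ x : V', x ^ p = 1) (hσ : σ ^ q = 1) (hσ' : σ' ^ q = 1) :
    ∃ e : V ≃* V', Subgroup.zpowers (MulAut.congr e σ) = Subgroup.zpowers σ' := by
  have := Fact.mk hp
  have := Fact.mk hq
  let i : CommGroup V := { ‹Group V› with mul_comm := hc }
  let i' : CommGroup V' := { ‹Group V'› with mul_comm := hc' }
  obtain ⟨e, ζ, hζ, he⟩ := h.exists_mulEquiv_cyclotomicField hpq hV hσ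
  obtain ⟨e', ζ', hζ', he'⟩ := h'.exists_mulEquiv_cyclotomicField hpq hV' hσ'
  have key : ∀ (ζ₁ ζ₂ : CyclotomicField q (ZMod p)) (τ₁ τ₂ : MulAut V'),
      IsPrimitiveRoot ζ₁ q → IsPrimitiveRoot ζ₂ q →
      (∀ x, (e' (τ₁ x)).toAdd = ζ₁ * (e' x).toAdd) →
      (∀ x, (e' (τ₂ x)).toAdd = ζ₂ * (e' x).toAdd) → τ₁ ∈ Subgroup.zpowers τ₂ := by
    intro ζ₁ ζ₂ τ₁ τ₂ h₁ h₂ hτ₁ hτ₂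
    obtain ⟨k, -, hk⟩ := h₂.eq_pow_of_pow_eq_one h₁.pow_eq_one
    refine Subgroup.mem_zpowers_iff.2 ⟨k, ?_⟩
    have hpow : ∀ (j : ℕ) x, (e' ((τ₂ ^ j) x)).toAdd = ζ₂ ^ j * (e' x).toAdd := by
      intro j
      induction j with
      | zero => simp
      | succ j ih =>
        intro x
        rw [pow_succ', MulAut.mul_apply, hτ₂, ih, pow_succ', mul_assoc]
    refine MulEquiv.ext fun x => e'.injective (Multiplicative.toAdd.injective ?_)
    rw [zpow_natCast, hpow, hτ₁, hk]
  have hcongr : ∀ x, (e' (MulAut.congr (e.trans e'.symm) σ x)).toAdd = ζ * (e' x).toAdd := by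
    intro x
    have : MulAut.congr (e.trans e'.symm) σ x = e'.symm (e (σ (e.symm (e' x)))) := rfl
    rw [this, MulEquiv.apply_symm_apply, he, MulEquiv.apply_symm_apply]
  refine ⟨e.trans e'.symm, le_antisymm ?_ ?_⟩
  · rw [Subgroup.zpowers_le]
    exact key ζ ζ' _ _ hζ hζ' hcongr he'
  · rw [Subgroup.zpowers_le]
    exact key ζ' ζ _ _ hζ' hζ he' hcongr

/-! ### Comparing Schmidt groups inside holomorphs -/

/-- The holomorph of a group. -/
abbrev Holomorph (N : Type*) [Group N] : Type _ := N ⋊[MonoidHom.id (MulAut N)] MulAut N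

/-- The map restricts to the inclusion on `P` and sends `z` to its conjugation action. Its image
depends only on `P` and the cyclic group of automorphisms induced by `z`, not on the order of `z`.
-/
theorem exists_hom_holomorph {G : Type*} [Group G] {P : Subgroup G} [P.Normal] {z : G}
    (hbot : P ⊓ Subgroup.zpowers z = ⊥) (htop : P ⊔ Subgroup.zpowers z = ⊤) :
    ∃ f : G →* Holomorph P, f.ker ⊓ P = ⊥ ∧
      f.range = SemidirectProduct.inl.range ⊔
        Subgroup.zpowers (SemidirectProduct.inr (MulAut.conjNormal z)) := by
  have hc : P.IsComplement' (Subgroup.zpowers z) :=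
    Subgroup.isComplement'_of_disjoint_and_mul_eq_univ (disjoint_iff.2 hbot) (by
      rw [← Subgroup.normal_mul, htop]; rfl)
  let e := SemidirectProduct.mulEquivSubgroup hc
  let g : _ →* Holomorph P := SemidirectProduct.map (φ₂ := MonoidHom.id (MulAut P))
    (φ₁ := (P.normalizerMonoidHom).comp
      (Subgroup.inclusion (P.normalizer_eq_top ▸ le_top : Subgroup.zpowers z ≤ _)))
    (MonoidHom.id P) ((MulAut.conjNormal).comp (Subgroup.zpowers z).subtype) (fun x => by
      ext y
      simp)
  let f : G →* Holomorph P := g.comp e.symm.toMonoidHom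
  have hfP : ∀ x : P, f x = SemidirectProduct.inl x := by
    intro x
    have : e (SemidirectProduct.inl x) = x := by simp [e]
    change g (e.symm x) = _
    rw [← this, MulEquiv.symm_apply_apply, SemidirectProduct.map_inl]
    rfl
  have hfz : f z = SemidirectProduct.inr (MulAut.conjNormal z) := by
    have : e (SemidirectProduct.inr ⟨z, Subgroup.mem_zpowers z⟩) = z := by simp [e]
    change g (e.symm z) = _
    rw [(MulEquiv.symm_apply_eq e).2 this.symm, SemidirectProduct.map_inr]
    rfl
  refine ⟨f, ?_, ?_⟩
  · rw [eq_bot_iff]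
    rintro x ⟨hx, hxP⟩
    have h1 := hfP ⟨x, hxP⟩
    rw [show f ((⟨x, hxP⟩ : P) : G) = 1 from hx] at h1
    have := SemidirectProduct.inl_injective (h1.symm.trans (map_one _).symm)
    exact congrArg Subtype.val this
  · rw [MonoidHom.range_eq_map, ← htop, Subgroup.map_sup, MonoidHom.map_zpowers, hfz]
    congr 1
    ext y
    constructor
    · rintro ⟨x, hx, rfl⟩
      exact ⟨⟨x, hx⟩, (hfP ⟨x, hx⟩).symm⟩
    · rintro ⟨x, rfl⟩
      exact ⟨x, x.2, hfP x⟩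

namespace FiniteGroupClass

variable {F : FiniteGroupClass.{u}}

theorem mem_of_elementary (hform : F.IsFormation) (hher : F.IsHereditary)
    (hshem : F.HasShemetkovProperty) {p q : ℕ} (hp : p.Prime) (hq : q.Prime) (hpq : p ≠ q)
    {S T : Type u} [Group S] [Finite S] [Group T] [Finite T] (hS : IsSchmidtGroup S)
    (hT : IsSchmidtGroup T) (hTF : F.mem T) (hSp : groupPrimes S ⊆ F.primes)
    {P : Subgroup S} {Q : Subgroup T} [P.Normal] [Q.Normal] {z : S} {w : T} {b c : ℕ}
    (hz : z ^ q ^ b = 1) (hw : w ^ q ^ c = 1) (hPz : P ⊔ Subgroup.zpowers z = ⊤)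
    (hQw : Q ⊔ Subgroup.zpowers w = ⊤) (hPc : ∀ x y : P, x * y = y * x)
    (hQc : ∀ x y : Q, x * y = y * x) (hPp : ∀ x : P, x ^ p = 1) (hQp : ∀ x : Q, x ^ p = 1) :
    F.mem S := by
  have hP : IsPGroup p P := isPGroup_iff_pow_pow_eq_one.2 fun x => ⟨1, by rw [pow_one, hPp]⟩
  have hQ : IsPGroup p Q := isPGroup_iff_pow_pow_eq_one.2 fun x => ⟨1, by rw [pow_one, hQp]⟩
  obtain ⟨e, he⟩ := (hS.isMinimallyNontrivial_conj hp hq hpq hP hz hPz).exists_mulEquiv_zpowers_eq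
    (hT.isMinimallyNontrivial_conj hp hq hpq hQ hw hQw) hp hq hpq hPc hQc hPp hQp
    (hS.conj_pow_eq_one hp hq hpq hP hz hPz) (hT.conj_pow_eq_one hp hq hpq hQ hw hQw)
  obtain ⟨f, hfker, hf⟩ := exists_hom_holomorph (inf_zpowers_eq_bot hp hq hpq hP hz) hPz
  obtain ⟨g, -, hg⟩ := exists_hom_holomorph (inf_zpowers_eq_bot hp hq hpq hQ hw) hQw
  let E : Holomorph P ≃* Holomorph Q := SemidirectProduct.congr e (MulAut.congr e) fun σ => by
    ext x
    simp
  have hE : f.range.map E.toMonoidHom = g.range := by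
    rw [hf, hg, Subgroup.map_sup, MonoidHom.map_zpowers]
    congr 1
    · ext y
      constructor
      · rintro ⟨_, ⟨x, rfl⟩, rfl⟩
        exact ⟨e x, by ext <;> simp [E]⟩
      · rintro ⟨x, rfl⟩
        exact ⟨SemidirectProduct.inl (e.symm x), ⟨_, rfl⟩, by ext <;> simp [E]⟩
    · have h1 : ∀ σ, E.toMonoidHom (SemidirectProduct.inr σ) =
          SemidirectProduct.inr (MulAut.congr e σ) := fun σ => by ext <;> simp [E]
      rw [h1, ← MonoidHom.map_zpowers, he, MonoidHom.map_zpowers]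
  have e1 : (S ⧸ f.ker) ≃* (T ⧸ g.ker) :=
    (QuotientGroup.quotientKerEquivRange f).trans
      ((E.subgroupMap f.range).trans ((MulEquiv.subgroupCongr hE).trans
        (QuotientGroup.quotientKerEquivRange g).symm))
  -- `S` is a subdirect product of `S / f.ker`, which is a quotient of `T` up to isomorphism, and
  -- the cyclic group `S / P`.
  refine hform.mem_of_inf_eq_bot f.ker P hfker
    ((mem_congr e1).2 (hform.quotient_mem T g.ker hTF)) ?_
  have hcyc : IsCyclic (S ⧸ P) := by
    refine ⟨(z : S ⧸ P), fun y => ?_⟩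
    obtain ⟨s, rfl⟩ := QuotientGroup.mk_surjective y
    obtain ⟨m, hm, v, hv, rfl⟩ := Subgroup.mem_sup_of_normal_left.1
      (hPz ▸ Subgroup.mem_top s : s ∈ P ⊔ Subgroup.zpowers z)
    obtain ⟨k, rfl⟩ := Subgroup.mem_zpowers_iff.1 hv
    exact ⟨k, by simp [(QuotientGroup.eq_one_iff m).2 hm]⟩
  have : Group.IsNilpotent (S ⧸ P) := @CommGroup.isNilpotent _ (IsCyclic.commGroup (α := S ⧸ P))
  exact mem_of_isNilpotent hher hshem
    (fun r hr => hSp ⟨hr.1, hr.2.trans (Subgroup.card_quotient_dvd_card P)⟩)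

end FiniteGroupClass

/-! ### A cover with kernel free over ZMod (p ^ 2) -/

/-- The action of the automorphisms of `P` on the free module with basis `P`. -/
noncomputable def permutationAut (P R : Type*) [Group P] [Ring R] :
    MulAut P →* MulAut (Multiplicative (P →₀ R)) where
  toFun α := AddEquiv.toMultiplicative (Finsupp.domCongr α.toEquiv)
  map_one' := MulEquiv.ext fun _ => Multiplicative.toAdd.injective (Finsupp.ext fun _ => rfl)
  map_mul' _ _ := MulEquiv.ext fun _ => Multiplicative.toAdd.injective (Finsupp.ext fun _ => rfl)

theorem permutationAut_single {P R : Type*} [Group P] [Ring R] (α : MulAut P) (x : P) (a : R) :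
    permutationAut P R α (Multiplicative.ofAdd (Finsupp.single x a)) =
      Multiplicative.ofAdd (Finsupp.single (α x) a) :=
  Multiplicative.toAdd.injective (Finsupp.equivMapDomain_single α.toEquiv x a)

/-- The reason for using `ZMod (p ^ 2)` instead of `ZMod p`: there every element killed by `p` is a
multiple of `p`, so it dies in any image of exponent `p`. -/
theorem exists_eq_pow_of_pow_eq_one {ι : Type*} {p : ℕ} (hp : p.Prime)
    (v : Multiplicative (ι →₀ ZMod (p ^ 2))) (hv : v ^ p = 1) : ∃ w, v = w ^ p := by
  have hne : NeZero (p ^ 2) := ⟨pow_ne_zero 2 hp.ne_zero⟩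
  have hv' : p • v.toAdd = 0 := hv
  refine ⟨Multiplicative.ofAdd (v.toAdd.mapRange
    (fun a => (((a.val / p : ℕ) : ZMod (p ^ 2)))) (by simp)), ?_⟩
  refine Multiplicative.toAdd.injective (Finsupp.ext fun i => ?_)
  rw [toAdd_pow, toAdd_ofAdd, Finsupp.smul_apply, Finsupp.mapRange_apply, nsmul_eq_mul,
    ← Nat.cast_mul]
  have h1 : p • v.toAdd i = 0 := by rw [← Finsupp.smul_apply, hv']; rfl
  rw [nsmul_eq_mul, ← ZMod.natCast_zmod_val (v.toAdd i), ← Nat.cast_mul,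
    ZMod.natCast_eq_zero_iff] at h1
  replace h1 := Nat.dvd_of_mul_dvd_mul_left hp.pos ((pow_two p).symm.dvd.trans h1)
  rw [Nat.mul_div_cancel' h1, ZMod.natCast_zmod_val]

/-- The projection of the free `ZMod n`-module with basis `P` onto the abelianization of `P`. -/
noncomputable def freeToAbelianization (P : Type*) [Group P] (n : ℕ)
    (h : ∀ x : Abelianization P, x ^ n = 1) : Multiplicative (P →₀ ZMod n) →* Abelianization P :=
  AddMonoidHom.toMultiplicativeLeft (Finsupp.liftAddHom fun x =>
    ZMod.lift n ⟨zmultiplesHom _ (Additive.ofMul (Abelianization.of x)), by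
      rw [zmultiplesHom_apply, natCast_zsmul, ← ofMul_pow, h, ofMul_one]⟩)

theorem freeToAbelianization_single {P : Type*} [Group P] {n : ℕ} (h : ∀ x : Abelianization P, x ^ n = 1)
    (x : P) (k : ℤ) : freeToAbelianization P n h (Multiplicative.ofAdd (Finsupp.single x (k : ZMod n))) =
      Abelianization.of (x ^ k) := by
  have : freeToAbelianization P n h (Multiplicative.ofAdd (Finsupp.single x (k : ZMod n))) =
    (Finsupp.liftAddHom (fun x =>
    ZMod.lift n ⟨zmultiplesHom _ (Additive.ofMul (Abelianization.of x)), by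
      rw [zmultiplesHom_apply, natCast_zsmul, ← ofMul_pow, h, ofMul_one]⟩)
      (Finsupp.single x (k : ZMod n))).toMul := rfl
  rw [this, Finsupp.liftAddHom_apply_single, ZMod.lift_coe, map_zpow]
  rfl

/-- The quotient of `S` by the derived subgroup of a normal subgroup `P` with cyclic factor group
is a quotient of a semidirect product `W` with abelian kernel `U`, which is free over
`ZMod (p ^ 2)`. -/
theorem exists_cover {S : Type u} [Group S] [Finite S] {P : Subgroup S} [P.Normal] {z : S}
    {p m : ℕ} (hp : p.Prime) (hz : z ^ m = 1) (htop : P ⊔ Subgroup.zpowers z = ⊤)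
    [((commutator P).map P.subtype).Normal]
    (hP : ∀ x : P, x ^ p ∈ commutator P) :
    ∃ (W : Type u) (_ : Group W) (_ : Finite W) (U : Subgroup W)
      (f : W →* S ⧸ (commutator P).map P.subtype),
      Function.Surjective f ∧ U.Normal ∧ (∀ w : W, w ^ m ∈ U) ∧
      (∀ v ∈ U, ∀ w ∈ U, v * w = w * v) ∧ (∀ w ∈ U, w ^ p ^ 2 = 1) ∧
      (∀ w ∈ U, w ^ p = 1 → f w = 1) ∧ (∀ w ∈ U, ∃ x ∈ P, f w = x) := by
  have hne : NeZero (p ^ 2) := ⟨pow_ne_zero 2 hp.ne_zero⟩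
  have hab : ∀ x : Abelianization P, x ^ p = 1 := by
    intro x
    obtain ⟨y, rfl⟩ := QuotientGroup.mk_surjective x
    exact (QuotientGroup.eq_one_iff (y ^ p)).2 (hP y)
  have hab2 : ∀ x : Abelianization P, x ^ p ^ 2 = 1 := fun x => by
    rw [pow_two, pow_mul, hab]
  set K := (commutator P).map P.subtype with hK
  let ι : Abelianization P →* S ⧸ K :=
    QuotientGroup.lift (commutator P) ((QuotientGroup.mk' K).comp P.subtype) (by
      intro x hx
      exact (QuotientGroup.eq_one_iff _).2 ⟨x, hx, rfl⟩)
  have hι : ∀ x : P, ι (Abelianization.of x) = ((x : S) : S ⧸ K) := fun x => rfl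
  let π := freeToAbelianization P (p ^ 2) hab2
  let φ : Subgroup.zpowers z →* MulAut (Multiplicative (P →₀ ZMod (p ^ 2))) :=
    (permutationAut P (ZMod (p ^ 2))).comp
      ((MulAut.conjNormal (H := P)).comp (Subgroup.zpowers z).subtype)
  let g : Subgroup.zpowers z →* S ⧸ K := (QuotientGroup.mk' K).comp (Subgroup.zpowers z).subtype
  have hsingle : ∀ (x : P) (a : ZMod (p ^ 2)), ∃ k : ℤ,
      ∀ y : P, ι (π (Multiplicative.ofAdd (Finsupp.single y a))) = ((y : S) : S ⧸ K) ^ k := by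
    intro x a
    obtain ⟨k, rfl⟩ := ZMod.intCast_surjective a
    refine ⟨k, fun y => ?_⟩
    rw [freeToAbelianization_single, hι, Subgroup.coe_zpow, QuotientGroup.mk_zpow]
  have hcompat : ∀ c, (ι.comp π).comp (φ c).toMonoidHom =
      (MulAut.conj (g c)).toMonoidHom.comp (ι.comp π) := by
    intro c
    refine MonoidHom.ext fun v => ?_
    change ι (π (φ c v)) = g c * ι (π v) * (g c)⁻¹
    have key : ∀ v : P →₀ ZMod (p ^ 2), ι (π (φ c (Multiplicative.ofAdd v))) =
        g c * ι (π (Multiplicative.ofAdd v)) * (g c)⁻¹ := by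
      intro v
      induction v using Finsupp.induction_linear with
      | zero => simp
      | add v w hv hw =>
        rw [ofAdd_add, map_mul, map_mul, map_mul, hv, hw, map_mul, map_mul]
        group
      | single x a =>
        obtain ⟨k, hk⟩ := hsingle x a
        have h1 : φ c (Multiplicative.ofAdd (Finsupp.single x a)) = Multiplicative.ofAdd
            (Finsupp.single (MulAut.conjNormal (H := P) (c : S) x) a) :=
          permutationAut_single _ _ _
        rw [h1, hk, hk, MulAut.conjNormal_apply, QuotientGroup.mk_mul, QuotientGroup.mk_mul,
          QuotientGroup.mk_inv, conj_zpow]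
        rfl
    exact key v.toAdd
  let f : Multiplicative (P →₀ ZMod (p ^ 2)) ⋊[φ] Subgroup.zpowers z →* S ⧸ K :=
    SemidirectProduct.lift (ι.comp π) g hcompat
  have hfl : ∀ v, f (SemidirectProduct.inl v) = ι (π v) := fun v => SemidirectProduct.lift_inl ..
  have hfr : ∀ c, f (SemidirectProduct.inr c) = ((c : S) : S ⧸ K) :=
    fun c => SemidirectProduct.lift_inr ..
  have hιP : ∀ v, ∃ x ∈ P, ι v = ((x : S) : S ⧸ K) := by
    intro v
    obtain ⟨x, rfl⟩ := QuotientGroup.mk_surjective v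
    exact ⟨x, x.2, rfl⟩
  have hfin : Finite (Multiplicative (P →₀ ZMod (p ^ 2)) ⋊[φ] Subgroup.zpowers z) := by
    have : Finite (Multiplicative (P →₀ ZMod (p ^ 2))) :=
      Finite.of_equiv (P → ZMod (p ^ 2)) (Finsupp.equivFunOnFinite.symm.trans Multiplicative.ofAdd)
    exact Finite.of_equiv _ SemidirectProduct.equivProd.symm
  have hmem : ∀ w : Multiplicative (P →₀ ZMod (p ^ 2)) ⋊[φ] Subgroup.zpowers z,
      w ∈ (SemidirectProduct.rightHom (φ := φ)).ker → ∃ v, w = SemidirectProduct.inl v := by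
    intro w hw
    rw [← SemidirectProduct.range_inl_eq_ker_rightHom] at hw
    obtain ⟨v, rfl⟩ := hw
    exact ⟨v, rfl⟩
  refine ⟨_, _, hfin, (SemidirectProduct.rightHom (φ := φ)).ker, f, ?_, inferInstance, ?_, ?_, ?_,
    ?_, ?_⟩
  · rw [← MonoidHom.range_eq_top, eq_top_iff]
    intro y _
    obtain ⟨s, rfl⟩ := QuotientGroup.mk_surjective y
    obtain ⟨x, hx, c, hc, rfl⟩ := Subgroup.mem_sup_of_normal_left.1
      (htop ▸ Subgroup.mem_top s : s ∈ P ⊔ Subgroup.zpowers z)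
    rw [QuotientGroup.mk_mul]
    refine mul_mem ⟨SemidirectProduct.inl (Multiplicative.ofAdd
      (Finsupp.single ⟨x, hx⟩ ((1 : ℤ) : ZMod (p ^ 2)))), ?_⟩
      ⟨SemidirectProduct.inr ⟨c, hc⟩, hfr _⟩
    rw [hfl, freeToAbelianization_single, zpow_one, hι]
  · intro w
    rw [MonoidHom.mem_ker, map_pow]
    obtain ⟨k, hk⟩ := Subgroup.mem_zpowers_iff.1 (SemidirectProduct.rightHom w).2
    refine Subtype.ext ?_
    rw [Subgroup.coe_pow, ← hk, zpow_pow_eq_one hz, Subgroup.coe_one]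
  · intro v hv w hw
    obtain ⟨v, rfl⟩ := hmem v hv
    obtain ⟨w, rfl⟩ := hmem w hw
    rw [← map_mul, ← map_mul, mul_comm]
  · intro w hw
    obtain ⟨v, rfl⟩ := hmem w hw
    rw [← map_pow]
    have : v ^ p ^ 2 = 1 := by
      refine Multiplicative.toAdd.injective (Finsupp.ext fun i => ?_)
      rw [toAdd_pow, Finsupp.smul_apply, nsmul_eq_mul, CharP.cast_eq_zero, zero_mul]
      rfl
    rw [this, map_one]
  · intro w hw hwp
    obtain ⟨v, rfl⟩ := hmem w hw
    rw [← map_pow] at hwp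
    obtain ⟨v', rfl⟩ := exists_eq_pow_of_pow_eq_one hp v
      (SemidirectProduct.inl_injective (hwp.trans (map_one _).symm))
    rw [hfl, map_pow, hab, map_one]
  · intro w hw
    obtain ⟨v, rfl⟩ := hmem w hw
    rw [hfl]
    exact hιP _

/-! ### Schmidt groups of the same type lie in F together -/

namespace FiniteGroupClass

variable {F : FiniteGroupClass.{u}}

/-- A Schmidt group in `F` can be replaced by one whose normal Sylow subgroup is elementary
abelian. -/
theorem exists_elementary_quotient (hform : F.IsFormation) {p q b : ℕ} (hp : p.Prime)
    (hq : q.Prime) (hpq : p ≠ q) {T : Type u} [Group T] [Finite T] (hT : IsSchmidtGroup T)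
    (hTF : F.mem T) {P : Subgroup T} [P.Normal] (hP : IsPGroup p P) {z : T} (hz : z ^ q ^ b = 1)
    (htop : P ⊔ Subgroup.zpowers z = ⊤) :
    ∃ (T' : Type u) (_ : Group T') (_ : Finite T') (P' : Subgroup T') (w : T'),
      IsSchmidtGroup T' ∧ F.mem T' ∧ P'.Normal ∧ w ^ q ^ b = 1 ∧ P' ⊔ Subgroup.zpowers w = ⊤ ∧
      (∀ x y : P', x * y = y * x) ∧ (∀ x : P', x ^ p = 1) := by
  have hK : ((commutator P).map P.subtype).Normal := ConjAct.normal_of_characteristic_of_normal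
  have hmin := hT.isMinimallyNontrivial_conj hp hq hpq hP hz htop
  have hσ := conjNormal_pow_eq_one (P := P) hz
  set K := (commutator P).map P.subtype with hKdef
  have hsurj := QuotientGroup.mk'_surjective K
  have hzK : (z : T ⧸ K) ^ q ^ b = 1 := by
    rw [← QuotientGroup.mk_pow, hz, QuotientGroup.mk_one]
  refine ⟨T ⧸ K, inferInstance, inferInstance, P.map (QuotientGroup.mk' K), z,
    ⟨inferInstance, fun hnil => ?_, isNilpotent_of_subgroup_quotient K hT.2.2⟩,
    hform.quotient_mem T K hTF, Subgroup.Normal.map inferInstance _ hsurj, hzK, ?_, ?_, ?_⟩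
  · refine hmin.commutator_ne_top hp hP (top_unique ?_)
    rw [← hmin.closure_eq_top hp hq hpq hP hσ, Subgroup.closure_le]
    rintro _ ⟨x, rfl⟩
    obtain ⟨a, ha⟩ := hP.exists_pow_eq_one x.2
    have hc := Group.IsNilpotent.commute_of_pow_eq_one hp hq hpq (i := a)
      (x := ((x : T) : T ⧸ K)) (by rw [← QuotientGroup.mk_pow, ha, QuotientGroup.mk_one]) hzK
    have h1 : ((z * x * z⁻¹ * (x : T)⁻¹ : T) : T ⧸ K) = 1 := by
      rw [QuotientGroup.mk_mul, QuotientGroup.mk_mul, QuotientGroup.mk_mul, ← hc.eq,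
        QuotientGroup.mk_inv, QuotientGroup.mk_inv]
      group
    rw [QuotientGroup.eq_one_iff] at h1
    obtain ⟨y, hy, hyx⟩ := h1
    have : y = MulAut.conjNormal z x * x⁻¹ := Subtype.ext (by simpa using hyx)
    exact (this ▸ hy : MulAut.conjNormal z x * x⁻¹ ∈ commutator P)
  · have := congrArg (Subgroup.map (QuotientGroup.mk' K)) htop
    rwa [Subgroup.map_sup, MonoidHom.map_zpowers, Subgroup.map_top_of_surjective _ hsurj] at this
  · rintro ⟨_, x, hx, rfl⟩ ⟨_, y, hy, rfl⟩
    refine Subtype.ext ?_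
    change ((x : T) : T ⧸ K) * (y : T ⧸ K) = (y : T ⧸ K) * (x : T ⧸ K)
    rw [← QuotientGroup.mk_mul, ← QuotientGroup.mk_mul, QuotientGroup.eq]
    refine ⟨⁅(⟨y, hy⟩ : P)⁻¹, (⟨x, hx⟩ : P)⁻¹⁆,
      Subgroup.commutator_mem_commutator (Subgroup.mem_top _) (Subgroup.mem_top _), ?_⟩
    simp [commutatorElement_def, mul_assoc]
  · rintro ⟨_, x, hx, rfl⟩
    refine Subtype.ext ?_
    change ((x : T) : T ⧸ K) ^ p = 1
    rw [← QuotientGroup.mk_pow, QuotientGroup.eq_one_iff]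
    exact ⟨(⟨x, hx⟩ : P) ^ p, hmin.pow_mem_commutator hp hq hpq hP hσ _, by simp⟩

/-- `S` is a quotient of the fibre product `X` of `S` and the cover `W` over `S / P'`. A critical
subgroup of `X` would be a Schmidt group of type `(p, q)` whose normal `p`-subgroup is elementary
abelian, and so would lie in `F` by comparison with `T'`. -/
theorem mem_of_isSchmidtGroup (hform : F.IsFormation) (hher : F.IsHereditary)
    (hshem : F.HasShemetkovProperty) {p q : ℕ} (hp : p.Prime) (hq : q.Prime) (hpq : p ≠ q)
    (hpF : p ∈ F.primes) (hqF : q ∈ F.primes)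
    {S T : Type u} [Group S] [Finite S] [Group T] [Finite T] (hS : IsSchmidtGroup S)
    (hT : IsSchmidtGroup T) (hTF : F.mem T) (hSpq : IsPrimaryExtension p q S)
    (hTpq : IsPrimaryExtension p q T) : F.mem S := by
  obtain ⟨Q, w, hQn, hQ, ⟨c, hw⟩, hQw⟩ := hTpq
  obtain ⟨T', _, _, Q', w', hT', hT'F, hQ'n, hw', hQw', hQ'c, hQ'p⟩ :=
    exists_elementary_quotient hform hp hq hpq hT hTF hQ hw hQw
  obtain ⟨P, z, hPn, hP, ⟨b, hz⟩, hPz⟩ := hSpq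
  have hK : ((commutator P).map P.subtype).Normal := ConjAct.normal_of_characteristic_of_normal
  have hmin := hS.isMinimallyNontrivial_conj hp hq hpq hP hz hPz
  have hσ := conjNormal_pow_eq_one (P := P) hz
  obtain ⟨W, _, _, U, f, hf, hUn, hWU, hUc, hUp, hUf, hUP⟩ :=
    exists_cover hp hz hPz (hmin.pow_mem_commutator hp hq hpq hP hσ)
  set K := (commutator P).map P.subtype with hKdef
  let X : Subgroup (W × S) := (f.comp (MonoidHom.fst W S)).eqLocus
    ((QuotientGroup.mk' K).comp (MonoidHom.snd W S))
  have hX : ∀ x : X, f (x : W × S).1 = ((x : W × S).2 : S ⧸ K) := fun x => x.2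
  suffices hXF : F.mem X by
    refine hform.mem_of_surjective ((MonoidHom.snd W S).comp X.subtype) (fun s => ?_) hXF
    obtain ⟨w, hw⟩ := hf (s : S ⧸ K)
    exact ⟨⟨(w, s), hw⟩, rfl⟩
  let N : Subgroup X := (U.prod P).subgroupOf X
  have hN : IsPGroup p N := by
    refine isPGroup_iff_pow_pow_eq_one.2 ?_
    rintro ⟨x, hxU, hxP⟩
    obtain ⟨a, ha⟩ := hP.exists_pow_eq_one hxP
    refine ⟨a + 2, Subtype.ext (Subtype.ext (Prod.ext ?_ ?_))⟩
    · change ((x : W × S).1) ^ p ^ (a + 2) = 1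
      have h2 := hUp _ hxU
      rw [pow_add, mul_comm, pow_mul]
      exact (congrArg (· ^ p ^ a) h2).trans (one_pow _)
    · change ((x : W × S).2) ^ p ^ (a + 2) = 1
      rw [pow_add, pow_mul]
      exact (congrArg (· ^ p ^ 2) ha).trans (one_pow _)
  have hNq : ∀ x : X, x ^ q ^ b ∈ N := fun x =>
    ⟨hWU _, pow_mem_of_sup_zpowers_eq_top hz hPz _⟩
  have hXp : groupPrimes X ⊆ F.primes := by
    rintro r ⟨hr, hrX⟩
    have := Fact.mk hr
    obtain ⟨x, hx⟩ := exists_prime_orderOf_dvd_card' (G := X) r hrX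
    obtain ⟨a, ha⟩ := hN.exists_pow_eq_one (hNq x)
    rw [← pow_mul] at ha
    have hd := orderOf_dvd_of_pow_eq_one ha
    rw [hx, hr.dvd_mul] at hd
    rcases hd with h | h
    · rwa [(Nat.prime_dvd_prime_iff_eq hr hq).1 (hr.dvd_of_dvd_pow h)]
    · rwa [(Nat.prime_dvd_prime_iff_eq hr hp).1 (hr.dvd_of_dvd_pow h)]
  by_contra hXF
  obtain ⟨R, hRc, hR⟩ := exists_isSCritical_isSchmidtGroup hher hshem hXF hXp
  obtain ⟨P₁, z₁, hP₁n, hP₁, ⟨b₁, hz₁⟩, htop₁⟩ :=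
    hR.isPrimaryExtension_of_subgroup hp hq hpq hN (fun x => ⟨b, hNq x⟩)
  have hmin₁ := hR.isMinimallyNontrivial_conj hp hq hpq hP₁ hz₁ htop₁
  have hσ₁ := conjNormal_pow_eq_one (P := P₁) hz₁
  have hP₁N : ∀ x ∈ P₁, ((x : X) : W × S).1 ∈ U ∧ ((x : X) : W × S).2 ∈ P := by
    intro x hx
    obtain ⟨a, ha⟩ := hP₁.exists_pow_eq_one hx
    have haX : (x : X) ^ p ^ a = 1 := by simpa using congrArg Subtype.val ha
    have h1 : (x : X) ∈ N := by
      rw [← QuotientGroup.eq_one_iff]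
      exact eq_one_of_pow_prime_pow hp hq hpq (a := a) (b := b)
        (by rw [← QuotientGroup.mk_pow, haX, QuotientGroup.mk_one])
        (by rw [← QuotientGroup.mk_pow]; exact (QuotientGroup.eq_one_iff _).2 (hNq _))
    exact h1
  let l : P₁ →* W := ((MonoidHom.fst W S).comp X.subtype).comp (R.subtype.comp P₁.subtype)
  have hl : commutator P₁ ≤ l.ker := by
    refine Subgroup.commutator_le.2 fun x _ y _ => ?_
    rw [MonoidHom.mem_ker, map_commutatorElement, commutatorElement_eq_one_iff_mul_comm]
    exact hUc _ (hP₁N x x.2).1 _ (hP₁N y y.2).1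
  -- The projection to `W` kills the derived subgroup of `P₁`, since `U` is abelian; `p`-th powers
  -- lie there, so the first component is killed by `p` and has trivial image in `S ⧸ K`.
  have hsnd : ∀ x ∈ P₁, ((x : X) : W × S).2 ∈ K := by
    intro x hx
    have h1 : l (⟨x, hx⟩ ^ p) = 1 := hl (hmin₁.pow_mem_commutator hp hq hpq hP₁ hσ₁ ⟨x, hx⟩)
    rw [map_pow] at h1
    rw [← QuotientGroup.eq_one_iff, ← hX]
    exact hUf _ (hP₁N x hx).1 h1
  -- First components lie in the abelian `U`; second components lie in the derived subgroup of `P`,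
  -- which is central in `P`.
  have hcomm₁ : ∀ x y : P₁, x * y = y * x := by
    intro x y
    refine Subtype.ext (Subtype.ext (Subtype.ext (Prod.ext
      (hUc _ (hP₁N x x.2).1 _ (hP₁N y y.2).1) ?_)))
    obtain ⟨d, hd, hdx⟩ := hsnd x x.2
    have h1 := hmin.commute_of_mem_commutator hp hq hpq hP hσ hd ⟨_, (hP₁N y y.2).2⟩
    have h2 := congrArg Subtype.val h1.eq
    change (((x : R) : X) : W × S).2 * (((y : R) : X) : W × S).2 =
      (((y : R) : X) : W × S).2 * (((x : R) : X) : W × S).2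
    rw [← hdx]
    exact h2
  have hexp₁ : ∀ x : P₁, x ^ p = 1 := by
    intro x
    have h1 := hmin₁.pow_mem_commutator hp hq hpq hP₁ hσ₁ x
    have h2 : commutator P₁ = ⊥ := by
      rw [eq_bot_iff]
      refine Subgroup.commutator_le.2 fun x _ y _ => ?_
      rw [Subgroup.mem_bot, commutatorElement_eq_one_iff_mul_comm]
      exact hcomm₁ x y
    rwa [h2, Subgroup.mem_bot] at h1
  exact hRc.1 (mem_of_elementary hform hher hshem hp hq hpq hR hT' hT'F
    ((groupPrimes_subgroup_subset R).trans hXp) hz₁ hw' htop₁ hQw' hcomm₁ hQ'c hexp₁ hQ'p)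

end FiniteGroupClass

/-! ### The centralizing condition and normal subgroups -/

/-- Every `q`-element that normalizes a `p`-subgroup centralizes it. -/
def CentralizesPSubgroups (p q : ℕ) (G : Type*) [Group G] : Prop :=
  ∀ (P : Subgroup G) (z : G) (b : ℕ), IsPGroup p P → z ^ q ^ b = 1 →
    (∀ x ∈ P, z * x * z⁻¹ ∈ P) → ∀ x ∈ P, Commute z x

theorem CentralizesPSubgroups.commute_of_mem {G : Type*} [Group G] {p q : ℕ} {H : Subgroup G}
    (h : CentralizesPSubgroups p q H) {P : Subgroup G} (hPH : P ≤ H) (hP : IsPGroup p P) {z : G}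
    (hzH : z ∈ H) {b : ℕ} (hz : z ^ q ^ b = 1) (hnorm : ∀ x ∈ P, z * x * z⁻¹ ∈ P) {x : G}
    (hx : x ∈ P) : Commute z x := by
  have := h (P.subgroupOf H) ⟨z, hzH⟩ b hP.comap_subtype (Subtype.ext (by simpa using hz))
    (fun y hy => Subgroup.mem_subgroupOf.2 (hnorm y (Subgroup.mem_subgroupOf.1 hy)))
    ⟨x, hPH hx⟩ (Subgroup.mem_subgroupOf.2 hx)
  exact congrArg Subtype.val this.eq

theorem groupPrimes_subset_pair {G : Type*} [Group G] [Finite G] {N : Subgroup G} {p q : ℕ}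
    (hp : p.Prime) (hq : q.Prime) (hN : IsPGroup p N) (hNq : ∀ x : G, ∃ b, x ^ q ^ b ∈ N) :
    groupPrimes G ⊆ {p, q} := by
  rintro r ⟨hr, hrG⟩
  have := Fact.mk hr
  obtain ⟨x, hx⟩ := exists_prime_orderOf_dvd_card' (G := G) r hrG
  obtain ⟨b, hb⟩ := hNq x
  obtain ⟨a, ha⟩ := hN.exists_pow_eq_one hb
  rw [← pow_mul] at ha
  have hd := orderOf_dvd_of_pow_eq_one ha
  rw [hx, hr.dvd_mul] at hd
  rcases hd with h | h
  · exact Or.inr ((Nat.prime_dvd_prime_iff_eq hr hq).1 (hr.dvd_of_dvd_pow h))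
  · exact Or.inl ((Nat.prime_dvd_prime_iff_eq hr hp).1 (hr.dvd_of_dvd_pow h))

theorem isSupersoluble_of_isCyclic {G : Type*} [Group G] (N : Subgroup G) [N.Normal] [IsCyclic N]
    [IsCyclic (G ⧸ N)] : IsSupersoluble G := by
  refine ⟨2, fun i => match i with | 0 => ⊥ | 1 => N | _ => ⊤, ?_, rfl, rfl, ?_⟩
  · rintro (_ | _ | _)
    · exact (inferInstance : (⊥ : Subgroup G).Normal)
    · exact (inferInstance : N.Normal)
    · exact (inferInstance : (⊤ : Subgroup G).Normal)
  · rintro (_ | _ | i) hi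
    · exact ⟨bot_le, isCyclic_of_surjective _
        ((QuotientGroup.mk' (⊥ : Subgroup G)).subgroupMap_surjective N)⟩
    · refine ⟨le_top, ?_⟩
      have : IsCyclic ((⊤ : Subgroup G).map (QuotientGroup.mk' N)) := by
        rw [Subgroup.map_top_of_surjective _ (QuotientGroup.mk'_surjective N)]
        exact isCyclic_of_surjective (Subgroup.topEquiv (G := G ⧸ N)).symm
          (Subgroup.topEquiv (G := G ⧸ N)).symm.surjective
      exact this
    · omega

theorem isCyclic_quotient_of_sup_zpowers {G : Type*} [Group G] {N : Subgroup G} [N.Normal] {z : G}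
    (h : N ⊔ Subgroup.zpowers z = ⊤) : IsCyclic (G ⧸ N) := by
  refine ⟨(z : G ⧸ N), fun y => ?_⟩
  obtain ⟨s, rfl⟩ := QuotientGroup.mk_surjective y
  obtain ⟨m, hm, v, hv, rfl⟩ := Subgroup.mem_sup_of_normal_left.1
    (h ▸ Subgroup.mem_top s : s ∈ N ⊔ Subgroup.zpowers z)
  obtain ⟨k, rfl⟩ := Subgroup.mem_zpowers_iff.1 hv
  exact ⟨k, by simp [(QuotientGroup.eq_one_iff m).2 hm]⟩

/-- The coprime argument of `MulAut.apply_eq_of_apply_mul_inv_eq`, for elements of a group. -/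
theorem commute_of_commute_commutator {G : Type*} [Group G] {p q a b : ℕ} (hp : p.Prime)
    (hq : q.Prime) (hpq : p ≠ q) {z x : G} (hz : z ^ q ^ b = 1)
    (hm : (z * x * z⁻¹ * x⁻¹) ^ p ^ a = 1) (hc : Commute z (z * x * z⁻¹ * x⁻¹)) :
    Commute z x := by
  set m := z * x * z⁻¹ * x⁻¹ with hmdef
  have hzx : z * x = m * x * z := by rw [hmdef]; group
  have key : ∀ k : ℕ, z ^ k * x = m ^ k * x * z ^ k := by
    intro k
    induction k with
    | zero => simp
    | succ k ih =>
      calc z ^ (k + 1) * x = z * (z ^ k * x) := by rw [pow_succ', mul_assoc]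
        _ = (z * m ^ k) * x * z ^ k := by rw [ih]; group
        _ = m ^ k * (z * x) * z ^ k := by rw [(hc.pow_right k).eq]; group
        _ = m ^ (k + 1) * x * z ^ (k + 1) := by rw [hzx, pow_succ, pow_succ']; group
  have h1 : m ^ q ^ b = 1 := by
    have := key (q ^ b)
    rw [hz, one_mul, mul_one] at this
    exact right_eq_mul.1 this
  rw [Commute, SemiconjBy, hzx, eq_one_of_pow_prime_pow hp hq hpq hm h1, one_mul]

/-- By the quotient condition `[z, P] ≤ P ∩ N`, so by coprimality it is enough that `z` centralizes
`P ∩ N`. There the Frattini argument replaces `z` by a `q`-element of `N` with the same action. -/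
theorem centralizesPSubgroups_of_normal {G : Type*} [Group G] [Finite G] {p q : ℕ} (hp : p.Prime)
    (hq : q.Prime) (hpq : p ≠ q) {N : Subgroup G} [N.Normal] (hN : CentralizesPSubgroups p q N)
    (hQ : CentralizesPSubgroups p q (G ⧸ N))
    (hR : ∀ R : Sylow p N, ∀ (c : G) (a : ℕ), c ^ q ^ a = 1 →
      c ∈ Subgroup.normalizer ((R.1.map N.subtype : Subgroup G) : Set G) →
      ∀ x ∈ R.1.map N.subtype, Commute c x) : CentralizesPSubgroups p q G := by
  have := Fact.mk hp
  intro P z b hP hz hnorm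
  have hzN : ((z : G) : G ⧸ N) ^ q ^ b = 1 := by
    rw [← QuotientGroup.mk_pow, hz, QuotientGroup.mk_one]
  have hinf : ∀ x ∈ P ⊓ N, Commute z x := by
    have hnorm' : ∀ x ∈ P ⊓ N, z * x * z⁻¹ ∈ P ⊓ N := fun x hx =>
      ⟨hnorm x hx.1, Subgroup.Normal.conj_mem inferInstance x hx.2 z⟩
    have hPN : IsPGroup p (P ⊓ N : Subgroup G) := hP.to_le inf_le_left
    obtain ⟨R, hPR⟩ := (hPN.comap_subtype (K := N)).exists_le_sylow
    have hPR' : P ⊓ N ≤ R.1.map N.subtype := fun x hx =>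
      ⟨⟨x, hx.2⟩, hPR (Subgroup.mem_subgroupOf.2 hx), rfl⟩
    obtain ⟨y, hy, n₀, hn₀, hyn⟩ := Subgroup.mem_sup_of_normal_right.1
      (Sylow.normalizer_sup_eq_top R ▸ Subgroup.mem_top z :
        z ∈ Subgroup.normalizer ((R.1.map N.subtype : Subgroup G) : Set G) ⊔ N)
    -- The `q`-part `y ^ m` is still congruent to `z` modulo `N`, because `m ≡ 1` modulo `q ^ b`; it
    -- centralizes the Sylow subgroup by `hR`, so `(y ^ m)⁻¹ * z ∈ N` acts on `P ∩ N` as `z` does.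
    obtain ⟨m, a, hma, hm⟩ := exists_pow_primePart hq y b
    have hc := hR R (y ^ m) a hma (pow_mem hy m)
    have hyz : (y : G ⧸ N) = z := by
      rw [← hyn, QuotientGroup.mk_mul, (QuotientGroup.eq_one_iff n₀).2 hn₀, mul_one]
    have hnN : (y ^ m)⁻¹ * z ∈ N := by
      rw [← QuotientGroup.eq, QuotientGroup.mk_pow, hyz, pow_eq_self_of_modEq_one hzN hm]
    set n := (y ^ m)⁻¹ * z with hn
    have hact : ∀ x ∈ P ⊓ N, n * x * n⁻¹ = z * x * z⁻¹ := by
      intro x hx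
      have h1 := (hc _ (hPR' (hnorm' x hx))).eq
      calc n * x * n⁻¹ = (y ^ m)⁻¹ * (z * x * z⁻¹ * y ^ m) := by rw [hn]; group
        _ = z * x * z⁻¹ := by rw [← h1]; group
    have hactk : ∀ k : ℕ, ∀ x ∈ P ⊓ N,
        n ^ k * x * (n ^ k)⁻¹ = z ^ k * x * (z ^ k)⁻¹ ∧ z ^ k * x * (z ^ k)⁻¹ ∈ P ⊓ N := by
      intro k
      induction k with
      | zero => intro x hx; simpa using hx
      | succ k ih =>
        intro x hx
        obtain ⟨h1, h2⟩ := ih x hx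
        have e1 : n ^ (k + 1) * x * (n ^ (k + 1))⁻¹ = n * (n ^ k * x * (n ^ k)⁻¹) * n⁻¹ := by
          rw [pow_succ']; group
        have e2 : z ^ (k + 1) * x * (z ^ (k + 1))⁻¹ = z * (z ^ k * x * (z ^ k)⁻¹) * z⁻¹ := by
          rw [pow_succ']; group
        rw [e1, e2, h1]
        exact ⟨hact _ h2, hnorm' _ h2⟩
    -- `n` itself need not be a `q`-element; its `q`-part `n ^ k` acts as `z ^ k = z`.
    obtain ⟨k, a', hka, hk⟩ := exists_pow_primePart hq n b
    have hzk : z ^ k = z := pow_eq_self_of_modEq_one hz hk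
    intro x hx
    have hcomm := hN.commute_of_mem (inf_le_right : P ⊓ N ≤ N) hPN (pow_mem hnN k) hka
      (fun y hy => by
        rw [(hactk k y hy).1]
        exact (hactk k y hy).2) hx
    have h1 := (hactk k x hx).1
    rw [hcomm.eq, mul_inv_cancel_right, hzk] at h1
    exact (eq_mul_inv_iff_mul_eq.1 h1).symm
  intro x hx
  have hmP : z * x * z⁻¹ * x⁻¹ ∈ P := mul_mem (hnorm x hx) (inv_mem hx)
  have hmN : z * x * z⁻¹ * x⁻¹ ∈ N := by
    have hq' := hQ (P.map (QuotientGroup.mk' N)) z b (hP.map _) hzN (by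
      rintro _ ⟨y, hy, rfl⟩
      exact ⟨_, hnorm y hy, rfl⟩) x ⟨x, hx, rfl⟩
    rw [← QuotientGroup.eq_one_iff, QuotientGroup.mk_mul, QuotientGroup.mk_mul,
      QuotientGroup.mk_mul, hq'.eq, QuotientGroup.mk_inv, QuotientGroup.mk_inv]
    group
  obtain ⟨a, ha⟩ := hP.exists_pow_eq_one hmP
  exact commute_of_commute_commutator hp hq hpq hz ha (hinf _ ⟨hmP, hmN⟩)

theorem Subgroup.card_dvd_card_mul_card {G : Type*} [Group G] [Finite G] {X Y : Subgroup G}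
    (h : ∀ g : G, ∃ x ∈ X, ∃ y ∈ Y, x * y = g) : Nat.card G ∣ Nat.card X * Nat.card Y := by
  rw [← Y.index_mul_card]
  refine mul_dvd_mul_right ?_ _
  have horb : MulAction.orbit X ((1 : G) : G ⧸ Y) = Set.univ := by
    rw [Set.eq_univ_iff_forall]
    intro c
    obtain ⟨g, rfl⟩ := QuotientGroup.mk_surjective c
    obtain ⟨x, hx, y, hy, rfl⟩ := h g
    refine ⟨⟨x, hx⟩, ?_⟩
    change ((x * 1 : G) : G ⧸ Y) = _
    rw [QuotientGroup.eq]
    simpa using hy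
  rw [Subgroup.index_eq_card, ← Nat.card_univ (α := G ⧸ Y), ← horb]
  have := Fintype.ofFinite X
  have := Fintype.ofFinite (MulAction.orbit X ((1 : G) : G ⧸ Y))
  have := Fintype.ofFinite (MulAction.stabilizer X ((1 : G) : G ⧸ Y))
  rw [Nat.card_eq_fintype_card, Nat.card_eq_fintype_card]
  exact Dvd.intro _ (MulAction.card_orbit_mul_card_stabilizer_eq_card_group X _)

/-- The automorphism group induced on `R` is the product of the images of `X` and `Y`. Both images
have order prime to `q`, hence so does the product. -/
theorem commute_of_normalizer_product {G : Type*} [Group G] [Finite G] {q : ℕ} (hq : q.Prime)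
    {R X Y : Subgroup G}
    (hXY : ∀ g ∈ Subgroup.normalizer (R : Set G), ∃ x ∈ X, ∃ y ∈ Y, x * y = g)
    (hXR : X ≤ Subgroup.normalizer (R : Set G)) (hYR : Y ≤ Subgroup.normalizer (R : Set G))
    (hX : ∀ (c : G) (a : ℕ), c ∈ X → c ^ q ^ a = 1 → ∀ r ∈ R, Commute c r)
    (hY : ∀ (c : G) (a : ℕ), c ∈ Y → c ^ q ^ a = 1 → ∀ r ∈ R, Commute c r)
    {c : G} {a : ℕ} (hc : c ^ q ^ a = 1) (hcR : c ∈ Subgroup.normalizer (R : Set G)) :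
    ∀ r ∈ R, Commute c r := by
  have := Fact.mk hq
  let f := R.normalizerMonoidHom
  have hf : ∀ g, f g = 1 ↔ ∀ r ∈ R, Commute (g : G) r := by
    intro g
    rw [MulEquiv.ext_iff]
    constructor
    · intro h r hr
      have := congrArg Subtype.val (h ⟨r, hr⟩)
      exact mul_inv_eq_iff_eq_mul.1 this
    · intro h r
      refine Subtype.ext ?_
      change (g : G) * r * (g : G)⁻¹ = r
      rw [(h r r.2).eq, mul_inv_cancel_right]
  have key : ∀ Z : Subgroup G, Z ≤ Subgroup.normalizer (R : Set G) →
      (∀ (c : G) (a : ℕ), c ∈ Z → c ^ q ^ a = 1 → ∀ r ∈ R, Commute c r) →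
      ¬ q ∣ Nat.card ((Z.subgroupOf (Subgroup.normalizer (R : Set G))).map f.rangeRestrict) := by
    intro Z hZ hZR hdvd
    obtain ⟨⟨w, hw⟩, ho⟩ := exists_prime_orderOf_dvd_card' q hdvd
    rw [Subgroup.orderOf_mk] at ho
    obtain ⟨z, hz, rfl⟩ := hw
    obtain ⟨m, a, hma, hm⟩ := exists_pow_primePart hq z 1
    have h1 : f (z ^ m) = 1 := by
      rw [hf]
      exact hZR _ a (pow_mem (Subgroup.mem_subgroupOf.1 hz) m) (by
        simpa using congrArg Subtype.val hma)
    have h2 : (f.rangeRestrict z) ^ q = 1 := ho ▸ pow_orderOf_eq_one _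
    have h3 := pow_eq_self_of_modEq_one h2 (by simpa using hm)
    rw [← map_pow] at h3
    have h4 : f.rangeRestrict (z ^ m) = 1 := Subtype.ext h1
    rw [← h3, h4, orderOf_one] at ho
    exact hq.one_lt.ne ho
  have hdvd := Subgroup.card_dvd_card_mul_card
    (X := (X.subgroupOf (Subgroup.normalizer (R : Set G))).map f.rangeRestrict)
    (Y := (Y.subgroupOf (Subgroup.normalizer (R : Set G))).map f.rangeRestrict) (by
      intro g
      obtain ⟨g, rfl⟩ := f.rangeRestrict_surjective g
      obtain ⟨x, hx, y, hy, hxy⟩ := hXY g g.2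
      refine ⟨_, ⟨⟨x, hXR hx⟩, Subgroup.mem_subgroupOf.2 hx, rfl⟩, _,
        ⟨⟨y, hYR hy⟩, Subgroup.mem_subgroupOf.2 hy, rfl⟩, ?_⟩
      rw [← map_mul]
      exact congrArg _ (Subtype.ext hxy))
  have hcf : f.rangeRestrict ⟨c, hcR⟩ ^ q ^ a = 1 := by
    rw [← map_pow, show (⟨c, hcR⟩ : Subgroup.normalizer (R : Set G)) ^ q ^ a = 1 from
      Subtype.ext (by simpa using hc), map_one]
  refine (hf ⟨c, hcR⟩).1 ?_
  have h1 : f.rangeRestrict ⟨c, hcR⟩ = 1 := by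
    rw [← orderOf_eq_one_iff]
    obtain ⟨k, -, hk⟩ := (Nat.dvd_prime_pow hq).1 (orderOf_dvd_of_pow_eq_one hcf)
    rw [hk]
    by_contra hne
    have h2 : q ∣ orderOf (f.rangeRestrict ⟨c, hcR⟩) := by
      rw [hk]
      exact dvd_pow_self q (by rintro rfl; exact hne (pow_zero q))
    have h3 := (h2.trans (orderOf_dvd_natCard _)).trans hdvd
    exact ((Nat.Prime.dvd_mul hq).1 h3).elim (key X hXR hX) (key Y hYR hY)
  exact congrArg Subtype.val h1

/-! ### Local description of F and products over a normal subgroup -/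

namespace FiniteGroupClass

variable {F : FiniteGroupClass.{u}}

/-- The primes `p ≠ q` are primes of `F`, and some Schmidt group that is an extension of a
`p`-group by a cyclic `q`-group is not in `F`. -/
def IsCriticalPair (F : FiniteGroupClass.{u}) (p q : ℕ) : Prop :=
  p.Prime ∧ q.Prime ∧ p ≠ q ∧ p ∈ F.primes ∧ q ∈ F.primes ∧
    ∃ (S : Type u) (_ : Group S) (_ : Finite S),
      IsSchmidtGroup S ∧ IsPrimaryExtension p q S ∧ ¬ F.mem S

theorem IsCriticalPair.not_mem (hform : F.IsFormation) (hher : F.IsHereditary)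
    (hshem : F.HasShemetkovProperty) {p q : ℕ} (h : F.IsCriticalPair p q) {T : Type u} [Group T]
    [Finite T] (hT : IsSchmidtGroup T) (hTpq : IsPrimaryExtension p q T) : ¬ F.mem T := by
  obtain ⟨hp, hq, hpq, hpF, hqF, S, _, _, hS, hSpq, hSF⟩ := h
  exact fun hTF => hSF
    (mem_of_isSchmidtGroup hform hher hshem hp hq hpq hpF hqF hS hT hTF hSpq hTpq)

theorem exists_isSchmidtGroup_of_not_commute {G : Type u} [Group G] [Finite G] {p q b : ℕ}
    (hp : p.Prime) (hq : q.Prime) (hpq : p ≠ q) {P : Subgroup G} (hP : IsPGroup p P) {z : G}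
    (hz : z ^ q ^ b = 1) (hnorm : ∀ x ∈ P, z * x * z⁻¹ ∈ P) {x : G} (hx : x ∈ P)
    (hzx : ¬ Commute z x) : ∃ S : Subgroup (P ⊔ Subgroup.zpowers z : Subgroup G),
      IsSchmidtGroup S ∧ IsPrimaryExtension p q S := by
  have hY := isPrimaryExtension_sup_zpowers hP hz hnorm
  obtain ⟨S, hS⟩ := exists_isSchmidtGroup_of_not_isNilpotent
    (G := (P ⊔ Subgroup.zpowers z : Subgroup G)) (fun hnil => hzx (by
      obtain ⟨a, ha⟩ := hP.exists_pow_eq_one hx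
      have h := Group.IsNilpotent.commute_of_pow_eq_one hp hq hpq (i := a) (j := b)
        (x := (⟨x, Subgroup.mem_sup_left hx⟩ : (P ⊔ Subgroup.zpowers z : Subgroup G)))
        (y := ⟨z, Subgroup.mem_sup_right (Subgroup.mem_zpowers z)⟩)
        (Subtype.ext (by simpa using ha)) (Subtype.ext (by simpa using hz))
      exact congrArg Subtype.val h.symm.eq))
  exact ⟨S, hS, hS.isPrimaryExtension_of_le hp hq hpq hY⟩

theorem IsCriticalPair.centralizesPSubgroups (hform : F.IsFormation) (hher : F.IsHereditary)
    (hshem : F.HasShemetkovProperty) {p q : ℕ} (h : F.IsCriticalPair p q) {G : Type u} [Group G]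
    [Finite G] (hG : F.mem G) : CentralizesPSubgroups p q G := by
  intro P z b hP hz hnorm x hx
  by_contra hzx
  obtain ⟨S, hS, hSpq⟩ := exists_isSchmidtGroup_of_not_commute h.1 h.2.1 h.2.2.1 hP hz hnorm hx hzx
  exact h.not_mem hform hher hshem hS hSpq (hher _ S (hher _ _ hG))

/-- A critical Schmidt subgroup `P⟨z⟩` outside `F` makes its own pair `(p, q)` critical; then `z`
would centralize `P`. -/
theorem mem_of_forall_isCriticalPair (hher : F.IsHereditary) (hshem : F.HasShemetkovProperty)
    {G : Type u} [Group G] [Finite G] (hp : groupPrimes G ⊆ F.primes)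
    (h : ∀ p q, F.IsCriticalPair p q → CentralizesPSubgroups p q G) : F.mem G := by
  by_contra hG
  obtain ⟨S, hSc, hS⟩ := exists_isSCritical_isSchmidtGroup hher hshem hG hp
  have hSp := (groupPrimes_subgroup_subset S).trans hp
  obtain ⟨p, q, hp, hq, hpq, P, z, hPn, hP, ⟨b, hz⟩, htop⟩ := hS.exists_isPrimaryExtension
  have := Fact.mk hp
  have hmin := hS.isMinimallyNontrivial_conj hp hq hpq hP hz htop
  have hnt := hmin.nontrivial
  have hpF : p ∈ F.primes := hSp ⟨hp, by
    obtain ⟨n, hn, hc⟩ := hP.nontrivial_iff_card.1 hnt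
    exact (dvd_pow_self p hn.ne').trans (hc ▸ Subgroup.card_subgroup_dvd_card P)⟩
  have hqF : q ∈ F.primes := hSp ⟨hq, by
    obtain ⟨c, -, hc⟩ := (Nat.dvd_prime_pow hq).1 (orderOf_dvd_of_pow_eq_one hz)
    refine (dvd_pow_self q ?_).trans (hc ▸ orderOf_dvd_natCard z)
    rintro rfl
    rw [pow_zero, orderOf_eq_one_iff] at hc
    exact hmin.ne_one (by rw [hc, map_one])⟩
  have hcrit : F.IsCriticalPair p q :=
    ⟨hp, hq, hpq, hpF, hqF, S, _, inferInstance, hS, ⟨P, z, hPn, hP, ⟨b, hz⟩, htop⟩, hSc.1⟩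
  refine hmin.ne_one (MulEquiv.ext fun x => Subtype.ext ?_)
  have hc := h p q hcrit (P.map S.subtype) z b (hP.map _) (by simpa using congrArg Subtype.val hz)
    (by
      rintro _ ⟨y, hy, rfl⟩
      exact ⟨z * y * z⁻¹, hPn.conj_mem y hy z, by simp⟩) _ ⟨x, x.2, rfl⟩
  refine Subtype.ext ?_
  change (z : G) * ((x : S) : G) * (z : G)⁻¹ = ((x : S) : G)
  exact mul_inv_eq_iff_eq_mul.2 hc.eq

/-- A noncentral action would produce a Schmidt subgroup of `⟨x⟩⟨z⟩`. It is cyclic-by-cyclic, so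
supersoluble and in `F` by `hsup`, against criticality. -/
theorem IsCriticalPair.commute_of_cyclic (hform : F.IsFormation) (hher : F.IsHereditary)
    (hshem : F.HasShemetkovProperty)
    (hsup : ∀ (G : Type u) [Group G] [Finite G],
      IsSchmidtGroup G → IsSupersoluble G → groupPrimes G ⊆ F.primes → F.mem G)
    {p q : ℕ} (h : F.IsCriticalPair p q) {G : Type u} [Group G] [Finite G] {x z : G} {a b : ℕ}
    (hx : x ^ p ^ a = 1) (hz : z ^ q ^ b = 1)
    (hnorm : ∀ y ∈ Subgroup.zpowers x, z * y * z⁻¹ ∈ Subgroup.zpowers x) : Commute z x := by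
  by_contra hzx
  have hp := h.1
  have hq := h.2.1
  have hP := isPGroup_zpowers hx
  have hY := isPrimaryExtension_sup_zpowers hP hz hnorm
  obtain ⟨S, hS, hSpq⟩ := exists_isSchmidtGroup_of_not_commute hp hq h.2.2.1 hP hz hnorm
    (Subgroup.mem_zpowers x) hzx
  refine h.not_mem hform hher hshem hS hSpq (hsup S hS ?_ ?_)
  · have hn := normal_subgroupOf_sup_zpowers hnorm
    have hZc := isCyclic_quotient_of_sup_zpowers
      (sup_zpowers_subgroupOf_eq_top (Subgroup.zpowers x) z)
    let f := (QuotientGroup.mk' ((Subgroup.zpowers x).subgroupOf _)).comp S.subtype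
    have h1 : IsCyclic f.ker := by
      refine isCyclic_of_injective ((((Subgroup.subtype _).comp S.subtype).comp f.ker.subtype).codRestrict
        (Subgroup.zpowers x) fun y => ?_) fun y y' hy => ?_
      · exact Subgroup.mem_subgroupOf.1 ((QuotientGroup.eq_one_iff _).1 (MonoidHom.mem_ker.1 y.2))
      · exact Subtype.ext (Subtype.ext (Subtype.ext (congrArg (fun t : Subgroup.zpowers x => (t : G)) hy)))
    have h2 : IsCyclic (S ⧸ f.ker) :=
      isCyclic_of_injective (QuotientGroup.kerLift f) (QuotientGroup.kerLift_injective f)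
    exact isSupersoluble_of_isCyclic f.ker
  · obtain ⟨P, w, hPn, hP, ⟨c, hw⟩, htop⟩ := hSpq
    refine (groupPrimes_subset_pair hp hq hP
      fun y => ⟨c, pow_mem_of_sup_zpowers_eq_top hw htop y⟩).trans ?_
    rintro r (rfl | rfl)
    · exact h.2.2.2.1
    · exact h.2.2.2.2.1

theorem groupPrimes_subset_of_product {G : Type u} [Group G] [Finite G] {X Y : Subgroup G}
    (hXY : ∀ g : G, ∃ x ∈ X, ∃ y ∈ Y, x * y = g) (hX : F.mem X) (hY : F.mem Y) :
    groupPrimes G ⊆ F.primes := by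
  rintro r ⟨hr, hrG⟩
  rcases (Nat.Prime.dvd_mul hr).1 (hrG.trans (Subgroup.card_dvd_card_mul_card hXY)) with h | h
  · exact groupPrimes_subset_primes hX ⟨hr, h⟩
  · exact groupPrimes_subset_primes hY ⟨hr, h⟩

theorem mem_of_product_of_commute (hform : F.IsFormation) (hher : F.IsHereditary)
    (hshem : F.HasShemetkovProperty) {G : Type u} [Group G] [Finite G] {X Y N : Subgroup G}
    [N.Normal] (hXY : ∀ g : G, ∃ x ∈ X, ∃ y ∈ Y, x * y = g) (hX : F.mem X) (hY : F.mem Y)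
    (hNX : N ≤ X) (hN : F.mem (G ⧸ N))
    (hdec : ∀ (p : ℕ) [Fact p.Prime] (R : Sylow p N), ∀ y ∈ Y, ∃ n ∈ N,
      n * y ∈ Y ∧ n * y ∈ Subgroup.normalizer ((R.1.map N.subtype : Subgroup G) : Set G))
    (hcomm : ∀ p q, F.IsCriticalPair p q → ∀ (R : Sylow p N) (c : G) (a : ℕ), c ∈ Y →
      c ∈ Subgroup.normalizer ((R.1.map N.subtype : Subgroup G) : Set G) → c ^ q ^ a = 1 →
      ∀ x ∈ R.1.map N.subtype, Commute c x) : F.mem G := by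
  refine mem_of_forall_isCriticalPair hher hshem (groupPrimes_subset_of_product hXY hX hY)
    fun p q hpq => ?_
  have := Fact.mk hpq.1
  refine centralizesPSubgroups_of_normal hpq.1 hpq.2.1 hpq.2.2.1
    (hpq.centralizesPSubgroups hform hher hshem (hher.mem_of_le hNX hX))
    (hpq.centralizesPSubgroups hform hher hshem hN) fun R c a hc hcR => ?_
  set R' : Subgroup G := R.1.map N.subtype with hR'
  have hR'X : R' ≤ X := (Subgroup.map_subtype_le _).trans hNX
  refine commute_of_normalizer_product hpq.2.1
    (X := X ⊓ Subgroup.normalizer (R' : Set G)) (Y := Y ⊓ Subgroup.normalizer (R' : Set G))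
    (fun g hg => ?_) inf_le_right inf_le_right (fun d e hd hde x hx => ?_)
    (fun d e hd hde => hcomm p q hpq R d e hd.1 hd.2 hde) hc hcR
  -- Rewriting `x * y = (x * n⁻¹) * (n * y)` puts both factors in the normalizer.
  · obtain ⟨x, hx, y, hy, rfl⟩ := hXY g
    obtain ⟨n, hn, hnY, hnR⟩ := hdec p R y hy
    refine ⟨x * n⁻¹, ⟨mul_mem hx (hNX (inv_mem hn)), ?_⟩, n * y, ⟨hnY, hnR⟩, by group⟩
    have := mul_mem hg (inv_mem hnR)
    rwa [show x * y * (n * y)⁻¹ = x * n⁻¹ by group] at this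
  · exact (hpq.centralizesPSubgroups hform hher hshem hX).commute_of_mem hR'X
      (R.2.map N.subtype) hd.1 hde
      (fun y hy => (Subgroup.mem_normalizer_iff.1 hd.2 y).1 hy) hx

/-- If `G = XY` with `X, Y ∈ F` and `N ≤ X ∩ Y` is normal in `G` with `G / N ∈ F`, then
`G ∈ F`. -/
theorem mem_of_product_of_normal_le (hform : F.IsFormation) (hher : F.IsHereditary)
    (hshem : F.HasShemetkovProperty) {G : Type u} [Group G] [Finite G] {X Y N : Subgroup G}
    [N.Normal] (hXY : ∀ g : G, ∃ x ∈ X, ∃ y ∈ Y, x * y = g) (hX : F.mem X) (hY : F.mem Y)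
    (hNX : N ≤ X) (hNY : N ≤ Y) (hN : F.mem (G ⧸ N)) : F.mem G := by
  refine mem_of_product_of_commute hform hher hshem hXY hX hY hNX hN (fun p _ R y hy => ?_)
    (fun p q hpq R c a hc hcR hca x hx => ?_)
  · have htop := Sylow.normalizer_sup_eq_top R
    rw [sup_comm] at htop
    have hy' := Subgroup.mem_top y
    rw [← htop] at hy'
    obtain ⟨n, hn, w, hw, rfl⟩ := Subgroup.mem_sup_of_normal_left.1 hy'
    refine ⟨n⁻¹, inv_mem hn, mul_mem (hNY (inv_mem hn)) hy, ?_⟩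
    rwa [inv_mul_cancel_left]
  · exact (hpq.centralizesPSubgroups hform hher hshem hY).commute_of_mem
      ((Subgroup.map_subtype_le _).trans hNY) (R.2.map N.subtype) hc hca
      (fun y hy => (Subgroup.mem_normalizer_iff.1 hcR y).1 hy) hx

/-- Since `B` normalizes every subgroup of `A`, commutation with a Sylow subgroup of `A` can be
checked on its cyclic subgroups. -/
theorem mem_of_normal_complement (hform : F.IsFormation) (hher : F.IsHereditary)
    (hshem : F.HasShemetkovProperty)
    (hsup : ∀ (G : Type u) [Group G] [Finite G],
      IsSchmidtGroup G → IsSupersoluble G → groupPrimes G ⊆ F.primes → F.mem G)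
    {G : Type u} [Group G] [Finite G] {A B : Subgroup G} [A.Normal]
    (hAB : ∀ g : G, ∃ a ∈ A, ∃ b ∈ B, a * b = g) (hA : F.mem A) (hB : F.mem B)
    (hnorm : ∀ b ∈ B, ∀ K ≤ A, ∀ x ∈ K, b * x * b⁻¹ ∈ K) : F.mem G := by
  refine mem_of_product_of_commute hform hher hshem hAB hA hB le_rfl ?_ (fun p _ R y hy => ?_)
    (fun p q hpq R c a hc hcR hca x hx => ?_)
  · refine hform.mem_of_surjective ((QuotientGroup.mk' A).comp B.subtype) (fun g => ?_) hB
    obtain ⟨g, rfl⟩ := QuotientGroup.mk_surjective g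
    obtain ⟨a, ha, b, hb, rfl⟩ := hAB g
    refine ⟨⟨b, hb⟩, ?_⟩
    simp [(QuotientGroup.eq_one_iff a).2 ha]
  · refine ⟨1, one_mem _, by rwa [one_mul], ?_⟩
    rw [one_mul]
    exact mem_normalizer_of_forall_conj_mem (hnorm y hy _ (Subgroup.map_subtype_le _))
  · obtain ⟨d, hd⟩ := (R.2.map A.subtype).exists_pow_eq_one hx
    exact hpq.commute_of_cyclic hform hher hshem hsup hd hca
      (hnorm c hc _ ((Subgroup.zpowers_le).2 (Subgroup.map_subtype_le _ hx)))

end FiniteGroupClass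

/-! ### From permuting to normalizing -/

theorem SubgroupsPermute.map {G H : Type*} [Group G] [Group H] {A B : Subgroup G}
    (h : SubgroupsPermute A B) (f : G →* H) : SubgroupsPermute (A.map f) (B.map f) := by
  refine .of_exists ?_
  rintro _ ⟨a, ha, rfl⟩ _ ⟨b, hb, rfl⟩
  obtain ⟨b', hb', a', ha', e⟩ := h.exists_mul_eq ha hb
  exact ⟨_, ⟨b', hb', rfl⟩, _, ⟨a', ha', rfl⟩, by rw [← map_mul, e, map_mul]⟩

theorem SubgroupsPermute.of_map {G H : Type*} [Group G] [Group H] {A B : Subgroup G} {f : G →* H}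
    (hf : Function.Injective f) (h : SubgroupsPermute (A.map f) (B.map f)) :
    SubgroupsPermute A B := by
  refine .of_exists fun a ha b hb => ?_
  obtain ⟨_, ⟨b', hb', rfl⟩, _, ⟨a', ha', rfl⟩, e⟩ :=
    h.exists_mul_eq (Subgroup.mem_map_of_mem f ha) (Subgroup.mem_map_of_mem f hb)
  rw [← map_mul, ← map_mul] at e
  exact ⟨b', hb', a', ha', hf e⟩

theorem SubgroupsPermute.card_sup {G : Type*} [Group G] {A B : Subgroup G}
    (h : SubgroupsPermute A B) (hAB : A ⊓ B = ⊥) :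
    Nat.card (A ⊔ B : Subgroup G) = Nat.card A * Nat.card B := by
  rw [← Nat.card_prod]
  refine (Nat.card_congr (Equiv.ofBijective
    (fun y : A × B => (⟨y.1 * y.2, Subgroup.mul_mem_sup y.1.2 y.2.2⟩ : (A ⊔ B : Subgroup G)))
    ⟨?_, ?_⟩)).symm
  · exact fun y y' hy => Subgroup.mul_injective_of_disjoint (disjoint_iff.2 hAB)
      (congrArg (fun t : (A ⊔ B : Subgroup G) => (t : G)) hy)
  · rintro ⟨g, hg⟩
    obtain ⟨a, ha, b, hb, rfl⟩ := h.mem_sup.1 hg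
    exact ⟨(⟨a, ha⟩, ⟨b, hb⟩), rfl⟩

theorem Subgroup.conj_mem_of_relIndex_eq_minFac_card {G : Type*} [Group G] {K H : Subgroup G}
    (hKH : K ≤ H) (h : K.relIndex H = (Nat.card H).minFac) {g : G} (hg : g ∈ H) {k : G}
    (hk : k ∈ K) : g * k * g⁻¹ ∈ K := by
  have := Subgroup.normal_of_index_eq_minFac_card (H := K.subgroupOf H) h
  exact Subgroup.mem_subgroupOf.1 (this.conj_mem ⟨k, hKH hk⟩ (Subgroup.mem_subgroupOf.2 hk) ⟨g, hg⟩)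

theorem Subgroup.conj_mem_of_coprime {G : Type*} [Group G] [Finite G] {X K : Subgroup G}
    (hXK : X ≤ K) (hK : K ≤ Subgroup.normalizer (X : Set G))
    (hc : Nat.Coprime (X.relIndex K) (Nat.card X)) {g : G} (hg : ∀ k ∈ K, g * k * g⁻¹ ∈ K) {x : G}
    (hx : x ∈ X) : g * x * g⁻¹ ∈ X := by
  have hn := Subgroup.normal_subgroupOf_of_le_normalizer hK
  let w : K := ⟨g * x * g⁻¹, hg x (hXK hx)⟩
  have h1 : orderOf (w : K ⧸ X.subgroupOf K) ∣ X.relIndex K := _root_.orderOf_dvd_natCard _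
  have hw : w ^ Nat.card X = 1 := by
    refine Subtype.ext ?_
    have : x ^ Nat.card X = 1 := congrArg Subtype.val (pow_card_eq_one' (x := (⟨x, hx⟩ : X)))
    change (g * x * g⁻¹) ^ Nat.card X = 1
    rw [conj_pow, this]
    group
  have h2 : orderOf (w : K ⧸ X.subgroupOf K) ∣ Nat.card X := by
    refine orderOf_dvd_of_pow_eq_one ?_
    rw [← QuotientGroup.mk_pow, hw, QuotientGroup.mk_one]
  have h3 := Nat.eq_one_of_dvd_coprimes hc h1 h2
  rw [orderOf_eq_one_iff, QuotientGroup.eq_one_iff] at h3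
  exact h3

theorem Subgroup.card_mul_relIndex {G : Type*} [Group G] {H K : Subgroup G} (h : H ≤ K) :
    Nat.card H * H.relIndex K = Nat.card K := by
  rw [← Subgroup.relIndex_bot_left, Subgroup.relIndex_mul_relIndex _ _ _ bot_le h,
    Subgroup.relIndex_bot_left]

theorem Nat.minFac_mul_of_prime_of_lt {r n : ℕ} (hr : r.Prime) (hn : n ≠ 1) (h : n.minFac < r) :
    (r * n).minFac = n.minFac := by
  have hs := Nat.minFac_prime hn
  refine le_antisymm (Nat.minFac_le_of_dvd hs.two_le ((Nat.minFac_dvd n).mul_left r)) ?_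
  have hne : r * n ≠ 1 := fun h => hr.ne_one (Nat.eq_one_of_mul_eq_one_right h)
  have hm := Nat.minFac_prime hne
  rcases hm.dvd_mul.1 (Nat.minFac_dvd (r * n)) with h1 | h1
  · rw [(Nat.prime_dvd_prime_iff_eq hm hr).1 h1]
    exact h.le
  · exact Nat.minFac_le_of_dvd hm.two_le h1

/-- The index of `X⟨y ^ s⟩` in `X⟨y⟩`. -/
theorem relIndex_sup_zpowers_pow {G : Type*} [Group G] [Finite G] {X : Subgroup G} {y : G} {s : ℕ}
    (hs : s ∣ orderOf y) (hperm : ∀ k : ℕ, SubgroupsPermute X (Subgroup.zpowers (y ^ k)))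
    (hdisj : X ⊓ Subgroup.zpowers y = ⊥) :
    (X ⊔ Subgroup.zpowers (y ^ s)).relIndex (X ⊔ Subgroup.zpowers y) = s := by
  have hle : Subgroup.zpowers (y ^ s) ≤ Subgroup.zpowers y := Subgroup.zpowers_le.2
    (pow_mem (Subgroup.mem_zpowers y) s)
  have h1 := (hperm 1).card_sup (by rwa [pow_one])
  have h2 := (hperm s).card_sup (le_bot_iff.1 (hdisj ▸ inf_le_inf_left X hle))
  have h3 := Subgroup.card_mul_relIndex (sup_le_sup_left hle X)
  have h4 : 0 < orderOf y := orderOf_pos y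
  obtain ⟨m, hm⟩ := hs
  have hs0 : s ≠ 0 := by rintro rfl; omega
  rw [pow_one] at h1
  rw [h1, h2, Nat.card_zpowers, Nat.card_zpowers, orderOf_pow_of_dvd hs0 ⟨m, hm⟩, hm,
    Nat.mul_div_cancel_left _ (Nat.pos_of_ne_zero hs0)] at h3
  have hm0 : 0 < Nat.card X * m := Nat.mul_pos Nat.card_pos
    (Nat.pos_of_ne_zero (by rintro rfl; omega))
  refine Nat.eq_of_mul_eq_mul_left hm0 (h3.trans (by ring))

/-- Let `s` be the least prime dividing the order of `y`. Then `X⟨y ^ s⟩` has least prime index in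
`X⟨y⟩`, so it is normal there; by induction `X` is a normal subgroup of it of coprime index, hence
characteristic. -/
theorem conj_mem_of_prime_card {G : Type*} [Group G] [Finite G] {X : Subgroup G}
    (hX : (Nat.card X).Prime) : ∀ (n : ℕ) {y : G}, orderOf y = n →
    (∀ t : ℕ, t.Prime → t ∣ orderOf y → t < Nat.card X) →
    (∀ k : ℕ, SubgroupsPermute X (Subgroup.zpowers (y ^ k))) → ∀ x ∈ X, y * x * y⁻¹ ∈ X := by
  intro n
  induction n using Nat.strong_induction_on with
  | _ n ih =>
  intro y hn ht hperm x hx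
  have hpos := orderOf_pos y
  have hcop : (orderOf y).Coprime (Nat.card X) := by
    rw [Nat.coprime_comm, hX.coprime_iff_not_dvd]
    exact fun h => lt_irrefl _ (ht _ hX h)
  by_cases h1 : orderOf y = 1
  · rw [orderOf_eq_one_iff] at h1
    simpa [h1] using hx
  have hs := Nat.minFac_prime h1
  have hsd := Nat.minFac_dvd (orderOf y)
  set s := (orderOf y).minFac with hsdef
  have hos : orderOf (y ^ s) = orderOf y / s := orderOf_pow_of_dvd hs.ne_zero hsd
  have hdisj : X ⊓ Subgroup.zpowers y = ⊥ :=
    (Subgroup.disjoint_of_coprime_natCard (by rw [Nat.card_zpowers]; exact hcop.symm)).eq_bot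
  have hle : Subgroup.zpowers (y ^ s) ≤ Subgroup.zpowers y := Subgroup.zpowers_le.2
    (pow_mem (Subgroup.mem_zpowers y) s)
  have hrel := relIndex_sup_zpowers_pow hsd hperm hdisj
  have hys := ih (orderOf (y ^ s)) (by
      rw [hos, ← hn]
      exact Nat.div_lt_self hpos hs.one_lt) rfl
    (fun t htp htd => ht t htp (htd.trans (hos ▸ Nat.div_dvd_of_dvd hsd)))
    (fun k => by rw [← pow_mul]; exact hperm _)
  refine Subgroup.conj_mem_of_coprime (K := X ⊔ Subgroup.zpowers (y ^ s)) le_sup_left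
    (sup_le Subgroup.le_normalizer (Subgroup.zpowers_le.2 (mem_normalizer_of_forall_conj_mem hys)))
    ?_ (fun k hk => ?_) hx
  · have h2 := (hperm s).card_sup (le_bot_iff.1 (hdisj ▸ inf_le_inf_left X hle))
    have h3 := Subgroup.card_mul_relIndex (le_sup_left : X ≤ X ⊔ Subgroup.zpowers (y ^ s))
    rw [h2] at h3
    rw [Nat.eq_of_mul_eq_mul_left Nat.card_pos h3, Nat.card_zpowers, hos]
    exact hcop.coprime_dvd_left (Nat.div_dvd_of_dvd hsd)
  · refine Subgroup.conj_mem_of_relIndex_eq_minFac_card (sup_le_sup_left hle X) ?_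
      (Subgroup.mem_sup_right (Subgroup.mem_zpowers y)) hk
    have hc := (hperm 1).card_sup (by rwa [pow_one])
    rw [pow_one, Nat.card_zpowers] at hc
    rw [hrel, hc, Nat.minFac_mul_of_prime_of_lt hX h1 (ht _ hs hsd)]

/-- With `n = M.index`, the quotient by the core embeds in the symmetric group on `n` cosets, so the
image of `M` has order dividing `(n - 1)!`. -/
theorem Subgroup.lt_of_prime_dvd_card_map_normalCore {G : Type*} [Group G] [Finite G]
    {M : Subgroup G} {t : ℕ} (ht : t.Prime)
    (htM : t ∣ Nat.card (M.map (QuotientGroup.mk' M.normalCore))) : t < M.index := by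
  have hpos : 0 < M.index := Nat.pos_of_ne_zero M.index_ne_zero_of_finite
  have h1 : M.normalCore.index ∣ M.index.factorial := by
    rw [Subgroup.normalCore_eq_ker, Subgroup.index_ker, Subgroup.index_eq_card,
      ← Nat.card_perm]
    exact Subgroup.card_subgroup_dvd_card _
  have h2 : (M.map (QuotientGroup.mk' M.normalCore)).index = M.index :=
    Subgroup.index_map_eq _ (QuotientGroup.mk'_surjective _)
      (by rw [QuotientGroup.ker_mk']; exact M.normalCore_le)
  have h3 := (M.map (QuotientGroup.mk' M.normalCore)).index_mul_card
  rw [h2, ← Subgroup.index_eq_card] at h3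
  rw [← h3, ← Nat.mul_factorial_pred hpos.ne'] at h1
  have h4 := htM.trans (Nat.dvd_of_mul_dvd_mul_left hpos h1)
  have := (ht.dvd_factorial).1 h4
  omega

/-- Modulo the core of `M = B⟨x ^ r⟩` the image of `x` has prime order `r`, and `B` normalizes the
group it generates. That group has abelian automorphism group, so the perfect `B` centralizes it.
This places `B` in the core, whose derived subgroup is then `B`. -/
theorem normal_of_conj_pow_mem {G : Type*} [Group G] [Finite G] {B : Subgroup G} {x : G} {r : ℕ}
    (hr : r.Prime) (hrx : r ∣ orderOf x) (htop : B ⊔ Subgroup.zpowers x = ⊤)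
    (hperm : ∀ K ≤ B, ∀ i : ℕ, SubgroupsPermute K (Subgroup.zpowers (x ^ i)))
    (hdisj : B ⊓ Subgroup.zpowers x = ⊥) (hperf : ⁅B, B⁆ = B)
    (hxr : ∀ b ∈ B, x ^ r * b * (x ^ r)⁻¹ ∈ B) : B.Normal := by
  set M := B ⊔ Subgroup.zpowers (x ^ r) with hM
  have hBM : B ≤ M := le_sup_left
  have hindex : M.index = r := by
    rw [← relIndex_sup_zpowers_pow hrx (hperm B le_rfl) hdisj, htop, Subgroup.relIndex_top_right]
  have hg : ∀ g : G, ∃ b ∈ B, ∃ i : ℤ, b * x ^ i = g := fun g => by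
    obtain ⟨b, hb, y, hy, h⟩ := (pow_one x ▸ hperm B le_rfl 1).mem_sup.1 (htop ▸ Subgroup.mem_top g)
    obtain ⟨i, rfl⟩ := Subgroup.mem_zpowers_iff.1 hy
    exact ⟨b, hb, i, h⟩
  have hxrC : x ^ r ∈ M.normalCore := fun g => by
    obtain ⟨b, hb, i, rfl⟩ := hg g
    have : b * x ^ i * x ^ r * (b * x ^ i)⁻¹ = b * x ^ r * b⁻¹ := by
      have := ((Commute.refl x).zpow_left i).pow_right r
      rw [mul_assoc b, this.eq]; group
    rw [this]
    exact mul_mem (mul_mem (hBM hb) (Subgroup.mem_sup_right (Subgroup.mem_zpowers _)))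
      (inv_mem (hBM hb))
  have hord : orderOf (x : G ⧸ M.normalCore) = r := by
    have := Fact.mk hr
    refine orderOf_eq_prime ?_ fun h => hr.ne_one ?_
    · rw [← QuotientGroup.mk_pow, (QuotientGroup.eq_one_iff _).2 hxrC]
    · have hxM := M.normalCore_le ((QuotientGroup.eq_one_iff x).1 h)
      rw [← hindex, Subgroup.index_eq_one, ← top_le_iff, ← htop]
      exact sup_le hBM (Subgroup.zpowers_le.2 hxM)
  have hcard : Nat.card (Subgroup.zpowers (x : G ⧸ M.normalCore)) = r := by
    rw [Nat.card_zpowers, hord]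
  have hconj : ∀ b ∈ B, ∃ k : ℤ, ((b * x * b⁻¹ : G) : G ⧸ M.normalCore) = (x : G ⧸ M.normalCore) ^ k := by
    intro b hb
    have := conj_mem_of_prime_card (X := Subgroup.zpowers (x : G ⧸ M.normalCore))
      (hcard ▸ hr) _ (y := (b : G ⧸ M.normalCore)) rfl (fun t ht htd => ?_) (fun k => ?_)
      x (Subgroup.mem_zpowers _)
    · obtain ⟨k, hk⟩ := Subgroup.mem_zpowers_iff.1 this
      exact ⟨k, hk.symm⟩
    · rw [hcard, ← hindex]
      refine Subgroup.lt_of_prime_dvd_card_map_normalCore ht (htd.trans ?_)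
      exact Subgroup.orderOf_dvd_natCard _ ⟨b, hBM hb, rfl⟩
    · have := ((hperm (Subgroup.zpowers (b ^ k)) (Subgroup.zpowers_le.2 (pow_mem hb k)) 1).map
        (QuotientGroup.mk' M.normalCore)).symm
      simpa [MonoidHom.map_zpowers] using this
  have hcent : B ≤ (Subgroup.centralizer {(x : G ⧸ M.normalCore)}).comap
      (QuotientGroup.mk' M.normalCore) := by
    conv_lhs => rw [← hperf]
    rw [Subgroup.commutator_le]
    intro b hb c hc
    obtain ⟨k, hk⟩ := hconj b⁻¹ (inv_mem hb)
    obtain ⟨l, hl⟩ := hconj c⁻¹ (inv_mem hc)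
    simp only [QuotientGroup.mk_mul, QuotientGroup.mk_inv, inv_inv] at hk hl
    rw [Subgroup.mem_comap, Subgroup.mem_centralizer_singleton_iff, map_commutatorElement,
      commutatorElement_def]
    simp only [QuotientGroup.mk'_apply]
    generalize (x : G ⧸ M.normalCore) = X at *
    generalize (b : G ⧸ M.normalCore) = β at *
    generalize (c : G ⧸ M.normalCore) = γ at *
    have h1 : β⁻¹ * (γ⁻¹ * X * γ) * β = γ⁻¹ * (β⁻¹ * X * β) * γ := by
      have e1 := conj_zpow (i := l) (a := β⁻¹) (b := X)
      have e2 := conj_zpow (i := k) (a := γ⁻¹) (b := X)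
      rw [inv_inv] at e1 e2
      rw [hl, hk, ← e1, ← e2, hl, hk, ← zpow_mul, ← zpow_mul, mul_comm]
    calc β * γ * β⁻¹ * γ⁻¹ * X = β * γ * (β⁻¹ * (γ⁻¹ * X * γ) * β) * β⁻¹ * γ⁻¹ := by group
      _ = X * (β * γ * β⁻¹ * γ⁻¹) := by rw [h1]; group
  have hBC : B ≤ M.normalCore := fun b hb g => by
    obtain ⟨c, hc, i, rfl⟩ := hg g
    have h1 : ((x : G ⧸ M.normalCore) ^ i) * b = b * (x : G ⧸ M.normalCore) ^ i := by
      have := Subgroup.mem_centralizer_singleton_iff.1 (hcent hb)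
      exact ((show Commute (b : G ⧸ M.normalCore) x from this).zpow_right i).eq.symm
    have h2 : b⁻¹ * (x ^ i * b * (x ^ i)⁻¹) ∈ M := M.normalCore_le (by
      rw [← QuotientGroup.eq]
      simp only [QuotientGroup.mk_mul, QuotientGroup.mk_inv, QuotientGroup.mk_zpow]
      rw [h1, mul_inv_cancel_right])
    have h3 := mul_mem (mul_mem (hBM hc) (mul_mem (hBM hb) h2)) (inv_mem (hBM hc))
    rwa [mul_inv_cancel_left, show c * (x ^ i * b * (x ^ i)⁻¹) * c⁻¹ =
      c * x ^ i * b * (c * x ^ i)⁻¹ by group] at h3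
  have hMB : ⁅M, M⁆ ≤ B := by
    have := normal_subgroupOf_sup_zpowers hxr
    have hcyc := isCyclic_quotient_of_sup_zpowers (sup_zpowers_subgroupOf_eq_top B (x ^ r))
    rw [Subgroup.commutator_le]
    intro m hm m' hm'
    have := hcyc.isMulCommutative.is_comm.comm ((⟨m, hm⟩ : M) : M ⧸ B.subgroupOf M) ((⟨m', hm'⟩ : M))
    have h2 : (⁅(⟨m, hm⟩ : M), (⟨m', hm'⟩ : M)⁆ : M) ∈ B.subgroupOf M := by
      rw [← QuotientGroup.eq_one_iff, commutatorElement_def]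
      simp only [QuotientGroup.mk_mul, QuotientGroup.mk_inv]
      rw [this, mul_inv_cancel_right, mul_inv_cancel]
    exact Subgroup.mem_subgroupOf.1 h2
  -- `B = [B, B] ≤ [core, core] ≤ [M, M] ≤ B`, and the commutator of a normal subgroup with itself
  -- is normal.
  have : B = ⁅M.normalCore, M.normalCore⁆ := le_antisymm
    (hperf.ge.trans (Subgroup.commutator_mono hBC hBC))
    ((Subgroup.commutator_mono M.normalCore_le M.normalCore_le).trans hMB)
  rw [this]
  infer_instance

theorem conj_mem_of_commutator_eq {G : Type*} [Group G] [Finite G] {B : Subgroup G}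
    (hperf : ⁅B, B⁆ = B) : ∀ (n : ℕ) {x : G}, orderOf x = n →
    (∀ K ≤ B, ∀ i : ℕ, SubgroupsPermute K (Subgroup.zpowers (x ^ i))) →
    B ⊓ Subgroup.zpowers x = ⊥ → ∀ b ∈ B, x * b * x⁻¹ ∈ B := by
  intro n
  induction n using Nat.strong_induction_on with
  | _ n ih =>
  intro x hn hperm hdisj b hb
  have hpos := orderOf_pos x
  by_cases h1 : orderOf x = 1
  · rw [orderOf_eq_one_iff] at h1
    simpa [h1] using hb
  have hr := Nat.minFac_prime h1
  have hrd := Nat.minFac_dvd (orderOf x)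
  set r := (orderOf x).minFac with hrdef
  have hle : Subgroup.zpowers (x ^ r) ≤ Subgroup.zpowers x := Subgroup.zpowers_le.2
    (pow_mem (Subgroup.mem_zpowers x) r)
  have hxr := ih (orderOf (x ^ r)) (by
      rw [orderOf_pow_of_dvd hr.ne_zero hrd, ← hn]
      exact Nat.div_lt_self hpos hr.one_lt) rfl
    (fun K hK i => by rw [← pow_mul]; exact hperm K hK _)
    (le_bot_iff.1 (hdisj ▸ inf_le_inf_left B hle))
  set H := B ⊔ Subgroup.zpowers x with hH
  have hxH : x ∈ H := Subgroup.mem_sup_right (Subgroup.mem_zpowers x)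
  have hBH : B ≤ H := le_sup_left
  have hmap : (B.subgroupOf H).map H.subtype = B := Subgroup.map_subgroupOf_eq_of_le hBH
  have hinj := Subgroup.map_injective H.subtype_injective
  have hnormal : (B.subgroupOf H).Normal := by
    refine normal_of_conj_pow_mem (x := ⟨x, hxH⟩) hr (by rwa [Subgroup.orderOf_mk])
      (sup_zpowers_subgroupOf_eq_top B x) (fun K hK i => ?_) (hinj ?_) (hinj ?_) (fun c hc => ?_)
    · refine .of_map H.subtype_injective ?_
      rw [MonoidHom.map_zpowers]
      exact hperm _ (Subgroup.map_le_iff_le_comap.2 hK) i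
    · rw [Subgroup.map_inf _ _ _ H.subtype_injective, hmap, MonoidHom.map_zpowers, Subgroup.map_bot]
      exact hdisj
    · rw [Subgroup.map_commutator, hmap, hperf]
    · exact Subgroup.mem_subgroupOf.2 (hxr c (Subgroup.mem_subgroupOf.1 hc))
  exact Subgroup.mem_subgroupOf.1 (hnormal.conj_mem ⟨b, hBH hb⟩ (Subgroup.mem_subgroupOf.2 hb) ⟨x, hxH⟩)

/-! ### Permutable subgroups and mutually permuting pairs -/

/-- A maximal proper permutable `N` is normal: otherwise `N` and a different conjugate `N^g` have a
permutable product, so `G = N N^g`, which forces `g ∈ N`. -/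
theorem exists_normal_ge_of_permutes {G : Type*} [Group G] [Finite G] {D : Subgroup G}
    (hD : D ≠ ⊤) (hperm : ∀ K : Subgroup G, SubgroupsPermute D K) :
    ∃ N : Subgroup G, N.Normal ∧ N ≠ ⊤ ∧ D ≤ N := by
  obtain ⟨N, hDN, hN⟩ := (Set.toFinite {N : Subgroup G | N ≠ ⊤ ∧
    ∀ K : Subgroup G, SubgroupsPermute N K}).exists_le_maximal ⟨hD, hperm⟩
  refine ⟨N, ?_, hN.prop.1, hDN⟩
  by_contra hnot
  obtain ⟨g, hg⟩ : ∃ g : G, N.map (MulAut.conj g).toMonoidHom ≠ N := by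
    by_contra! hcon
    exact hnot ⟨fun n hn g => hcon g ▸ ⟨n, hn, rfl⟩⟩
  have hNg : ∀ K : Subgroup G, SubgroupsPermute (N.map (MulAut.conj g).toMonoidHom) K := fun K => by
    have := (hN.prop.2 (K.map (MulAut.conj g⁻¹).toMonoidHom)).map (MulAut.conj g).toMonoidHom
    rw [Subgroup.map_map] at this
    convert this
    ext y
    simp [mul_assoc]
  have htop : N ⊔ N.map (MulAut.conj g).toMonoidHom = ⊤ := by
    by_contra hne
    have hmem : ∀ K : Subgroup G, SubgroupsPermute (N ⊔ N.map (MulAut.conj g).toMonoidHom) K := by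
      refine fun K => .of_exists fun a ha k hk => ?_
      obtain ⟨m, hm, n, hn, rfl⟩ := (hN.prop.2 _).mem_sup.1 ha
      obtain ⟨k', hk', n', hn', e⟩ := (hNg K).exists_mul_eq hn hk
      obtain ⟨k'', hk'', m', hm', e'⟩ := (hN.prop.2 K).exists_mul_eq hm hk'
      exact ⟨k'', hk'', m' * n', Subgroup.mul_mem_sup hm' hn', by
        rw [mul_assoc, e, ← mul_assoc, e', mul_assoc]⟩
    have hle : N.map (MulAut.conj g).toMonoidHom ≤ N :=
      le_sup_right.trans (hN.2 ⟨hne, hmem⟩ le_sup_left)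
    exact hg (Subgroup.eq_of_le_of_card_ge hle
      (Subgroup.card_map_of_injective (MulAut.conj g).injective).ge)
  obtain ⟨a, ha, _, ⟨b, hb, rfl⟩, e⟩ := (hN.prop.2 _).mem_sup.1 (htop ▸ Subgroup.mem_top g⁻¹)
  have hgN : g ∈ N := by
    have : g = a⁻¹ * b⁻¹ := by
      have e' : a * (g * b * g⁻¹) = g⁻¹ := e
      rw [← mul_assoc, mul_eq_right, ← mul_assoc] at e'
      rw [eq_mul_inv_iff_mul_eq, eq_inv_of_mul_eq_one_right ((mul_assoc a g b).symm.trans e')]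
    rw [this]
    exact mul_mem (inv_mem ha) (inv_mem hb)
  refine hg (Subgroup.eq_of_le_of_card_ge ?_
    (Subgroup.card_map_of_injective (MulAut.conj g).injective).ge)
  rintro _ ⟨n, hn, rfl⟩
  exact mul_mem (mul_mem hgN hn) (inv_mem hgN)

/-- Each of the two subgroups permutes with every subgroup of the other. -/
structure MutuallyPermute {G : Type*} [Group G] (A B : Subgroup G) : Prop where
  left : ∀ K ≤ B, SubgroupsPermute A K
  right : ∀ K ≤ A, SubgroupsPermute B K

namespace MutuallyPermute

variable {G : Type*} [Group G] {A B K : Subgroup G}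

theorem symm (h : MutuallyPermute A B) : MutuallyPermute B A := ⟨h.right, h.left⟩

theorem sup_inf_eq (h : MutuallyPermute A B) (hK : A ⊓ B ≤ K) (hKB : K ≤ B) :
    (A ⊔ K) ⊓ B = K := by
  refine le_antisymm ?_ (le_inf le_sup_right hKB)
  rintro g ⟨hg, hgB⟩
  obtain ⟨a, ha, k, hk, rfl⟩ := (h.left K hKB).mem_sup.1 hg
  have haB : a ∈ B := by
    have := B.mul_mem hgB (B.inv_mem (hKB hk))
    rwa [mul_inv_cancel_right] at this
  exact mul_mem (hK ⟨ha, haB⟩) hk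

/-- The element of `B` produced by permuting lies in `AK`, and `AK ∩ B = K` by Dedekind's law. -/
theorem restrict (h : MutuallyPermute A B) (hK : A ⊓ B ≤ K) (hKB : K ≤ B) :
    MutuallyPermute A K := by
  refine ⟨fun L hL => h.left L (hL.trans hKB), fun L hL => .of_exists fun k hk l hl => ?_⟩
  obtain ⟨l', hl', b, hb, e⟩ := (h.right L hL).exists_mul_eq (hKB hk) hl
  refine ⟨l', hl', b, ?_, e⟩
  rw [← h.sup_inf_eq hK hKB]
  refine ⟨?_, hb⟩
  rw [← inv_mul_eq_iff_eq_mul] at e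
  rw [← e]
  exact mul_mem (Subgroup.mem_sup_left (hL (inv_mem hl')))
    (mul_mem (Subgroup.mem_sup_right hk) (Subgroup.mem_sup_left (hL hl)))

theorem subgroupOf (h : MutuallyPermute A B) {H : Subgroup G} (hA : A ≤ H) (hB : B ≤ H) :
    MutuallyPermute (A.subgroupOf H) (B.subgroupOf H) := by
  constructor
  · refine fun L hL => .of_map H.subtype_injective ?_
    rw [Subgroup.map_subgroupOf_eq_of_le hA]
    exact h.left _ (Subgroup.map_le_iff_le_comap.2 hL)
  · refine fun L hL => .of_map H.subtype_injective ?_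
    rw [Subgroup.map_subgroupOf_eq_of_le hB]
    exact h.right _ (Subgroup.map_le_iff_le_comap.2 hL)

theorem map {H : Type*} [Group H] (h : MutuallyPermute A B) (f : G →* H) :
    MutuallyPermute (A.map f) (B.map f) := by
  have key : ∀ (C : Subgroup G), ∀ L ≤ C.map f, (C ⊓ L.comap f).map f = L := fun C L hL => by
    refine le_antisymm ?_ fun y hy => ?_
    · rintro _ ⟨x, hx, rfl⟩
      exact hx.2
    · obtain ⟨x, hx, rfl⟩ := hL hy
      exact ⟨x, ⟨hx, hy⟩, rfl⟩
  refine ⟨fun L hL => ?_, fun L hL => ?_⟩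
  · rw [← key B L hL]
    exact (h.left _ inf_le_left).map f
  · rw [← key A L hL]
    exact (h.right _ inf_le_left).map f

theorem isMutuallyPermutableProduct (h : MutuallyPermute A B) (htop : A ⊔ B = ⊤) :
    IsMutuallyPermutableProduct A B :=
  ⟨Set.eq_univ_iff_forall.2 fun g =>
    (h.left B le_rfl).mem_sup.1 (htop ▸ Subgroup.mem_top g), h.left, h.right⟩

end MutuallyPermute

theorem IsMutuallyPermutableProduct.mutuallyPermute {G : Type*} [Group G] {A B : Subgroup G}
    (h : IsMutuallyPermutableProduct A B) : MutuallyPermute A B :=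
  ⟨h.left_permutes, h.right_permutes⟩

theorem IsMutuallyPermutableProduct.sup_eq_top {G : Type*} [Group G] {A B : Subgroup G}
    (h : IsMutuallyPermutableProduct A B) : A ⊔ B = ⊤ :=
  top_unique fun g _ => by
    obtain ⟨a, ha, b, hb, rfl⟩ := h.exists_mul_eq g
    exact Subgroup.mul_mem_sup ha hb

theorem IsMutuallyPermutableProduct.normalClosure_le {G : Type*} [Group G] {A B K : Subgroup G}
    (h : IsMutuallyPermutableProduct A B) (hK : ∀ b ∈ B, ∀ k ∈ K, b * k * b⁻¹ ∈ K) :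
    Subgroup.normalClosure (K : Set G) ≤ A ⊔ K := by
  rw [Subgroup.normalClosure, Subgroup.closure_le]
  intro y hy
  obtain ⟨k, hk, hky⟩ := Group.mem_conjugatesOfSet_iff.1 hy
  obtain ⟨g, rfl⟩ := isConj_iff.1 hky
  obtain ⟨a, ha, b, hb, rfl⟩ := h.exists_mul_eq g
  rw [show a * b * k * (a * b)⁻¹ = a * (b * k * b⁻¹) * a⁻¹ by group]
  exact mul_mem (mul_mem (Subgroup.mem_sup_left ha) (Subgroup.mem_sup_right (hK b hb k hk)))
    (inv_mem (Subgroup.mem_sup_left ha))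

/-- `A ∩ B` permutes with all subgroups of `B`, so a nontrivial one lies in a proper normal subgroup
of `B`; if it is trivial, `B` is not simple and any proper nontrivial normal subgroup will do. -/
theorem exists_normalized_ge_inf {G : Type*} [Group G] [Finite G] {A B : Subgroup G}
    (h : MutuallyPermute A B) (hAB : ¬ B ≤ A) (hne : A ⊓ B ≠ ⊥ ∨ ¬ IsSimpleGroup B) (hB : B ≠ ⊥) :
    ∃ K ≤ B, A ⊓ B ≤ K ∧ K ≠ B ∧ K ≠ ⊥ ∧ ∀ b ∈ B, ∀ k ∈ K, b * k * b⁻¹ ∈ K := by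
  obtain ⟨N, hN, hNtop, hNbot, hle⟩ : ∃ N : Subgroup B, N.Normal ∧ N ≠ ⊤ ∧ N ≠ ⊥ ∧
      A.subgroupOf B ≤ N := by
    by_cases hbot : A ⊓ B = ⊥
    · have hs := hne.resolve_left (not_not.2 hbot)
      by_contra! hcon
      refine hs ?_
      have := (Subgroup.nontrivial_iff_ne_bot B).2 hB
      refine ⟨fun N hN => ?_⟩
      by_contra! hc
      refine hcon N hN hc.2 hc.1 ?_
      rw [Subgroup.subgroupOf_eq_bot.2 (disjoint_iff.2 hbot)]
      exact bot_le
    · obtain ⟨N, hN, hNtop, hle⟩ := exists_normal_ge_of_permutes (D := A.subgroupOf B)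
        (by rwa [Ne, Subgroup.subgroupOf_eq_top]) (fun K => .of_exists fun d hd k hk => by
          obtain ⟨_, ⟨k', hk', rfl⟩, a, ha, e⟩ := (h.left (K.map B.subtype)
            (Subgroup.map_subtype_le _)).exists_mul_eq (Subgroup.mem_subgroupOf.1 hd) ⟨k, hk, rfl⟩
          have e' : a = ((k'⁻¹ * (d * k) : B) : G) := by
            rw [← inv_mul_eq_iff_eq_mul] at e
            rw [← e]; rfl
          refine ⟨k', hk', k'⁻¹ * (d * k), ?_, by group⟩
          rw [Subgroup.mem_subgroupOf, ← e']
          exact ha)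
      refine ⟨N, hN, hNtop, fun hb => hbot ?_, hle⟩
      rw [hb, le_bot_iff, Subgroup.subgroupOf_eq_bot] at hle
      exact hle.eq_bot
  refine ⟨N.map B.subtype, Subgroup.map_subtype_le _, ?_, ?_, ?_, ?_⟩
  · exact fun g hg => ⟨⟨g, hg.2⟩, hle (Subgroup.mem_subgroupOf.2 hg.1), rfl⟩
  · intro he
    refine hNtop (Subgroup.map_injective B.subtype_injective ?_)
    rw [he, ← MonoidHom.range_eq_map, Subgroup.range_subtype]
  · rwa [Ne, (Subgroup.map_eq_bot_iff_of_injective _ B.subtype_injective)]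
  · rintro b hb _ ⟨k, hk, rfl⟩
    exact ⟨_, hN.conj_mem k hk ⟨b, hb⟩, rfl⟩

theorem IsSimpleGroup.prime_card_or_commutator_eq {G : Type*} [Group G] [Finite G]
    {B : Subgroup G} (hB : IsSimpleGroup B) : (Nat.card B).Prime ∨ ⁅B, B⁆ = B := by
  rcases hB.eq_bot_or_eq_top_of_normal (commutator B) inferInstance with h | h
  · left
    let inst : CommGroup B :=
      { (inferInstance : Group B) with
        mul_comm := fun x y => by
          have : ⁅x, y⁆ ∈ commutator B := Subgroup.commutator_mem_commutator trivial trivial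
          rw [h, Subgroup.mem_bot] at this
          exact commutatorElement_eq_one_iff_mul_comm.1 this }
    exact IsSimpleGroup.prime_card
  · right
    have := congrArg (Subgroup.map B.subtype) h
    rwa [commutator_def, Subgroup.map_commutator, ← MonoidHom.range_eq_map,
      Subgroup.range_subtype] at this

/-- In a mutually permutable product `AB` with `A ∩ B = 1` and `B` simple, the subgroup `A` has
nontrivial core or `B` is normal. -/
theorem IsMutuallyPermutableProduct.normalCore_ne_bot_or_normal {G : Type*} [Group G] [Finite G]
    {A B : Subgroup G} (h : IsMutuallyPermutableProduct A B) (hdisj : A ⊓ B = ⊥)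
    (hB : IsSimpleGroup B) : A.normalCore ≠ ⊥ ∨ B.Normal := by
  have hnormal : (∀ a ∈ A, ∀ b ∈ B, a * b * a⁻¹ ∈ B) → B.Normal := fun hA => ⟨fun x hx g => by
    obtain ⟨a, ha, b, hb, rfl⟩ := h.exists_mul_eq g
    rw [show a * b * x * (a * b)⁻¹ = a * (b * x * b⁻¹) * a⁻¹ by group]
    exact hA a ha _ (mul_mem (mul_mem hb hx) (inv_mem hb))⟩
  by_cases hcore : A.normalCore = ⊥
  swap
  · exact Or.inl hcore
  refine Or.inr (hnormal fun a ha => ?_)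
  have hz : ∀ k : ℕ, Subgroup.zpowers (a ^ k) ≤ A := fun k =>
    Subgroup.zpowers_le.2 (pow_mem ha k)
  rcases hB.prime_card_or_commutator_eq with hp | hperf
  · refine conj_mem_of_prime_card hp _ rfl (fun t ht hta => ?_)
      (fun k => h.right_permutes _ (hz k))
    have hidx : A.index = Nat.card B := by
      have h1 := (h.mutuallyPermute.left B le_rfl).card_sup hdisj
      rw [h.sup_eq_top, Nat.card_congr Subgroup.topEquiv.toEquiv, ← A.card_mul_index] at h1
      exact Nat.eq_of_mul_eq_mul_left Nat.card_pos h1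
    rw [← hidx]
    -- The index of `A` is the prime `|B|` and its core is trivial, so all primes dividing `|A|` are
    -- smaller than `|B|`.
    refine Subgroup.lt_of_prime_dvd_card_map_normalCore ht ?_
    have hinj : Function.Injective (QuotientGroup.mk' A.normalCore) := by
      rw [← MonoidHom.ker_eq_bot_iff, QuotientGroup.ker_mk', hcore]
    rw [Subgroup.card_map_of_injective hinj]
    exact hta.trans (Subgroup.orderOf_dvd_natCard _ ha)
  · refine conj_mem_of_commutator_eq hperf _ rfl (fun K hK i => ?_) ?_
    · exact (h.mutuallyPermute.symm.restrict (K := Subgroup.zpowers (a ^ i))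
        (by rw [inf_comm, hdisj]; exact bot_le) (hz i)).right K hK |>.symm
    · rw [← le_bot_iff, ← hdisj, inf_comm]
      exact inf_le_inf_right B (Subgroup.zpowers_le.2 ha)

/-! ### Induction on the order: from 2 to 1 -/

namespace FiniteGroupClass

variable {F : FiniteGroupClass.{u}}

/-- Mutually permutable products of subgroups in `F` are in `F`, for products of order
below `n`. -/
def ClosedBelow (F : FiniteGroupClass.{u}) (n : ℕ) : Prop :=
  ∀ (G : Type u) [Group G] [Finite G], Nat.card G < n → ∀ A B : Subgroup G,
    IsMutuallyPermutableProduct A B → F.mem A → F.mem B → F.mem G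

section

variable {G : Type u} [Group G] [Finite G] {A B : Subgroup G}

theorem ClosedBelow.mem_sup (hn : F.ClosedBelow (Nat.card G)) (h : MutuallyPermute A B)
    (hA : F.mem A) (hB : F.mem B) (htop : A ⊔ B ≠ ⊤) : F.mem (A ⊔ B : Subgroup G) := by
  refine hn _ ?_ _ _ ((h.subgroupOf le_sup_left le_sup_right).isMutuallyPermutableProduct ?_)
    ((mem_subgroupOf_iff le_sup_left).2 hA) ((mem_subgroupOf_iff le_sup_right).2 hB)
  · refine lt_of_le_of_ne (Nat.le_of_dvd Nat.card_pos (Subgroup.card_subgroup_dvd_card _)) ?_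
    exact fun h => htop (Subgroup.eq_top_of_card_eq _ h)
  · rw [← Subgroup.subgroupOf_sup le_sup_left le_sup_right, Subgroup.subgroupOf_self]

theorem ClosedBelow.mem_quotient (hn : F.ClosedBelow (Nat.card G)) (hform : F.IsFormation)
    (h : IsMutuallyPermutableProduct A B) (hA : F.mem A) (hB : F.mem B) (L : Subgroup G) [L.Normal]
    (hL : L ≠ ⊥) : F.mem (G ⧸ L) := by
  refine hn _ ?_ _ _ ((h.mutuallyPermute.map (QuotientGroup.mk' L)).isMutuallyPermutableProduct ?_)
    (hform.mem_map _ hA) (hform.mem_map _ hB)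
  · rw [← Subgroup.index_eq_card, ← L.card_mul_index]
    exact lt_mul_left (Nat.pos_of_ne_zero L.index_ne_zero_of_finite)
      (Subgroup.one_lt_card_iff_ne_bot L |>.2 hL)
  · rw [← Subgroup.map_sup, h.sup_eq_top,
      Subgroup.map_top_of_surjective _ (QuotientGroup.mk'_surjective L)]

theorem ClosedBelow.mem_normal_sup (hn : F.ClosedBelow (Nat.card G)) (hher : F.IsHereditary)
    (h : IsMutuallyPermutableProduct A B) (hA : F.mem A) (hB : F.mem B) (L : Subgroup G)
    (hL : L ⊔ B ≠ ⊤) : F.mem (L ⊔ B : Subgroup G) := by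
  -- Dedekind's law exhibits `LB` as a mutually permutable product of a subgroup of `A` containing
  -- `A ∩ B` with `B`.
  have heq : ((L ⊔ B) ⊓ A) ⊔ B = L ⊔ B := by
    refine le_antisymm (sup_le inf_le_left le_sup_right) fun g hg => ?_
    obtain ⟨a, ha, b, hb, rfl⟩ := h.exists_mul_eq g
    refine Subgroup.mul_mem_sup ⟨?_, ha⟩ hb
    have := mul_mem hg (inv_mem (Subgroup.mem_sup_right hb))
    rwa [mul_inv_cancel_right] at this
  rw [← heq] at hL ⊢
  exact hn.mem_sup (h.symm.mutuallyPermute.restrict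
    (le_inf (inf_le_left.trans le_sup_right) inf_le_right) inf_le_right).symm
    (hher.mem_of_le inf_le_right hA) hB hL

/-- If `LB = G`, Dedekind's law gives `X = L(X ∩ B) = L`. Otherwise `LB` is in `F` by induction, and
`G = X(LB)` with the normal `L` in both factors. -/
theorem ClosedBelow.mem_or_normal (hn : F.ClosedBelow (Nat.card G)) (hform : F.IsFormation)
    (hher : F.IsHereditary) (hshem : F.HasShemetkovProperty)
    (h : IsMutuallyPermutableProduct A B) (hA : F.mem A) (hB : F.mem B) {X L : Subgroup G}
    [L.Normal] (hL : L ≠ ⊥) (hAX : A ≤ X) (hX : F.mem X) (hLX : L ≤ X) (hXB : X ⊓ B ≤ L) :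
    F.mem G ∨ X = L := by
  by_cases htop : L ⊔ B = ⊤
  · right
    refine le_antisymm (fun g hg => ?_) hLX
    obtain ⟨l, hl, b, hb, rfl⟩ := Subgroup.mem_sup_of_normal_left.1 (htop ▸ Subgroup.mem_top g)
    refine mul_mem hl (hXB ⟨?_, hb⟩)
    have := mul_mem (inv_mem (hLX hl)) hg
    rwa [inv_mul_cancel_left] at this
  · left
    refine mem_of_product_of_normal_le hform hher hshem (X := X) (Y := L ⊔ B) (N := L)
      (fun g => ?_) hX (hn.mem_normal_sup hher h hA hB L htop) hLX le_sup_left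
      (hn.mem_quotient hform h hA hB L hL)
    obtain ⟨a, ha, b, hb, rfl⟩ := h.exists_mul_eq g
    exact ⟨a, hAX ha, b, Subgroup.mem_sup_right hb, rfl⟩

theorem ClosedBelow.mem_or_normal_sup (hn : F.ClosedBelow (Nat.card G)) (hform : F.IsFormation)
    (hher : F.IsHereditary) (hshem : F.HasShemetkovProperty)
    (h : IsMutuallyPermutableProduct A B) (hA : F.mem A) (hB : F.mem B) {K : Subgroup G}
    (hKB : K ≤ B) (hAK : A ⊓ B ≤ K) (hne : K ≠ B) (hK : K ≠ ⊥)
    (hnorm : ∀ b ∈ B, ∀ k ∈ K, b * k * b⁻¹ ∈ K) :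
    F.mem G ∨ (A ⊔ K).Normal ∧ F.mem (A ⊔ K : Subgroup G) := by
  have hinf := h.mutuallyPermute.sup_inf_eq hAK hKB
  have hKL : K ≤ Subgroup.normalClosure (K : Set G) := Subgroup.subset_normalClosure
  have hmem : F.mem (A ⊔ K : Subgroup G) :=
    hn.mem_sup (h.mutuallyPermute.restrict hAK hKB) hA (hher.mem_of_le hKB hB)
      fun htop => hne (by rw [← hinf, htop, top_inf_eq])
  refine (hn.mem_or_normal hform hher hshem h hA hB (X := A ⊔ K)
    (L := Subgroup.normalClosure (K : Set G)) (fun hb => hK (le_bot_iff.1 (hb ▸ hKL)))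
    le_sup_left hmem (h.normalClosure_le hnorm) (hinf.le.trans hKL)).imp_right fun he => ⟨?_, hmem⟩
  rw [he]
  infer_instance

theorem mem_of_normal_of_inf_eq_bot (hform : F.IsFormation) (hher : F.IsHereditary)
    (hshem : F.HasShemetkovProperty)
    (hsup : ∀ (G : Type u) [Group G] [Finite G],
      IsSchmidtGroup G → IsSupersoluble G → groupPrimes G ⊆ F.primes → F.mem G)
    (h : IsMutuallyPermutableProduct A B) (hA : F.mem A) (hB : F.mem B) (hdisj : A ⊓ B = ⊥)
    (hAn : A.Normal) : F.mem G := by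
  refine mem_of_normal_complement hform hher hshem hsup h.exists_mul_eq hA hB fun b hb K hK x hx => ?_
  obtain ⟨x', hx', b', hb', e⟩ := (h.right_permutes K hK).exists_mul_eq hb hx
  -- Normality of `A` puts this element in `A`; the trivial intersection then gives `b' = b`, so `b`
  -- normalizes `K`.
  have h1 : b' * b⁻¹ ∈ A ⊓ B := by
    refine ⟨?_, B.mul_mem hb' (B.inv_mem hb)⟩
    have h2 := mul_mem (inv_mem (hK hx')) (hAn.conj_mem x (hK hx) b)
    rwa [e, mul_assoc, inv_mul_cancel_left] at h2
  rw [hdisj, Subgroup.mem_bot] at h1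
  rw [e, mul_assoc, h1, mul_one]
  exact hx'

theorem ClosedBelow.mem_of_isSimpleGroup (hn : F.ClosedBelow (Nat.card G)) (hform : F.IsFormation)
    (hher : F.IsHereditary) (hshem : F.HasShemetkovProperty)
    (hsup : ∀ (G : Type u) [Group G] [Finite G],
      IsSchmidtGroup G → IsSupersoluble G → groupPrimes G ⊆ F.primes → F.mem G)
    (h : IsMutuallyPermutableProduct A B) (hA : F.mem A) (hB : F.mem B) (hdisj : A ⊓ B = ⊥)
    (hsimple : IsSimpleGroup B) : F.mem G := by
  rcases h.normalCore_ne_bot_or_normal hdisj hsimple with hcore | hBn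
  · refine (hn.mem_or_normal hform hher hshem h hA hB hcore le_rfl hA A.normalCore_le
      (hdisj.le.trans bot_le)).elim id fun he => ?_
    exact mem_of_normal_of_inf_eq_bot hform hher hshem hsup h hA hB hdisj (he ▸ inferInstance)
  · exact mem_of_normal_of_inf_eq_bot hform hher hshem hsup h.symm hB hA (by rwa [inf_comm]) hBn

theorem ClosedBelow.mem (hn : F.ClosedBelow (Nat.card G)) (hform : F.IsFormation)
    (hher : F.IsHereditary) (hshem : F.HasShemetkovProperty)
    (hsup : ∀ (G : Type u) [Group G] [Finite G],
      IsSchmidtGroup G → IsSupersoluble G → groupPrimes G ⊆ F.primes → F.mem G)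
    (h : IsMutuallyPermutableProduct A B) (hA : F.mem A) (hB : F.mem B) : F.mem G := by
  by_cases hBA : B ≤ A
  · have := h.sup_eq_top
    rw [sup_eq_left.2 hBA] at this
    exact mem_top_iff.1 (this ▸ hA)
  by_cases hAB : A ≤ B
  · have := h.sup_eq_top
    rw [sup_eq_right.2 hAB] at this
    exact mem_top_iff.1 (this ▸ hB)
  by_cases hs : A ⊓ B = ⊥ ∧ IsSimpleGroup B
  · exact hn.mem_of_isSimpleGroup hform hher hshem hsup h hA hB hs.1 hs.2
  by_cases hs' : B ⊓ A = ⊥ ∧ IsSimpleGroup A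
  · exact hn.mem_of_isSimpleGroup hform hher hshem hsup h.symm hB hA hs'.1 hs'.2
  rw [not_and_or] at hs hs'
  obtain ⟨K, hKB, hK, hKne, hKbot, hKn⟩ := exists_normalized_ge_inf h.mutuallyPermute hBA hs
    (by rintro rfl; exact hBA bot_le)
  obtain ⟨H, hHA, hH, hHne, hHbot, hHn⟩ := exists_normalized_ge_inf h.symm.mutuallyPermute hAB hs'
    (by rintro rfl; exact hAB bot_le)
  rcases hn.mem_or_normal_sup hform hher hshem h hA hB hKB hK hKne hKbot hKn with hG | ⟨hXn, hX⟩
  · exact hG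
  rcases hn.mem_or_normal_sup hform hher hshem h.symm hB hA hHA hH hHne hHbot hHn with
    hG | ⟨hYn, hY⟩
  · exact hG
  -- This intersection is normal, and it is nontrivial because it contains `K`; the quotient by it
  -- is therefore in `F` by induction.
  refine mem_of_product_of_normal_le hform hher hshem (N := (A ⊔ K) ⊓ (B ⊔ H)) (fun g => ?_) hX hY
    inf_le_left inf_le_right (hn.mem_quotient hform h hA hB _ fun hb => hKbot ?_)
  · obtain ⟨a, ha, b, hb, rfl⟩ := h.exists_mul_eq g
    exact ⟨a, Subgroup.mem_sup_left ha, b, Subgroup.mem_sup_left hb, rfl⟩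
  · rw [← le_bot_iff, ← hb]
    exact le_inf le_sup_right (hKB.trans le_sup_left)

end

theorem closedUnderMutuallyPermutableProducts (hform : F.IsFormation) (hher : F.IsHereditary)
    (hshem : F.HasShemetkovProperty)
    (hsup : ∀ (G : Type u) [Group G] [Finite G],
      IsSchmidtGroup G → IsSupersoluble G → groupPrimes G ⊆ F.primes → F.mem G) :
    F.ClosedUnderMutuallyPermutableProducts := by
  have key : ∀ n, F.ClosedBelow n := by
    intro n
    induction n with
    | zero => exact fun G _ _ hG => absurd hG (Nat.not_lt_zero _)
    | succ n ih =>
      intro G _ _ hG A B h hA hB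
      refine ClosedBelow.mem (fun G' _ _ hG' => ih G' (by omega)) hform hher hshem hsup h hA hB
  exact fun G _ _ A B h hA hB => key _ G (Nat.lt_succ_self _) A B h hA hB

end FiniteGroupClass

theorem mainTheorem6 (F : FiniteGroupClass.{u}) (hform : F.IsFormation)
    (hher : F.IsHereditary) (hshem : F.HasShemetkovProperty) :
    F.ClosedUnderMutuallyPermutableProducts ↔
      ∀ (G : Type u) [Group G] [Finite G],
        IsSchmidtGroup G → IsSupersoluble G → groupPrimes G ⊆ F.primes → F.mem G := by
  exact ⟨fun h _ _ _ hG hs hp =>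
      FiniteGroupClass.mem_of_isSupersoluble hher hshem h hG hs hp,
    FiniteGroupClass.closedUnderMutuallyPermutableProducts hform hher hshem⟩
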